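/- Work in the hyperbolic plane $\mathbb H$. For $n\ge 4$, an ideal $n$-gon is the polygon spanned by $n$ distinct points of $\partial\mathbb H$; its sides are the $n$ complete geodesics joining cyclically consecutive vertices. For two non-adjacent sides, the geodesic segment that realizes the distance between them (their common perpendicular) is called an orthogeodesic. A set of pairwise disjoint orthogeodesics of an ideal polygon which is maximal with respect to inclusion is called an orthogeodesic decomposition. **Theorem.** For every $n\ge 4$ there is a constant $O_n$ such that every ideal $n$-gon admits an orthogeodesic decomposition $\mu_1,\dots,\mu_{n-3}$, consisting of $n-3$ distinct orthogeodesics, each of length at most $O_n$. Let $O_n$ denote the smallest real number such that every ideal $n$-gon has an orthogeodesic decomposition all of whose orthogeodesics have length at most $O_n$ (this minimum exists). Then $$ 2\,\mathrm{arcsinh}\left(\frac{\sqrt3}{2}\cot\left(\frac{\pi}{n}\right)\right)\;\le\; O_n\;\le\; 2\,\mathrm{arccosh}\left(\frac{1}{\sin(\pi/n)}\right)\qquad(n\ge 4), $$ and in particular $$ \lim_{n\to\infty}\frac{O_n}{2\log n}=1 . $$ -/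

import Mathlib

/-- The complete geodesic of the hyperbolic plane `ℍ` (upper half-plane model) with ideal endpoints
`a` and `b` in `∂ℍ = ℝ ∪ {∞}`, where `∞` is the element `⊤` of `WithTop ℝ`. For distinct real `a`, `b`
the equation is that of the half-circle with diameter `[a, b]`; if one endpoint is `∞`, the geodesic
is a vertical half-line. -/
def hypGeodesic : WithTop ℝ → WithTop ℝ → Set UpperHalfPlane
  | some a, some b => {z | (z.re - a) * (z.re - b) + z.im ^ 2 = 0}
  | some a, none => {z | z.re = a}
  | none, some b => {z | z.re = b}
  | none, none => ∅

/-- The geodesic segment between two points of the hyperbolic plane. -/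
def hypSegment (p q : UpperHalfPlane) : Set UpperHalfPlane :=
  {z | dist p z + dist z q = dist p q}

/-- An ideal `n`-gon of the hyperbolic plane, given by its `n` vertices in `∂ℍ = ℝ ∪ {∞}`. They are
listed in increasing order (with `∞` last), which is their cyclic order on the circle `∂ℍ`; each set of
`n` distinct ideal points has exactly one such listing. -/
structure IdealPolygon (n : ℕ) where
  vertex : Fin n → WithTop ℝ
  strictMono_vertex : StrictMono vertex

namespace IdealPolygon

variable {n : ℕ}

/-- The `i`-th side: the complete geodesic from the `i`-th vertex to the cyclically next one. -/
def side (P : IdealPolygon n) (i : Fin n) : Set UpperHalfPlane :=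
  hypGeodesic (P.vertex i) (P.vertex (finRotate n i))

/-- An orthogeodesic of `P`: the geodesic segment that realizes the distance between two non-adjacent
sides (equivalently, their common perpendicular). Since it joins an unordered pair of sides, the two
sides are listed with `i < j`. -/
structure Orthogeodesic (P : IdealPolygon n) where
  /-- index of the first side -/
  i : Fin n
  /-- index of the second side -/
  j : Fin n
  lt : i < j
  nonadjacent : j ≠ finRotate n i ∧ i ≠ finRotate n j
  /-- endpoint on the first side -/
  p : UpperHalfPlane
  /-- endpoint on the second side -/
  q : UpperHalfPlane
  p_mem : p ∈ P.side i
  q_mem : q ∈ P.side j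
  dist_le : ∀ x ∈ P.side i, ∀ y ∈ P.side j, dist p q ≤ dist x y

/-- The orthogeodesic as a set of points, endpoints included. -/
def Orthogeodesic.carrier {P : IdealPolygon n} (μ : P.Orthogeodesic) : Set UpperHalfPlane :=
  hypSegment μ.p μ.q

/-- The hyperbolic length of an orthogeodesic. -/
noncomputable def Orthogeodesic.length {P : IdealPolygon n} (μ : P.Orthogeodesic) : ℝ :=
  dist μ.p μ.q

/-- An orthogeodesic decomposition: a set of pairwise disjoint orthogeodesics which is maximal with
respect to inclusion. -/
def IsOrthogeodesicDecomposition (P : IdealPolygon n) (D : Set P.Orthogeodesic) : Prop :=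
  Maximal (fun E : Set P.Orthogeodesic =>
    E.Pairwise fun μ ν => Disjoint μ.carrier ν.carrier) D

end IdealPolygon

/-- `L` is an admissible bound for `n` if each ideal `n`-gon has an orthogeodesic decomposition all of
whose orthogeodesics have length at most `L`. -/
def IsOrthoBound (n : ℕ) (L : ℝ) : Prop :=
  ∀ P : IdealPolygon n, ∃ D : Set P.Orthogeodesic,
    P.IsOrthogeodesicDecomposition D ∧ ∀ μ ∈ D, μ.length ≤ L

/-- The optimal constant `O_n`. -/
noncomputable def orthoConst (n : ℕ) : ℝ := sInf {L : ℝ | IsOrthoBound n L}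

/-! A point `z` of the hyperbolic plane is encoded by the positive definite form `hypForm z` of
determinant one on `ℝ²`, and an ideal point by a vector up to scaling. The geodesic with ideal
endpoints `u`, `v` is then `hypForm z u v = 0`, distances are Lorentzian products of forms, and all
of the geometry becomes algebra with the determinant `bracket`.

Decompositions are triangulations. The n sides of the ideal polygon serve as vertices of a
combinatorial n-gon, and an orthogeodesic is one of its diagonals. Two distinct orthogeodesics meet
exactly when the diagonals cross, so orthogeodesic decompositions correspond to triangulations,
which have n - 3 diagonals (`isOrthogeodesicDecomposition_iff`, `ncard_eq`). The length of an
orthogeodesic is a cross-ratio of four vertices (`sq_cosh_half_length`).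

Upper bound. Call two sides related if one disc inside the polygon touches both. The adjacent sides
0 and n - 1 are related, through a disc deep in their common cusp. A disc touching sides s and t can
be pushed along their bisector until it touches a third side k between them (`exists_between`), so
the relation contains a triangulation. The half-angles under which the centre of a disc sees the n
sides add up to π, so one of them is at least π/n. This bounds the radius of the disc, and the
radius bounds the distance between two touched sides (`exists_sideCot_le`, `cross_ratio_le`).

Lower bound. Every triangulation has a central triangle, none of whose three gaps exceeds n/2. It
therefore suffices to find one polygon in which every central triangle has a long edge. If 3 does
not divide n, the regular polygon works: some edge of the triangle has gaps strictly larger than n/3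
on both sides. If n = 3m, the regular polygon just misses because of the triangle with gaps m, m, m,
and it is replaced by one with 2m sides of a smaller angle and m sides of a larger one
(`arsinh_le_of_block`).

The minimum is attained because each polygon has finitely many orthogeodesics, and both bounds are 2
log n up to a bounded error. -/

/-! ### Triangulations of a combinatorial polygon. -/

/-- A diagonal of the combinatorial `n`-gon with vertices `0, …, n - 1`. -/
def IsDiagonal (n : ℕ) (e : ℕ × ℕ) : Prop :=
  e.1 + 2 ≤ e.2 ∧ e.2 < n ∧ ¬ (e.1 = 0 ∧ e.2 + 1 = n)

/-- Two pairs of indices that interleave. -/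
def Crosses (e f : ℕ × ℕ) : Prop :=
  (e.1 < f.1 ∧ f.1 < e.2 ∧ e.2 < f.2) ∨ (f.1 < e.1 ∧ e.1 < f.2 ∧ f.2 < e.2)

/-- A triangulation of the combinatorial `n`-gon: a maximal set of noncrossing diagonals. -/
structure IsTriangulation (n : ℕ) (D : Set (ℕ × ℕ)) : Prop where
  diag : ∀ e ∈ D, IsDiagonal n e
  noncrossing : ∀ e ∈ D, ∀ f ∈ D, ¬ Crosses e f
  maximal : ∀ e, IsDiagonal n e → (∀ f ∈ D, ¬ Crosses e f) → e ∈ D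

/-- The pair `(a, b)` is a diagonal of `D` or a side of the combinatorial `n`-gon. -/
def IsEdge (n : ℕ) (D : Set (ℕ × ℕ)) (a b : ℕ) : Prop :=
  a < b ∧ b < n ∧ (a + 1 = b ∨ (a = 0 ∧ b + 1 = n) ∨ (a, b) ∈ D)

namespace IsTriangulation

variable {n : ℕ} {D : Set (ℕ × ℕ)}

theorem not_crosses_edge (hD : IsTriangulation n D) {a b c d : ℕ} (h : IsEdge n D a b)
    (hcd : (c, d) ∈ D) : ¬ Crosses (a, b) (c, d) := by
  obtain ⟨h1, h2, h3 | ⟨h3, h4⟩ | h3⟩ := h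
  · have := hD.diag _ hcd
    simp only [Crosses, IsDiagonal] at *
    omega
  · have := hD.diag _ hcd
    simp only [Crosses, IsDiagonal] at *
    omega
  · exact hD.noncrossing _ h3 _ hcd

/-- The apex is the last `k` before `j` that is joined to `i`. A diagonal crossing `(k, j)` would
cross `(i, j)` or `(i, k)`, or would join `i` to a later vertex. Hence `(k, j)` is an edge by
maximality. -/
theorem exists_triangle (hD : IsTriangulation n D) {i j : ℕ} (h : IsEdge n D i j)
    (hij : i + 2 ≤ j) : ∃ k, i < k ∧ k < j ∧ IsEdge n D i k ∧ IsEdge n D k j := by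
  classical
  have hjn := h.2.1
  let S := (Finset.Ioo i j).filter fun k => IsEdge n D i k
  have hS : S.Nonempty := ⟨i + 1, by
    simp only [S, Finset.mem_filter, Finset.mem_Ioo]
    exact ⟨by omega, by omega, by omega, Or.inl rfl⟩⟩
  obtain ⟨k, hkS, hk⟩ := S.exists_max_image id hS
  simp only [S, Finset.mem_filter, Finset.mem_Ioo, id] at hkS hk
  obtain ⟨⟨hik, hkj⟩, hek⟩ := hkS
  refine ⟨k, hik, hkj, hek, hkj, hjn, ?_⟩
  by_cases hk1 : k + 1 = j
  · exact Or.inl hk1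
  refine Or.inr (Or.inr (hD.maximal _ ⟨by simp only; omega, hjn, by simp only; omega⟩ ?_))
  rintro ⟨a, b⟩ hab hcr
  have h1 := hD.not_crosses_edge h hab
  have h2 := hD.not_crosses_edge hek hab
  have hdab := hD.diag _ hab
  simp only [Crosses, IsDiagonal] at hcr h1 h2 hdab
  rcases hcr with hcr | hcr
  · omega
  · have hai : a = i := by omega
    subst hai
    have := hk b ⟨⟨by omega, by omega⟩, by omega, by omega, Or.inr (Or.inr hab)⟩
    omega

/-- The diagonals of `D`, together with the pair `(0, n - 1)`, that lie between `i` and `j`. -/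
def between (n : ℕ) (D : Set (ℕ × ℕ)) (i j : ℕ) : Set (ℕ × ℕ) :=
  {e | (e ∈ D ∨ e = (0, n - 1)) ∧ i ≤ e.1 ∧ e.2 ≤ j ∧ e.1 + 2 ≤ e.2}

theorem between_finite (i j : ℕ) : (between n D i j).Finite :=
  ((Finset.range (j + 1)) ×ˢ (Finset.range (j + 1))).finite_toSet.subset fun e he => by
    obtain ⟨-, h1, h2, h3⟩ := he
    simp only [Finset.coe_product, Finset.coe_range, Set.mem_prod, Set.mem_Iio]
    omega

/-- Induction by cutting along the triangle below `(i, j)`. Adjoining `(0, n - 1)` in `between` lets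
every edge of gap at least two count itself, including the one side that is not of the form `(a, a +
1)`. -/
theorem ncard_between (hD : IsTriangulation n D) (m : ℕ) : ∀ {i j : ℕ}, IsEdge n D i j →
    j = i + m + 1 → (between n D i j).ncard = m := by
  induction m using Nat.strong_induction_on with
  | _ m ih =>
  intro i j h hm
  rcases Nat.eq_zero_or_pos m with rfl | hpos
  · rw [Set.ncard_eq_zero (between_finite i j), Set.eq_empty_iff_forall_notMem]
    rintro e ⟨-, h1, h2, h3⟩
    omega
  obtain ⟨k, hik, hkj, e1, e2⟩ := hD.exists_triangle h (by omega)
  have hjn := h.2.1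
  have hsplit : between n D i j = insert (i, j) (between n D i k ∪ between n D k j) := by
    ext ⟨a, b⟩
    simp only [between, Set.mem_ofPred_eq, Set.mem_insert_iff, Set.mem_union, Prod.mk.injEq]
    constructor
    · rintro ⟨hab, ha, hb, hab2⟩
      by_contra hcon
      push Not at hcon
      obtain ⟨hc1, hc2, hc3⟩ := hcon
      have hc2' := fun hle => hc2 hab ha hle
      have hc3' := fun hle => hc3 hab hle hb
      rcases hab with hab | ⟨rfl, rfl⟩
      · have x1 := hD.not_crosses_edge e1 hab
        have x2 := hD.not_crosses_edge e2 hab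
        simp only [Crosses] at x1 x2
        omega
      · omega
    · rintro (⟨rfl, rfl⟩ | ⟨hab, h1, h2, h3⟩ | ⟨hab, h1, h2, h3⟩)
      · refine ⟨?_, le_rfl, le_rfl, by omega⟩
        rcases h.2.2 with h3 | h3 | h3
        · omega
        · right; omega
        · exact Or.inl h3
      · exact ⟨hab, h1, by omega, h3⟩
      · exact ⟨hab, by omega, h2, h3⟩
  have hd : Disjoint (between n D i k) (between n D k j) := by
    rw [Set.disjoint_left]
    rintro e ⟨-, h1, h2, h3⟩ ⟨-, h4, h5, h6⟩
    omega
  rw [hsplit, Set.ncard_insert_of_notMem ?_ ((between_finite _ _).union (between_finite _ _)),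
    Set.ncard_union_eq hd (between_finite _ _) (between_finite _ _),
    ih (k - i - 1) (by omega) e1 (by omega), ih (j - k - 1) (by omega) e2 (by omega)]
  · omega
  · rintro (⟨-, h1, h2, h3⟩ | ⟨-, h1, h2, h3⟩) <;> simp only at h1 h2 h3 <;> omega

theorem ncard_eq (hn : 3 ≤ n) (hD : IsTriangulation n D) : D.ncard = n - 3 := by
  have h := hD.ncard_between (n - 2) (i := 0) (j := n - 1)
    ⟨by omega, by omega, Or.inr (Or.inl ⟨rfl, by omega⟩)⟩ (by omega)
  have hnot : (0, n - 1) ∉ D := fun hmem => by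
    exact (hD.diag _ hmem).2.2 ⟨rfl, by simp only; omega⟩
  have heq : between n D 0 (n - 1) = insert (0, n - 1) D := by
    ext e
    simp only [between, Set.mem_ofPred_eq, Set.mem_insert_iff]
    constructor
    · tauto
    · rintro (rfl | he)
      · exact ⟨Or.inr rfl, le_rfl, le_rfl, by simp only; omega⟩
      · have := hD.diag _ he
        simp only [IsDiagonal] at this
        exact ⟨Or.inl he, by omega, by omega, by omega⟩
  have hfin : D.Finite := (between_finite (n := n) (D := D) 0 (n - 1)).subset (by
    rw [heq]; exact Set.subset_insert _ _)
  rw [heq, Set.ncard_insert_of_notMem hnot hfin] at h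
  omega

/-- Some triangle of a triangulation has all its combinatorial gaps at most half of `n`. -/
theorem exists_central_triangle (hn : 3 ≤ n) (hD : IsTriangulation n D) :
    ∃ i j k, IsEdge n D i j ∧ IsEdge n D j k ∧ IsEdge n D i k ∧
      2 * (j - i) ≤ n ∧ 2 * (k - j) ≤ n ∧ n ≤ 2 * (k - i) := by
  classical
  let S := ((Finset.range n) ×ˢ (Finset.range n)).filter fun e =>
    IsEdge n D e.1 e.2 ∧ n ≤ 2 * (e.2 - e.1)
  have hS : S.Nonempty := ⟨(0, n - 1), by
    simp only [S, Finset.mem_filter, Finset.mem_product, Finset.mem_range]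
    exact ⟨by omega, ⟨by omega, by omega, Or.inr (Or.inl ⟨rfl, by omega⟩)⟩, by omega⟩⟩
  -- Among the edges of gap at least `n / 2` take a shortest one. The two other edges of the
  -- triangle below it are shorter, so their gaps are below `n / 2`.
  obtain ⟨⟨i, k⟩, hik, hmin⟩ := S.exists_min_image (fun e => e.2 - e.1) hS
  simp only [S, Finset.mem_filter, Finset.mem_product, Finset.mem_range, Prod.forall] at hik hmin
  obtain ⟨j, hij, hjk, e1, e2⟩ := hD.exists_triangle hik.2.1 (by omega)
  refine ⟨i, j, k, e1, e2, hik.2.1, ?_, ?_, hik.2.2⟩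
  · by_contra hcon
    have := hmin i j ⟨by omega, e1, by omega⟩
    omega
  · by_contra hcon
    have := hmin j k ⟨by omega, e2, by omega⟩
    omega

end IsTriangulation

/-- Recursive subdivision. For `m ≥ 2` the set `T` contains the top edge `(i, i + m)`, and this is
what makes the union maximal: any other pair straddling `k` crosses `(i, k)` or `(k, i + m)`. -/
theorem exists_triangulation_between {n : ℕ} {R : ℕ → ℕ → Prop}
    (hR : ∀ i j, i + 2 ≤ j → j < n → R i j → ∃ k, i < k ∧ k < j ∧ R i k ∧ R k j) (m : ℕ) :
    ∀ i, i + m < n → R i (i + m) → ∃ T : Set (ℕ × ℕ),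
      (∀ e ∈ T, i ≤ e.1 ∧ e.1 + 2 ≤ e.2 ∧ e.2 ≤ i + m ∧ R e.1 e.2) ∧
      (∀ e ∈ T, ∀ f ∈ T, ¬ Crosses e f) ∧
      (∀ e : ℕ × ℕ, i ≤ e.1 → e.1 + 2 ≤ e.2 → e.2 ≤ i + m →
        (∀ f ∈ T, ¬ Crosses e f) → e ∈ T) := by
  induction m using Nat.strong_induction_on with
  | _ m ih =>
  intro i hi hRi
  by_cases hm : m < 2
  · refine ⟨∅, by simp, by simp, fun e h1 h2 h3 => ?_⟩
    omega
  obtain ⟨k, hik, hkj, r1, r2⟩ := hR i (i + m) (by omega) hi hRi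
  obtain ⟨T1, a1, b1, c1⟩ := ih (k - i) (by omega) i (by omega)
    (by rwa [show i + (k - i) = k by omega])
  obtain ⟨T2, a2, b2, c2⟩ := ih (i + m - k) (by omega) k (by omega)
    (by rwa [show k + (i + m - k) = i + m by omega])
  rw [show i + (k - i) = k by omega] at a1 c1
  rw [show k + (i + m - k) = i + m by omega] at a2 c2
  have d1 : i + 2 ≤ k → (i, k) ∈ T1 := fun h => c1 _ le_rfl h le_rfl fun f hf hc => by
    have := a1 f hf
    simp only [Crosses] at hc
    omega
  have d2 : k + 2 ≤ i + m → (k, i + m) ∈ T2 := fun h => c2 _ le_rfl h le_rfl fun f hf hc => by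
    have := a2 f hf
    simp only [Crosses] at hc
    omega
  refine ⟨insert (i, i + m) (T1 ∪ T2), ?_, ?_, ?_⟩
  · rintro e (rfl | he | he)
    · exact ⟨le_rfl, by simp only; omega, le_rfl, hRi⟩
    · obtain ⟨h1, h2, h3, h4⟩ := a1 e he
      exact ⟨h1, h2, by omega, h4⟩
    · obtain ⟨h1, h2, h3, h4⟩ := a2 e he
      exact ⟨by omega, h2, h3, h4⟩
  · have key : ∀ e ∈ insert (i, i + m) (T1 ∪ T2), i ≤ e.1 ∧ e.2 ≤ i + m ∧
        (e = (i, i + m) ∨ e.2 ≤ k ∧ e ∈ T1 ∨ k ≤ e.1 ∧ e ∈ T2) := by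
      rintro e (rfl | he | he)
      · exact ⟨le_rfl, le_rfl, Or.inl rfl⟩
      · have := a1 e he
        exact ⟨by omega, by omega, Or.inr (Or.inl ⟨by omega, he⟩)⟩
      · have := a2 e he
        exact ⟨by omega, by omega, Or.inr (Or.inr ⟨by omega, he⟩)⟩
    intro e he f hf
    obtain ⟨e1, e2, e3⟩ := key e he
    obtain ⟨f1, f2, f3⟩ := key f hf
    rcases e3 with rfl | e3 | e3 <;> rcases f3 with rfl | f3 | f3 <;>
      first
      | exact b1 _ e3.2 _ f3.2
      | exact b2 _ e3.2 _ f3.2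
      | (simp only [Crosses]; omega)
  · rintro ⟨a, b⟩ h1 h2 h3 hf
    simp only at h1 h2 h3
    by_cases hb : b ≤ k
    · exact Or.inr (Or.inl (c1 _ h1 h2 hb fun f hfT => hf f (Or.inr (Or.inl hfT))))
    by_cases ha : k ≤ a
    · exact Or.inr (Or.inr (c2 _ ha h2 h3 fun f hfT => hf f (Or.inr (Or.inr hfT))))
    left
    by_contra hne
    rw [Prod.mk.injEq] at hne
    by_cases hai : a = i
    · refine hf _ (Or.inr (Or.inr (d2 (by omega)))) ?_
      simp only [Crosses]
      omega
    · refine hf _ (Or.inr (Or.inl (d1 (by omega)))) ?_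
      simp only [Crosses]
      omega

/-- A relation on indices that holds for `(0, n - 1)` and can be refined by triangles contains a
triangulation. -/
theorem exists_triangulation {n : ℕ} (hn : 3 ≤ n) {R : ℕ → ℕ → Prop} (h0 : R 0 (n - 1))
    (hR : ∀ i j, i + 2 ≤ j → j < n → R i j → ∃ k, i < k ∧ k < j ∧ R i k ∧ R k j) :
    ∃ D, IsTriangulation n D ∧ ∀ e ∈ D, R e.1 e.2 := by
  obtain ⟨T, h1, h2, h3⟩ := exists_triangulation_between hR (n - 1) 0 (by omega) (by simpa using h0)
  refine ⟨T \ {(0, n - 1)}, ⟨fun e he => ?_, fun e he f hf => h2 e he.1 f hf.1, ?_⟩,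
    fun e he => (h1 e he.1).2.2.2⟩
  · have := h1 e he.1
    have hne : ¬ (e.1 = 0 ∧ e.2 = n - 1) := fun hh => he.2 (Prod.ext hh.1 hh.2)
    exact ⟨this.2.1, by omega, by omega⟩
  · rintro e ⟨he1, he2, he3⟩ hf
    refine ⟨h3 e (by omega) he1 (by omega) fun f hfT => ?_, ?_⟩
    · by_cases hfe : f = (0, n - 1)
      · subst hfe
        simp only [Crosses]
        omega
      · exact hf f ⟨hfT, hfe⟩
    · rintro rfl
      exact he3 ⟨rfl, by simp only; omega⟩

/-! ### Points of the hyperbolic plane as binary quadratic forms. -/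

open UpperHalfPlane

/-- The determinant form on `ℝ²`, signed so that it is positive on lifts of increasing reals. -/
def bracket (u v : ℝ × ℝ) : ℝ := u.2 * v.1 - u.1 * v.2

/-- The positive definite symmetric form on `ℝ²` attached to a point of the upper half-plane. -/
noncomputable def hypForm (z : ℍ) (u v : ℝ × ℝ) : ℝ :=
  (u.1 * v.1 - (u.1 * v.2 + u.2 * v.1) * z.re + u.2 * v.2 * (z.re ^ 2 + z.im ^ 2)) / z.im

theorem hypForm_comm (z : ℍ) (u v : ℝ × ℝ) : hypForm z u v = hypForm z v u := by
  unfold hypForm; ring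

theorem bracket_swap (u v : ℝ × ℝ) : bracket u v = -bracket v u := by
  unfold bracket; ring

theorem bracket_self (u : ℝ × ℝ) : bracket u u = 0 := by
  unfold bracket; ring

theorem bracket_neg_left (u v : ℝ × ℝ) : bracket (-u) v = -bracket u v := by
  simp only [bracket, Prod.fst_neg, Prod.snd_neg]; ring

theorem bracket_neg_right (u v : ℝ × ℝ) : bracket u (-v) = -bracket u v := by
  simp only [bracket, Prod.fst_neg, Prod.snd_neg]; ring

theorem hypForm_neg_left (z : ℍ) (u v : ℝ × ℝ) : hypForm z (-u) v = -hypForm z u v := by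
  simp only [hypForm, Prod.fst_neg, Prod.snd_neg]; ring

theorem hypForm_neg_right (z : ℍ) (u v : ℝ × ℝ) : hypForm z u (-v) = -hypForm z u v := by
  simp only [hypForm, Prod.fst_neg, Prod.snd_neg]; ring

theorem bracket_mul_bracket (u v x y : ℝ × ℝ) :
    bracket u v * bracket x y = bracket u x * bracket v y - bracket u y * bracket v x := by
  unfold bracket; ring

/-- The form of `z` has determinant one, so `z` is a point of the hyperboloid in the Lorentzian
space of quadratic forms whose norm is the determinant. -/
theorem hypForm_gram (z : ℍ) (u v : ℝ × ℝ) :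
    hypForm z u u * hypForm z v v - hypForm z u v ^ 2 = bracket u v ^ 2 := by
  have := z.im_ne_zero
  unfold hypForm bracket
  field_simp
  ring

theorem hypForm_self_nonneg (z : ℍ) (u : ℝ × ℝ) : 0 ≤ hypForm z u u := by
  unfold hypForm
  refine div_nonneg ?_ z.im_pos.le
  nlinarith [sq_nonneg (u.1 - u.2 * z.re), sq_nonneg (u.2 * z.im)]

theorem hypForm_self_pos (z : ℍ) {u v : ℝ × ℝ} (h : bracket u v ≠ 0) : 0 < hypForm z u u := by
  have h1 := hypForm_gram z u v
  have h2 := hypForm_self_nonneg z u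
  have h3 : 0 < bracket u v ^ 2 := by positivity
  rcases h2.eq_or_lt with h0 | h0
  · rw [← h0] at h1
    nlinarith [sq_nonneg (hypForm z u v)]
  · exact h0

/-- Expansion of the form in the basis `u`, `v`. -/
theorem sq_bracket_mul_hypForm (z : ℍ) (u v x y : ℝ × ℝ) :
    bracket u v ^ 2 * hypForm z x y =
      -(bracket x v * bracket v y) * hypForm z u u - bracket x u * bracket u y * hypForm z v v +
        (bracket x v * bracket u y + bracket x u * bracket v y) * hypForm z u v := by
  have := z.im_ne_zero
  unfold hypForm bracket
  field_simp
  ring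

/-- A geodesic whose ideal endpoints lie between `x` and `y` is on one side of the geodesic from `x`
to `y`. -/
theorem hypForm_neg_of_between (z : ℍ) {u v x y : ℝ × ℝ} (h0 : hypForm z u v = 0)
    (huv : 0 < bracket u v) (hxu : 0 ≤ bracket x u) (hxv : 0 < bracket x v)
    (huy : 0 < bracket u y) (hvy : 0 ≤ bracket v y) (hne : 0 < bracket x u ∨ 0 < bracket v y) :
    hypForm z x y < 0 := by
  have h1 := sq_bracket_mul_hypForm z u v x y
  have h2 := hypForm_self_pos z huv.ne'
  have h3 : 0 < hypForm z v v := hypForm_self_pos z (v := u) (by rw [bracket_swap]; linarith)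
  rw [h0, mul_zero, add_zero] at h1
  have h4 : bracket u v ^ 2 * hypForm z x y < 0 := by
    have e1 : 0 ≤ bracket x v * bracket v y * hypForm z u u := by positivity
    have e2 : 0 ≤ bracket x u * bracket u y * hypForm z v v := by positivity
    rcases hne with h | h
    · have : 0 < bracket x u * bracket u y * hypForm z v v := by positivity
      linarith
    · have : 0 < bracket x v * bracket v y * hypForm z u u := by positivity
      linarith
  by_contra hcon
  push Not at hcon
  have : 0 ≤ bracket u v ^ 2 * hypForm z x y := by positivity
  linarith

/-- The right-hand side polarizes the Gram determinant: it is the Lorentzian product of two points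
of the hyperboloid. -/
theorem sq_bracket_mul_cosh_dist (z w : ℍ) (u v : ℝ × ℝ) :
    bracket u v ^ 2 * Real.cosh (dist z w) =
      (hypForm z u u * hypForm w v v + hypForm z v v * hypForm w u u -
        2 * hypForm z u v * hypForm w u v) / 2 := by
  have h1 := z.im_ne_zero
  have h2 := w.im_ne_zero
  have h3 : dist (z : ℂ) w ^ 2 = (z.re - w.re) ^ 2 + (z.im - w.im) ^ 2 := by
    rw [Complex.dist_eq, Complex.sq_norm, Complex.normSq_apply]
    simp only [Complex.sub_re, Complex.sub_im, coe_re, coe_im]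
    ring
  rw [UpperHalfPlane.cosh_dist, h3]
  unfold hypForm bracket
  field_simp
  ring

theorem eq_of_hypForm_eq {z w : ℍ} {u v : ℝ × ℝ} (h : bracket u v ≠ 0)
    (h11 : hypForm z u u = hypForm w u u) (h12 : hypForm z u v = hypForm w u v)
    (h22 : hypForm z v v = hypForm w v v) : z = w := by
  have h1 := sq_bracket_mul_cosh_dist z w u v
  have h2 := hypForm_gram w u v
  rw [h11, h12, h22] at h1
  have h3 : bracket u v ^ 2 * (Real.cosh (dist z w) - 1) = 0 := by linarith
  have h4 : Real.cosh (dist z w) = 1 := by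
    rcases mul_eq_zero.1 h3 with h5 | h5
    · exact absurd h5 (by positivity)
    · linarith
  have h5 : dist z w = 0 := by
    by_contra hne
    have := (Real.one_lt_cosh).2 hne
    linarith
  exact dist_eq_zero.1 h5

/-- Every positive definite form comes, up to scaling, from a point of the upper half-plane. -/
theorem exists_hypForm_eq {a b c : ℝ} (ha : 0 < a) (hdet : 0 < a * c - b ^ 2) :
    ∃ z : ℍ, ∀ u v : ℝ × ℝ, hypForm z u v =
      (Real.sqrt (a * c - b ^ 2))⁻¹ * (a * (u.1 * v.1) - b * (u.1 * v.2 + u.2 * v.1) +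
        c * (u.2 * v.2)) := by
  set s := Real.sqrt (a * c - b ^ 2) with hs
  have hs0 : 0 < s := Real.sqrt_pos.2 hdet
  have hs2 : s ^ 2 = a * c - b ^ 2 := Real.sq_sqrt hdet.le
  -- The point is the root in the upper half-plane of the quadratic polynomial `a * t ^ 2 - 2 * b *
  -- t + c`.
  refine ⟨⟨⟨b / a, s / a⟩, by simp only; positivity⟩, fun u v => ?_⟩
  have hre : UpperHalfPlane.re ⟨⟨b / a, s / a⟩, by simp only; positivity⟩ = b / a := rfl
  have him : UpperHalfPlane.im ⟨⟨b / a, s / a⟩, by simp only; positivity⟩ = s / a := rfl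
  rw [hypForm, hre, him]
  have hc : c = (s ^ 2 + b ^ 2) / a := by
    rw [hs2]; field_simp; ring
  rw [hc]
  field_simp
  ring

theorem hypForm_eq_combination (z : ℍ) (u v : ℝ × ℝ) :
    hypForm z u v = hypForm z (1, 0) (1, 0) * (u.1 * v.1) +
      hypForm z (1, 0) (0, 1) * (u.1 * v.2 + u.2 * v.1) + hypForm z (0, 1) (0, 1) * (u.2 * v.2) := by
  have := z.im_ne_zero
  simp only [hypForm]
  field_simp
  ring

/-- A null vector orthogonal to a timelike vector vanishes. -/
theorem eq_zero_of_null_of_orthogonal {A B D X Y Z : ℝ} (hX : X ≠ 0) (h : X * Z - Y ^ 2 = 1)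
    (h1 : A * D - B ^ 2 = 0) (h2 : A * Z + D * X - 2 * B * Y = 0) : A = 0 ∧ B = 0 ∧ D = 0 := by
  have h3 : (B * X - A * Y) ^ 2 + A ^ 2 = 0 := by
    linear_combination (-X ^ 2) * h1 + A * X * h2 - A ^ 2 * h
  have hA : A = 0 := by nlinarith [sq_nonneg (B * X - A * Y), sq_nonneg A]
  subst hA
  have hB : B = 0 := by nlinarith [sq_nonneg B]
  subst hB
  have hD : D * X = 0 := by linarith
  exact ⟨rfl, rfl, (mul_eq_zero.1 hD).resolve_right hX⟩

/-- A segment of the hyperboloid lies in the cone over its endpoints: the point at distances `a`,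
`b` from `p`, `q` is `(sinh b * p + sinh a * q) / sinh (a + b)`. The difference `(A, B, D)` of the
two sides is null and orthogonal to the timelike vector `z`, hence zero. -/
theorem exists_combination_of_mem_hypSegment {p q z : ℍ} (hz : z ∈ hypSegment p q) :
    ∃ α β : ℝ, 0 ≤ α ∧ 0 ≤ β ∧ 0 < α + β ∧
      ∀ u v, hypForm z u v = α * hypForm p u v + β * hypForm q u v := by
  have hz' : dist p z + dist z q = dist p q := hz
  by_cases hpq : p = q
  · subst hpq
    have h1 : p = z := by
      have := dist_nonneg (x := p) (y := z)
      have := dist_nonneg (x := z) (y := p)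
      rw [dist_self] at hz'
      exact dist_eq_zero.1 (by linarith)
    subst h1
    exact ⟨1, 0, by simp, by simp, by simp, by simp⟩
  set a := dist p z with ha
  set b := dist z q with hb
  have hd : 0 < a + b := hz'.symm ▸ dist_pos.2 hpq
  have hs : 0 < Real.sinh (a + b) := Real.sinh_pos_iff.2 hd
  have ha0 : 0 ≤ Real.sinh a := Real.sinh_nonneg_iff.2 dist_nonneg
  have hb0 : 0 ≤ Real.sinh b := Real.sinh_nonneg_iff.2 dist_nonneg
  let e₁ : ℝ × ℝ := (1, 0)
  let e₂ : ℝ × ℝ := (0, 1)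
  have hbr : bracket e₁ e₂ ^ 2 = 1 := by simp [bracket, e₁, e₂]
  have c1 := sq_bracket_mul_cosh_dist p z e₁ e₂
  have c2 := sq_bracket_mul_cosh_dist z q e₁ e₂
  have c3 := sq_bracket_mul_cosh_dist p q e₁ e₂
  have gz := hypForm_gram z e₁ e₂
  have gp := hypForm_gram p e₁ e₂
  have gq := hypForm_gram q e₁ e₂
  have hz1 : 0 < hypForm z e₁ e₁ := hypForm_self_pos z (v := e₂) (by simp [bracket, e₁, e₂])
  rw [hbr, one_mul] at c1 c2 c3
  rw [hbr] at gz gp gq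
  rw [← ha] at c1
  rw [← hb] at c2
  rw [← hz'] at c3
  have hsum := Real.sinh_add a b
  have csum := Real.cosh_add a b
  have ida := Real.cosh_sq a
  have idb := Real.cosh_sq b
  set X := hypForm z e₁ e₁
  set Y := hypForm z e₁ e₂
  set Z := hypForm z e₂ e₂
  set Xp := hypForm p e₁ e₁
  set Yp := hypForm p e₁ e₂
  set Zp := hypForm p e₂ e₂
  set Xq := hypForm q e₁ e₁
  set Yq := hypForm q e₁ e₂
  set Zq := hypForm q e₂ e₂
  set S := Real.sinh (a + b)
  set sa := Real.sinh a
  set sb := Real.sinh b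
  set ca := Real.cosh a
  set cb := Real.cosh b
  set C := Real.cosh (a + b)
  let A := S * X - sb * Xp - sa * Xq
  let B := S * Y - sb * Yp - sa * Yq
  let D := S * Z - sb * Zp - sa * Zq
  have k1 : A * D - B ^ 2 = 0 := by
    have : A * D - B ^ 2 = S ^ 2 * (X * Z - Y ^ 2) + sb ^ 2 * (Xp * Zp - Yp ^ 2) +
        sa ^ 2 * (Xq * Zq - Yq ^ 2) - 2 * S * sb * ca - 2 * S * sa * cb + 2 * sa * sb * C := by
      rw [c1, c2, c3]; simp only [A, B, D]; ring
    rw [this, gz, gp, gq, csum, hsum]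
    linear_combination (-sb ^ 2) * ida - sa ^ 2 * idb
  have k2 : A * Z + D * X - 2 * B * Y = 0 := by
    have : A * Z + D * X - 2 * B * Y = 2 * (S * (X * Z - Y ^ 2) - sb * ca - sa * cb) := by
      rw [c1, c2]; simp only [A, B, D]; ring
    rw [this, gz, hsum]; ring
  obtain ⟨hA, hB, hD⟩ := eq_zero_of_null_of_orthogonal hz1.ne' gz k1 k2
  refine ⟨sb / S, sa / S, by positivity, by positivity, ?_, fun u v => ?_⟩
  · have hpos : 0 < sb + sa := by
      by_contra hcon
      have e1 : sa = 0 := by linarith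
      have e2 : sb = 0 := by linarith
      rw [e1, e2] at hsum
      simp at hsum
      exact absurd hsum hs.ne'
    rw [← add_div]; positivity
  · rw [hypForm_eq_combination z, hypForm_eq_combination p, hypForm_eq_combination q]
    have hX : X = sb / S * Xp + sa / S * Xq := by
      have := hA; simp only [A] at this; field_simp; linarith
    have hY : Y = sb / S * Yp + sa / S * Yq := by
      have := hB; simp only [B] at this; field_simp; linarith
    have hZ : Z = sb / S * Zp + sa / S * Zq := by
      have := hD; simp only [D] at this; field_simp; linarith
    change X * _ + Y * _ + Z * _ = sb / S * (Xp * _ + Yp * _ + Zp * _) +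
      sa / S * (Xq * _ + Yq * _ + Zq * _)
    rw [hX, hY, hZ]; ring

/-- The products with `p` and `q` give the hyperbolic cosines of the two partial distances, and
normalization gives their hyperbolic sines. The addition formula then yields equality in the
triangle inequality. -/
theorem mem_hypSegment_of_combination {p q z : ℍ} {α β : ℝ} (hα : 0 ≤ α) (hβ : 0 ≤ β)
    (h : ∀ u v, hypForm z u v = α * hypForm p u v + β * hypForm q u v) : z ∈ hypSegment p q := by
  let e₁ : ℝ × ℝ := (1, 0)
  let e₂ : ℝ × ℝ := (0, 1)
  have hbr : bracket e₁ e₂ ^ 2 = 1 := by simp [bracket, e₁, e₂]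
  have c1 := sq_bracket_mul_cosh_dist p z e₁ e₂
  have c2 := sq_bracket_mul_cosh_dist z q e₁ e₂
  have c3 := sq_bracket_mul_cosh_dist p q e₁ e₂
  have gz := hypForm_gram z e₁ e₂
  have gp := hypForm_gram p e₁ e₂
  have gq := hypForm_gram q e₁ e₂
  rw [hbr, one_mul] at c1 c2 c3
  rw [hbr] at gz gp gq
  rw [h, h, h] at c1 c2 gz
  set c := Real.cosh (dist p q)
  have e1 : Real.cosh (dist p z) = α + β * c := by
    rw [c1, c3]; linear_combination α * gp
  have e2 : Real.cosh (dist z q) = α * c + β := by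
    rw [c2, c3]; linear_combination β * gq
  have e3 : α ^ 2 + β ^ 2 + 2 * α * β * c = 1 := by
    rw [c3]; linear_combination gz - α ^ 2 * gp - β ^ 2 * gq
  have hsd : 0 ≤ Real.sinh (dist p q) := Real.sinh_nonneg_iff.2 dist_nonneg
  have hcs : c ^ 2 = Real.sinh (dist p q) ^ 2 + 1 := Real.cosh_sq _
  have s1 : Real.sinh (dist p z) = β * Real.sinh (dist p q) := by
    refine (sq_eq_sq₀ (Real.sinh_nonneg_iff.2 dist_nonneg) (by positivity)).1 ?_
    have := Real.cosh_sq (dist p z)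
    rw [e1] at this
    linear_combination (-1) * this + e3 + β ^ 2 * hcs
  have s2 : Real.sinh (dist z q) = α * Real.sinh (dist p q) := by
    refine (sq_eq_sq₀ (Real.sinh_nonneg_iff.2 dist_nonneg) (by positivity)).1 ?_
    have := Real.cosh_sq (dist z q)
    rw [e2] at this
    linear_combination (-1) * this + e3 + α ^ 2 * hcs
  have : Real.cosh (dist p z + dist z q) = c := by
    rw [Real.cosh_add, e1, e2, s1, s2]
    linear_combination c * e3 - α * β * hcs
  change dist p z + dist z q = dist p q
  exact Real.cosh_injOn (add_nonneg dist_nonneg dist_nonneg) dist_nonneg this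

/-! ### The common perpendicular of two disjoint geodesics. -/

/-- Coordinates adapted to the common perpendicular of the geodesics with ideal endpoints `u₁`, `v₁`
and `u₂`, `v₂`: the perpendicular has ideal endpoints `ξ` and `η`. -/
structure PerpFrame (u₁ v₁ u₂ v₂ : ℝ × ℝ) where
  ξ : ℝ × ℝ
  η : ℝ × ℝ
  R : ℝ
  one_lt : 1 < R
  bracket_pos : 0 < bracket ξ η
  exists_left : ∃ a b : ℝ, 0 < a ∧ 0 < b ∧ ∀ x, bracket ξ x = a * bracket u₁ x + b * bracket v₁ x
  exists_right : ∃ a b : ℝ, 0 < a ∧ 0 < b ∧ ∀ x, bracket x η = a * bracket x u₂ + b * bracket x v₂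
  form_left : ∃ c : ℝ, 0 < c ∧ ∀ z, hypForm z ξ ξ - hypForm z η η = c * hypForm z u₁ v₁
  form_right : ∃ c : ℝ, 0 < c ∧ ∀ z, R ^ 2 * hypForm z η η - hypForm z ξ ξ = c * hypForm z u₂ v₂
  line_left : ∀ z, hypForm z ξ η = bracket u₁ u₂ * bracket u₁ v₂ * hypForm z v₁ v₁ -
    bracket v₁ u₂ * bracket v₁ v₂ * hypForm z u₁ u₁
  ratio : (R + 1) ^ 2 / (4 * R) =
    bracket u₁ u₂ * bracket v₁ v₂ / (bracket u₁ v₁ * bracket u₂ v₂)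

/-- The ideal endpoints of the perpendicular are the pair harmonic to both `u₁, v₁` and `u₂, v₂`:
`±α u₁ + β v₁` are proportional to combinations `γ u₂ ± δ v₂`. Square roots of the four mixed
brackets make the coefficients polynomial, and the Plücker relation `g * h = (d e + c f) (d e - c
f)` supplies `R`. -/
theorem nonempty_perpFrame {u₁ v₁ u₂ v₂ : ℝ × ℝ} (hg : 0 < bracket u₁ v₁) (hc : 0 < bracket v₁ u₂)
    (hd : 0 < bracket u₁ u₂) (hh : 0 < bracket u₂ v₂) (he : 0 < bracket v₁ v₂)
    (hf : 0 < bracket u₁ v₂) : Nonempty (PerpFrame u₁ v₁ u₂ v₂) := by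
  obtain ⟨c, hc0, hc⟩ : ∃ c, 0 < c ∧ bracket v₁ u₂ = c ^ 2 :=
    ⟨_, Real.sqrt_pos.2 hc, (Real.sq_sqrt hc.le).symm⟩
  obtain ⟨d, hd0, hd⟩ : ∃ c, 0 < c ∧ bracket u₁ u₂ = c ^ 2 :=
    ⟨_, Real.sqrt_pos.2 hd, (Real.sq_sqrt hd.le).symm⟩
  obtain ⟨e, he0, he⟩ : ∃ c, 0 < c ∧ bracket v₁ v₂ = c ^ 2 :=
    ⟨_, Real.sqrt_pos.2 he, (Real.sq_sqrt he.le).symm⟩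
  obtain ⟨f, hf0, hf⟩ : ∃ c, 0 < c ∧ bracket u₁ v₂ = c ^ 2 :=
    ⟨_, Real.sqrt_pos.2 hf, (Real.sq_sqrt hf.le).symm⟩
  set g := bracket u₁ v₁ with hgdef
  set h := bracket u₂ v₂ with hhdef
  have hpl : g * h = d ^ 2 * e ^ 2 - f ^ 2 * c ^ 2 := by
    rw [hgdef, hhdef, bracket_mul_bracket, hc, hd, he, hf]
  have hprod : g * h = (d * e + c * f) * (d * e - c * f) := by rw [hpl]; ring
  have hlam : 0 < d * e - c * f := by
    by_contra hcon
    have h1 : (d * e + c * f) * (d * e - c * f) ≤ 0 :=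
      mul_nonpos_of_nonneg_of_nonpos (by positivity) (by linarith)
    have h2 : 0 < g * h := by positivity
    linarith
  -- coordinates of `u₂` and `v₂` in the basis `u₁`, `v₁`
  have hu1 : g * u₂.1 = -c ^ 2 * u₁.1 + d ^ 2 * v₁.1 := by
    rw [← hc, ← hd, hgdef]; unfold bracket; ring
  have hu2 : g * u₂.2 = -c ^ 2 * u₁.2 + d ^ 2 * v₁.2 := by
    rw [← hc, ← hd, hgdef]; unfold bracket; ring
  have hv1 : g * v₂.1 = -e ^ 2 * u₁.1 + f ^ 2 * v₁.1 := by
    rw [← he, ← hf, hgdef]; unfold bracket; ring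
  have hv2 : g * v₂.2 = -e ^ 2 * u₁.2 + f ^ 2 * v₁.2 := by
    rw [← he, ← hf, hgdef]; unfold bracket; ring
  have hg' := hg.ne'
  have hκ : 0 < d * e + c * f := by positivity
  refine ⟨{
    ξ := (c * e * u₁.1 + d * f * v₁.1, c * e * u₁.2 + d * f * v₁.2)
    η := (-(c * e) * u₁.1 + d * f * v₁.1, -(c * e) * u₁.2 + d * f * v₁.2)
    R := (d * e + c * f) / (d * e - c * f)
    one_lt := ?_
    bracket_pos := ?_
    exists_left := ⟨c * e, d * f, by positivity, by positivity, fun x => ?_⟩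
    exists_right := ⟨g * (e * f) / (d * e + c * f), g * (c * d) / (d * e + c * f), by positivity,
      by positivity, fun x => ?_⟩
    form_left := ⟨4 * (c * e * d * f), by positivity, fun z => ?_⟩
    form_right := ⟨4 * (c * e * d * f) * g ^ 2 / (d * e - c * f) ^ 2, by positivity, fun z => ?_⟩
    line_left := fun z => ?_
    ratio := ?_ }⟩
  · rw [one_lt_div hlam]
    have : 0 < c * f := by positivity
    linarith
  · have : bracket (c * e * u₁.1 + d * f * v₁.1, c * e * u₁.2 + d * f * v₁.2)
      (-(c * e) * u₁.1 + d * f * v₁.1, -(c * e) * u₁.2 + d * f * v₁.2) =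
        2 * (c * e * d * f) * g := by
      rw [hgdef]; simp only [bracket]; ring
    rw [this]; positivity
  · simp only [bracket]; ring
  · simp only [bracket]
    field_simp
    linear_combination (-x.2 * (e * f)) * hu1 + (x.1 * (e * f)) * hu2 - (x.2 * (c * d)) * hv1 +
      (x.1 * (c * d)) * hv2
  · have := z.im_ne_zero
    simp only [hypForm]; field_simp; ring
  · have := z.im_ne_zero
    have h1 : g * (e * f * u₂.1 + c * d * v₂.1) =
        (d * e + c * f) * (-(c * e) * u₁.1 + d * f * v₁.1) := by
      linear_combination (e * f) * hu1 + (c * d) * hv1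
    have h2 : g * (e * f * u₂.2 + c * d * v₂.2) =
        (d * e + c * f) * (-(c * e) * u₁.2 + d * f * v₁.2) := by
      linear_combination (e * f) * hu2 + (c * d) * hv2
    have h3 : g * (e * f * u₂.1 - c * d * v₂.1) =
        (d * e - c * f) * ((c * e) * u₁.1 + d * f * v₁.1) := by
      linear_combination (e * f) * hu1 - (c * d) * hv1
    have h4 : g * (e * f * u₂.2 - c * d * v₂.2) =
        (d * e - c * f) * ((c * e) * u₁.2 + d * f * v₁.2) := by
      linear_combination (e * f) * hu2 - (c * d) * hv2
    -- The polarization identity for `hypForm z u₂ v₂`, after `h1`–`h4` rewrite multiples of `η` and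
    -- `ξ` as `e f u₂ ± c d v₂`.
    have key : (d * e + c * f) ^ 2 * hypForm z (-(c * e) * u₁.1 + d * f * v₁.1,
          -(c * e) * u₁.2 + d * f * v₁.2) (-(c * e) * u₁.1 + d * f * v₁.1,
          -(c * e) * u₁.2 + d * f * v₁.2) -
        (d * e - c * f) ^ 2 * hypForm z (c * e * u₁.1 + d * f * v₁.1, c * e * u₁.2 + d * f * v₁.2)
          (c * e * u₁.1 + d * f * v₁.1, c * e * u₁.2 + d * f * v₁.2) =
        4 * (c * e * d * f) * g ^ 2 * hypForm z u₂ v₂ := by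
      have e1 : (d * e + c * f) ^ 2 * hypForm z (-(c * e) * u₁.1 + d * f * v₁.1,
          -(c * e) * u₁.2 + d * f * v₁.2) (-(c * e) * u₁.1 + d * f * v₁.1,
          -(c * e) * u₁.2 + d * f * v₁.2) =
          hypForm z (g * (e * f * u₂.1 + c * d * v₂.1), g * (e * f * u₂.2 + c * d * v₂.2))
          (g * (e * f * u₂.1 + c * d * v₂.1), g * (e * f * u₂.2 + c * d * v₂.2)) := by
        rw [h1, h2]; simp only [hypForm]; ring
      have e2 : (d * e - c * f) ^ 2 * hypForm z (c * e * u₁.1 + d * f * v₁.1,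
          c * e * u₁.2 + d * f * v₁.2)
          (c * e * u₁.1 + d * f * v₁.1, c * e * u₁.2 + d * f * v₁.2) =
          hypForm z (g * (e * f * u₂.1 - c * d * v₂.1), g * (e * f * u₂.2 - c * d * v₂.2))
          (g * (e * f * u₂.1 - c * d * v₂.1), g * (e * f * u₂.2 - c * d * v₂.2)) := by
        rw [h3, h4]; simp only [hypForm]; ring
      rw [e1, e2]; simp only [hypForm]; ring
    have hl := hlam.ne'
    rw [div_pow, div_mul_eq_mul_div, div_mul_eq_mul_div, ← key]
    field_simp
  · rw [hc, hd, he, hf]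
    simp only [hypForm]; ring
  · have hl := hlam.ne'
    rw [hd, he, hprod]
    field_simp
    ring

namespace PerpFrame

variable {u₁ v₁ u₂ v₂ : ℝ × ℝ} (F : PerpFrame u₁ v₁ u₂ v₂)

theorem mem_left_iff (z : ℍ) : hypForm z u₁ v₁ = 0 ↔ hypForm z F.ξ F.ξ = hypForm z F.η F.η := by
  obtain ⟨c, hc, h⟩ := F.form_left
  rw [← sub_eq_zero (a := hypForm z F.ξ F.ξ), h z, mul_eq_zero, or_iff_right hc.ne']

theorem mem_right_iff (z : ℍ) :
    hypForm z u₂ v₂ = 0 ↔ hypForm z F.ξ F.ξ = F.R ^ 2 * hypForm z F.η F.η := by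
  obtain ⟨c, hc, h⟩ := F.form_right
  rw [eq_comm (a := hypForm z F.ξ F.ξ), ← sub_eq_zero (b := hypForm z F.ξ F.ξ), h z, mul_eq_zero,
    or_iff_right hc.ne']

/-- The half-sum of the two eigenvalues is the hyperbolic cosine of the distance. -/
theorem cosh_dist_aux {Δ R g k h l : ℝ} (hΔ : 0 < Δ) (hR : 1 < R) (hg : 0 < g) (hk : 0 < k)
    (h1 : g ^ 2 - h ^ 2 = Δ ^ 2) (h2 : R ^ 2 * k ^ 2 - l ^ 2 = Δ ^ 2) :
    Δ ^ 2 * ((R + R⁻¹) / 2) ≤ (g * k + g * (R ^ 2 * k) - 2 * h * l) / 2 ∧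
      ((g * k + g * (R ^ 2 * k) - 2 * h * l) / 2 ≤ Δ ^ 2 * ((R + R⁻¹) / 2) → h = 0 ∧ l = 0) := by
  have hR0 : 0 < R := by linarith
  set C := (R + R⁻¹) / 2 with hC
  have hC1 : 1 < C := by
    rw [hC]
    have : R * R⁻¹ = 1 := mul_inv_cancel₀ hR0.ne'
    nlinarith [sq_nonneg (R - 1), inv_pos.2 hR0]
  set m := g * (R * k) with hm
  have hm0 : 0 < m := by positivity
  have e1 : (g * k + g * (R ^ 2 * k) - 2 * h * l) / 2 = m * C - h * l := by
    rw [hm, hC]; field_simp; ring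
  have e2 : m ^ 2 = (Δ ^ 2 + h ^ 2) * (Δ ^ 2 + l ^ 2) := by
    rw [hm]; linear_combination (R ^ 2 * k ^ 2) * h1 + (Δ ^ 2 + h ^ 2) * h2
  -- Cauchy–Schwarz for the vectors `(Δ, |h|)` and `(Δ, |l|)`. As `C > 1`, it makes `m * C - h * l`
  -- smallest exactly when `h = l = 0`, that is, when both points lie on the perpendicular.
  have e3 : Δ ^ 2 + |h * l| ≤ m := by
    refine abs_le_of_sq_le_sq' ?_ hm0.le |>.2
    rw [e2]
    have : |h * l| ^ 2 = h ^ 2 * l ^ 2 := by rw [sq_abs]; ring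
    have h4 : 2 * |h * l| ≤ h ^ 2 + l ^ 2 := by
      rw [abs_mul]; nlinarith [sq_nonneg (|h| - |l|), sq_abs h, sq_abs l]
    nlinarith [mul_le_mul_of_nonneg_left h4 (sq_nonneg Δ)]
  have e4 : h * l ≤ |h * l| := le_abs_self _
  have e5 : 0 ≤ |h * l| := abs_nonneg _
  rw [e1]
  refine ⟨by nlinarith, fun hle => ?_⟩
  have e6 : |h * l| = 0 := by
    have : (C - 1) * |h * l| ≤ 0 := by nlinarith
    nlinarith
  have e7 : h * l = 0 := abs_eq_zero.1 e6
  have e8 : m ≤ Δ ^ 2 := by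
    rw [e7] at hle
    have : m * C ≤ Δ ^ 2 * C := by linarith
    exact le_of_mul_le_mul_right this (by linarith)
  have e9 : m ^ 2 ≤ (Δ ^ 2) ^ 2 := by gcongr
  have e10 : Δ ^ 2 * (h ^ 2 + l ^ 2) ≤ 0 := by nlinarith [sq_nonneg (h * l)]
  have e11 : h ^ 2 + l ^ 2 ≤ 0 := by
    by_contra hcon
    push Not at hcon
    have : 0 < Δ ^ 2 * (h ^ 2 + l ^ 2) := by positivity
    linarith
  constructor <;> nlinarith [sq_nonneg h, sq_nonneg l]

theorem pos_η (z : ℍ) : 0 < hypForm z F.η F.η :=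
  hypForm_self_pos z (v := F.ξ) (by rw [bracket_swap]; linarith [F.bracket_pos])

theorem cosh_le {x y : ℍ} (hx : hypForm x u₁ v₁ = 0) (hy : hypForm y u₂ v₂ = 0) :
    (F.R + F.R⁻¹) / 2 ≤ Real.cosh (dist x y) ∧
      (Real.cosh (dist x y) ≤ (F.R + F.R⁻¹) / 2 →
        hypForm x F.ξ F.η = 0 ∧ hypForm y F.ξ F.η = 0) := by
  have h1 := (F.mem_left_iff x).1 hx
  have h2 := (F.mem_right_iff y).1 hy
  have gx := hypForm_gram x F.ξ F.η
  have gy := hypForm_gram y F.ξ F.η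
  have hc := sq_bracket_mul_cosh_dist x y F.ξ F.η
  rw [h1] at gx hc
  rw [h2] at gy hc
  have hΔ := F.bracket_pos
  obtain ⟨k1, k2⟩ := cosh_dist_aux (h := hypForm x F.ξ F.η) (l := hypForm y F.ξ F.η) hΔ F.one_lt
    (F.pos_η x) (F.pos_η y)
    (by rw [← gx]; ring) (by rw [← gy]; ring)
  rw [← hc] at k1 k2
  have hΔ2 : 0 < bracket F.ξ F.η ^ 2 := by positivity
  exact ⟨le_of_mul_le_mul_left k1 hΔ2, fun h => k2 (mul_le_mul_of_nonneg_left h hΔ2.le)⟩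

/-- The perpendicular is parametrized by `s`; the left geodesic is met at `s = 1` and the right one
at `s = R`, so their distance is `log R`. -/
theorem exists_point {s : ℝ} (hs : 0 < s) : ∃ z : ℍ, hypForm z F.ξ F.η = 0 ∧
    hypForm z F.ξ F.ξ = s * bracket F.ξ F.η ∧ hypForm z F.η F.η = s⁻¹ * bracket F.ξ F.η := by
  have hΔ := F.bracket_pos
  set Δ := bracket F.ξ F.η with hΔd
  have hdet : (F.η.2 ^ 2 * s + F.ξ.2 ^ 2 / s) * (F.η.1 ^ 2 * s + F.ξ.1 ^ 2 / s) -
      (F.η.1 * F.η.2 * s + F.ξ.1 * F.ξ.2 / s) ^ 2 = Δ ^ 2 := by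
    rw [hΔd]; unfold bracket; field_simp; ring
  have ha : 0 < F.η.2 ^ 2 * s + F.ξ.2 ^ 2 / s := by
    have h0 : 0 ≤ F.η.2 ^ 2 * s + F.ξ.2 ^ 2 / s := by positivity
    refine h0.lt_of_ne' fun hzero => ?_
    rw [hzero] at hdet
    have : 0 < Δ ^ 2 := by positivity
    nlinarith [sq_nonneg (F.η.1 * F.η.2 * s + F.ξ.1 * F.ξ.2 / s)]
  obtain ⟨z, hz⟩ := exists_hypForm_eq ha (b := F.η.1 * F.η.2 * s + F.ξ.1 * F.ξ.2 / s)
    (c := F.η.1 ^ 2 * s + F.ξ.1 ^ 2 / s) (by rw [hdet]; positivity)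
  rw [hdet, Real.sqrt_sq hΔ.le] at hz
  refine ⟨z, ?_, ?_, ?_⟩
  · rw [hz, mul_eq_zero]; right; field_simp; ring
  · rw [hz, inv_mul_eq_div, div_eq_iff hΔ.ne', hΔd]; unfold bracket; field_simp; ring
  · rw [hz, inv_mul_eq_div, div_eq_iff hΔ.ne', hΔd]; unfold bracket; field_simp; ring

/-- The two geodesics have a common perpendicular, and it realizes their distance. -/
theorem exists_minimizer : ∃ p q : ℍ, hypForm p u₁ v₁ = 0 ∧ hypForm q u₂ v₂ = 0 ∧
    Real.cosh (dist p q) = (F.R + F.R⁻¹) / 2 := by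
  have hR : 0 < F.R := by linarith [F.one_lt]
  have hΔ := F.bracket_pos
  obtain ⟨p, p1, p2, p3⟩ := F.exists_point one_pos
  obtain ⟨q, q1, q2, q3⟩ := F.exists_point hR
  refine ⟨p, q, (F.mem_left_iff p).2 (by rw [p2, p3, inv_one]), (F.mem_right_iff q).2 ?_, ?_⟩
  · rw [q2, q3]; field_simp
  · have hc := sq_bracket_mul_cosh_dist p q F.ξ F.η
    rw [p1, p2, p3, q1, q2, q3] at hc
    have hΔ2 : bracket F.ξ F.η ^ 2 ≠ 0 := by positivity
    refine mul_left_cancel₀ hΔ2 (hc.trans ?_)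
    rw [inv_one]; ring

/-- A pair of points realizes the distance of two geodesics. -/
def IsMinimizer (u₁ v₁ u₂ v₂ : ℝ × ℝ) (p q : ℍ) : Prop :=
  hypForm p u₁ v₁ = 0 ∧ hypForm q u₂ v₂ = 0 ∧
    ∀ x y : ℍ, hypForm x u₁ v₁ = 0 → hypForm y u₂ v₂ = 0 → dist p q ≤ dist x y

theorem exists_isMinimizer (F : PerpFrame u₁ v₁ u₂ v₂) : ∃ p q : ℍ, IsMinimizer u₁ v₁ u₂ v₂ p q := by
  obtain ⟨p, q, hp, hq, h⟩ := F.exists_minimizer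
  refine ⟨p, q, hp, hq, fun x y hx hy => ?_⟩
  have := (F.cosh_le hx hy).1
  rw [← h, Real.cosh_le_cosh, abs_of_nonneg dist_nonneg, abs_of_nonneg dist_nonneg] at this
  exact this

variable {p q : ℍ}

theorem cosh_dist_eq (h : IsMinimizer u₁ v₁ u₂ v₂ p q) :
    Real.cosh (dist p q) = (F.R + F.R⁻¹) / 2 := by
  obtain ⟨p', q', hp, hq, h'⟩ := F.exists_minimizer
  refine le_antisymm ?_ (F.cosh_le h.1 h.2.1).1
  rw [← h', Real.cosh_le_cosh, abs_of_nonneg dist_nonneg, abs_of_nonneg dist_nonneg]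
  exact h.2.2 _ _ hp hq

/-- The distance of two geodesics as a cross-ratio of their ideal endpoints. -/
theorem sq_cosh_half_dist (F : PerpFrame u₁ v₁ u₂ v₂) (h : IsMinimizer u₁ v₁ u₂ v₂ p q) :
    Real.cosh (dist p q / 2) ^ 2 =
      bracket u₁ u₂ * bracket v₁ v₂ / (bracket u₁ v₁ * bracket u₂ v₂) := by
  rw [← F.ratio]
  have h1 := F.cosh_dist_eq h
  have h2 := Real.cosh_two_mul (dist p q / 2)
  have h3 := Real.cosh_sq (dist p q / 2)
  rw [mul_div_cancel₀ _ two_ne_zero] at h2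
  have hR : 0 < F.R := by linarith [F.one_lt]
  have h4 : Real.cosh (dist p q / 2) ^ 2 = ((F.R + F.R⁻¹) / 2 + 1) / 2 := by
    rw [← h1]; linarith
  rw [h4]; field_simp; ring

theorem form_eq (h : IsMinimizer u₁ v₁ u₂ v₂ p q) :
    hypForm p F.ξ F.η = 0 ∧ hypForm q F.ξ F.η = 0 ∧
    hypForm p F.ξ F.ξ = bracket F.ξ F.η ∧ hypForm p F.η F.η = bracket F.ξ F.η ∧
    hypForm q F.ξ F.ξ = F.R * bracket F.ξ F.η ∧ hypForm q F.η F.η = F.R⁻¹ * bracket F.ξ F.η := by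
  have hR : 0 < F.R := by linarith [F.one_lt]
  obtain ⟨hp, hq⟩ := (F.cosh_le h.1 h.2.1).2 (F.cosh_dist_eq h).le
  have gp := hypForm_gram p F.ξ F.η
  have gq := hypForm_gram q F.ξ F.η
  have p1 := (F.mem_left_iff p).1 h.1
  have q1 := (F.mem_right_iff q).1 h.2.1
  rw [hp, p1] at gp
  rw [hq, q1] at gq
  have hΔ := F.bracket_pos
  have e1 : hypForm p F.η F.η = bracket F.ξ F.η :=
    (sq_eq_sq₀ (F.pos_η p).le hΔ.le).1 (by rw [← gp]; ring)
  have e2 : F.R * hypForm q F.η F.η = bracket F.ξ F.η :=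
    (sq_eq_sq₀ (mul_pos hR (F.pos_η q)).le hΔ.le).1 (by rw [← gq]; ring)
  refine ⟨hp, hq, p1.trans e1, e1, ?_, ?_⟩
  · rw [q1, ← e2]; ring
  · rw [← e2]; field_simp

theorem minimizer_unique (F : PerpFrame u₁ v₁ u₂ v₂) {p' q' : ℍ}
    (h : IsMinimizer u₁ v₁ u₂ v₂ p q)
    (h' : IsMinimizer u₁ v₁ u₂ v₂ p' q') : p = p' ∧ q = q' := by
  obtain ⟨a1, a2, a3, a4, a5, a6⟩ := F.form_eq h
  obtain ⟨b1, b2, b3, b4, b5, b6⟩ := F.form_eq h'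
  exact ⟨eq_of_hypForm_eq F.bracket_pos.ne' (a3.trans b3.symm) (a1.trans b1.symm) (a4.trans b4.symm),
    eq_of_hypForm_eq F.bracket_pos.ne' (a5.trans b5.symm) (a2.trans b2.symm) (a6.trans b6.symm)⟩

theorem form_eq_zero_of_mem_segment (h : IsMinimizer u₁ v₁ u₂ v₂ p q) {z : ℍ}
    (hz : z ∈ hypSegment p q) : hypForm z F.ξ F.η = 0 := by
  obtain ⟨α, β, -, -, -, hc⟩ := exists_combination_of_mem_hypSegment hz
  obtain ⟨hp, hq, -⟩ := F.form_eq h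
  rw [hc, hp, hq]; ring

/-- On the line of the perpendicular, the two inequalities say that `z` lies between the geodesics.
They are the signs of the coefficients `α` and `β` that express `z` through `p` and `q`. -/
theorem mem_segment_of_form (h : IsMinimizer u₁ v₁ u₂ v₂ p q) {z : ℍ}
    (h0 : hypForm z F.ξ F.η = 0) (h1 : 0 ≤ hypForm z u₁ v₁) (h2 : 0 ≤ hypForm z u₂ v₂) :
    z ∈ hypSegment p q := by
  have hR1 := F.one_lt
  have hR : 0 < F.R := by linarith
  have hR2 : 0 < F.R ^ 2 - 1 := by nlinarith
  have hΔ := F.bracket_pos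
  obtain ⟨a1, a2, a3, a4, a5, a6⟩ := F.form_eq h
  obtain ⟨c1, hc1, k1⟩ := F.form_left
  obtain ⟨c2, hc2, k2⟩ := F.form_right
  have m1 : 0 ≤ hypForm z F.ξ F.ξ - hypForm z F.η F.η := by rw [k1]; positivity
  have m2 : 0 ≤ F.R ^ 2 * hypForm z F.η F.η - hypForm z F.ξ F.ξ := by rw [k2]; positivity
  set Δ := bracket F.ξ F.η with hΔd
  set α := (F.R ^ 2 * hypForm z F.η F.η - hypForm z F.ξ F.ξ) / (Δ * (F.R ^ 2 - 1)) with hα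
  set β := F.R * (hypForm z F.ξ F.ξ - hypForm z F.η F.η) / (Δ * (F.R ^ 2 - 1)) with hβ
  refine mem_hypSegment_of_combination (α := α) (β := β) (by positivity) (by positivity)
    fun u v => ?_
  have e1 := sq_bracket_mul_hypForm z F.ξ F.η u v
  have e2 := sq_bracket_mul_hypForm p F.ξ F.η u v
  have e3 := sq_bracket_mul_hypForm q F.ξ F.η u v
  have hΔ2 : Δ ^ 2 ≠ 0 := by positivity
  refine mul_left_cancel₀ hΔ2 ?_
  rw [mul_add, mul_left_comm, mul_left_comm _ β, e1, e2, e3, h0, a1, a2, a3, a4, a5, a6, hα, hβ]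
  have hR3 := hR2.ne'
  field_simp
  ring

end PerpFrame

namespace PerpFrame

variable {u₁ v₁ u₂ v₂ : ℝ × ℝ} (F : PerpFrame u₁ v₁ u₂ v₂)

theorem bracket_ξ_pos {x : ℝ × ℝ} (h1 : 0 ≤ bracket u₁ x) (h2 : 0 ≤ bracket v₁ x)
    (h : 0 < bracket u₁ x ∨ 0 < bracket v₁ x) : 0 < bracket F.ξ x := by
  obtain ⟨a, b, ha, hb, hab⟩ := F.exists_left
  rw [hab]
  rcases h with h | h <;> positivity

theorem bracket_ξ_neg {x : ℝ × ℝ} (h1 : 0 ≤ bracket x u₁) (h2 : 0 ≤ bracket x v₁)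
    (h : 0 < bracket x u₁ ∨ 0 < bracket x v₁) : 0 < bracket x F.ξ := by
  obtain ⟨a, b, ha, hb, hab⟩ := F.exists_left
  rw [bracket_swap, hab, bracket_swap u₁, bracket_swap v₁]
  have : 0 < a * bracket x u₁ + b * bracket x v₁ := by rcases h with h | h <;> positivity
  linarith

theorem bracket_η_pos {x : ℝ × ℝ} (h1 : 0 ≤ bracket x u₂) (h2 : 0 ≤ bracket x v₂)
    (h : 0 < bracket x u₂ ∨ 0 < bracket x v₂) : 0 < bracket x F.η := by
  obtain ⟨a, b, ha, hb, hab⟩ := F.exists_right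
  rw [hab]
  rcases h with h | h <;> positivity

theorem bracket_η_neg {x : ℝ × ℝ} (h1 : 0 ≤ bracket u₂ x) (h2 : 0 ≤ bracket v₂ x)
    (h : 0 < bracket u₂ x ∨ 0 < bracket v₂ x) : 0 < bracket F.η x := by
  obtain ⟨a, b, ha, hb, hab⟩ := F.exists_right
  rw [bracket_swap, hab, bracket_swap x, bracket_swap x]
  have : 0 < a * bracket u₂ x + b * bracket v₂ x := by rcases h with h | h <;> positivity
  linarith

/-- Along a perpendicular to the geodesic from `u` to `v`, the ratio of `hypForm z u u` to `hypForm
z v v` is constant and marks the foot. `line_left` and `line_right` compute this ratio at the two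
ends, so that perpendiculars to one side can be compared. -/
theorem line_right (z : ℍ) : bracket u₂ v₂ * hypForm z F.ξ F.η = bracket u₁ v₁ *
    (bracket v₁ v₂ * bracket u₁ v₂ * hypForm z u₂ u₂ -
      bracket v₁ u₂ * bracket u₁ u₂ * hypForm z v₂ v₂) := by
  rw [F.line_left]
  have := z.im_ne_zero
  unfold hypForm bracket
  field_simp
  ring

end PerpFrame

theorem exists_point_combination (p q : ℍ) {α β : ℝ} (hα : 0 < α) (hβ : 0 < β) :
    ∃ z : ℍ, ∃ κ : ℝ, 0 < κ ∧
      ∀ u v, hypForm z u v = κ * (α * hypForm p u v + β * hypForm q u v) := by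
  let e₁ : ℝ × ℝ := (1, 0)
  let e₂ : ℝ × ℝ := (0, 1)
  have hbr : bracket e₁ e₂ = -1 := by simp [bracket, e₁, e₂]
  have c := sq_bracket_mul_cosh_dist p q e₁ e₂
  have gp := hypForm_gram p e₁ e₂
  have gq := hypForm_gram q e₁ e₂
  have hp : 0 < hypForm p e₁ e₁ := hypForm_self_pos p (v := e₂) (by rw [hbr]; norm_num)
  have hq : 0 < hypForm q e₁ e₁ := hypForm_self_pos q (v := e₂) (by rw [hbr]; norm_num)
  rw [hbr] at c gp gq
  have hdet : (α * hypForm p e₁ e₁ + β * hypForm q e₁ e₁) *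
      (α * hypForm p e₂ e₂ + β * hypForm q e₂ e₂) -
      (-(α * hypForm p e₁ e₂ + β * hypForm q e₁ e₂)) ^ 2 =
      α ^ 2 + β ^ 2 + 2 * α * β * Real.cosh (dist p q) := by
    linear_combination α ^ 2 * gp + β ^ 2 * gq - 2 * α * β * c
  have hpos : 0 < α ^ 2 + β ^ 2 + 2 * α * β * Real.cosh (dist p q) := by
    have := Real.cosh_pos (dist p q)
    positivity
  obtain ⟨z, hz⟩ := exists_hypForm_eq (a := α * hypForm p e₁ e₁ + β * hypForm q e₁ e₁)
    (b := -(α * hypForm p e₁ e₂ + β * hypForm q e₁ e₂))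
    (c := α * hypForm p e₂ e₂ + β * hypForm q e₂ e₂) (by positivity) (by rw [hdet]; exact hpos)
  rw [hdet] at hz
  refine ⟨z, _, inv_pos.2 (Real.sqrt_pos.2 hpos), fun u v => ?_⟩
  rw [hz, hypForm_eq_combination p u v, hypForm_eq_combination q u v]
  simp only [e₁, e₂]
  ring

/-! ### Which orthogeodesics of a polygon meet. -/

/-- A sequence of vectors of `ℝ²` that lifts the vertices of an ideal `n`-gon in cyclic order. -/
structure IsVertexLift (n : ℕ) (U : ℕ → ℝ × ℝ) : Prop where
  antiperiodic : ∀ k, U (k + n) = -U k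
  bracket_pos : ∀ {a b : ℕ}, a < b → b < a + n → 0 < bracket (U a) (U b)

namespace IsVertexLift

variable {n : ℕ} {U : ℕ → ℝ × ℝ}

theorem bracket_nonneg (hU : IsVertexLift n U) {a b : ℕ} (h1 : a ≤ b) (h2 : b ≤ a + n) :
    0 ≤ bracket (U a) (U b) := by
  rcases h1.eq_or_lt with rfl | h1
  · rw [bracket_self]
  rcases h2.eq_or_lt with rfl | h2
  · rw [hU.antiperiodic, bracket_neg_right, bracket_self, neg_zero]
  · exact (hU.bracket_pos h1 h2).le

theorem nonempty_frame (hU : IsVertexLift n U) {i j : ℕ} (h1 : i + 2 ≤ j) (h2 : j + 2 ≤ i + n) :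
    Nonempty (PerpFrame (U i) (U (i + 1)) (U j) (U (j + 1))) :=
  nonempty_perpFrame (hU.bracket_pos (by omega) (by omega)) (hU.bracket_pos (by omega) (by omega))
    (hU.bracket_pos (by omega) (by omega)) (hU.bracket_pos (by omega) (by omega))
    (hU.bracket_pos (by omega) (by omega)) (hU.bracket_pos (by omega) (by omega))

/-- Each side of the polygon lies on the positive side of every other side. -/
theorem side_pos (hU : IsVertexLift n U) (hn : 3 ≤ n) {i k : ℕ} (h1 : i < k) (h2 : k < i + n)
    {z : ℍ} (hz : hypForm z (U i) (U (i + 1)) = 0) : 0 < hypForm z (U k) (U (k + 1)) := by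
  -- Shifted by one turn, the endpoints `i + n` and `i + 1 + n` lie in the window from `k + 1` to `k
  -- + n`. The sign of `U (k + n) = -U k` turns the negative value into a positive one.
  have h := hypForm_neg_of_between z (u := U (i + n)) (v := U (i + 1 + n)) (x := U (k + 1))
    (y := U (k + n)) (by rw [hU.antiperiodic, hU.antiperiodic, hypForm_neg_left, hypForm_neg_right,
      hz, neg_zero, neg_zero]) (hU.bracket_pos (by omega) (by omega))
    (hU.bracket_nonneg (by omega) (by omega)) (hU.bracket_pos (by omega) (by omega))
    (hU.bracket_pos (by omega) (by omega)) (hU.bracket_nonneg (by omega) (by omega)) (by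
      by_cases h : k + 1 < i + n
      · exact Or.inl (hU.bracket_pos (by omega) (by omega))
      · exact Or.inr (hU.bracket_pos (by omega) (by omega)))
  rw [hU.antiperiodic, hypForm_neg_right, hypForm_comm] at h
  linarith

theorem side_pos' (hU : IsVertexLift n U) (hn : 3 ≤ n) {i k : ℕ} (h1 : k < i) (h2 : i < k + n)
    {z : ℍ} (hz : hypForm z (U i) (U (i + 1)) = 0) : 0 < hypForm z (U k) (U (k + 1)) := by
  have h := hU.side_pos hn (i := i) (k := k + n) (by omega) (by omega) hz
  rwa [show k + n + 1 = k + 1 + n by omega, hU.antiperiodic, hU.antiperiodic, hypForm_neg_left,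
    hypForm_neg_right, neg_neg] at h

open PerpFrame

variable {i j k l : ℕ} {p q p' q' z : ℍ}

theorem ξ_pos (hU : IsVertexLift n U) (F : PerpFrame (U i) (U (i + 1)) (U j) (U (j + 1))) {m : ℕ}
    (hn : 2 ≤ n) (h1 : i + 1 ≤ m) (h2 : m ≤ i + n) : 0 < bracket F.ξ (U m) :=
  F.bracket_ξ_pos (hU.bracket_nonneg (by omega) (by omega))
    (hU.bracket_nonneg (by omega) (by omega)) (by
      by_cases h : m < i + n
      · exact Or.inl (hU.bracket_pos (by omega) (by omega))
      · exact Or.inr (hU.bracket_pos (by omega) (by omega)))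

theorem pos_ξ (hU : IsVertexLift n U) (F : PerpFrame (U i) (U (i + 1)) (U j) (U (j + 1))) {m : ℕ}
    (hn : 2 ≤ n) (h1 : m ≤ i) (h2 : i + 1 ≤ m + n) : 0 < bracket (U m) F.ξ :=
  F.bracket_ξ_neg (hU.bracket_nonneg (by omega) (by omega))
    (hU.bracket_nonneg (by omega) (by omega)) (by
      by_cases h : m < i
      · exact Or.inl (hU.bracket_pos (by omega) (by omega))
      · exact Or.inr (hU.bracket_pos (by omega) (by omega)))

theorem pos_η (hU : IsVertexLift n U) (F : PerpFrame (U i) (U (i + 1)) (U j) (U (j + 1))) {m : ℕ}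
    (hn : 2 ≤ n) (h1 : m ≤ j) (h2 : j + 1 ≤ m + n) : 0 < bracket (U m) F.η :=
  F.bracket_η_pos (hU.bracket_nonneg (by omega) (by omega))
    (hU.bracket_nonneg (by omega) (by omega)) (by
      by_cases h : m < j
      · exact Or.inl (hU.bracket_pos (by omega) (by omega))
      · exact Or.inr (hU.bracket_pos (by omega) (by omega)))

/-- The common perpendiculars of interleaved pairs of sides meet. -/
theorem perp_inter_of_crossing (hU : IsVertexLift n U) (h1 : i < k) (h2 : k < j) (h3 : j < l)
    (h4 : l < n) (hij : i + 2 ≤ j) (hkl : k + 2 ≤ l)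
    (hp : IsMinimizer (U i) (U (i + 1)) (U j) (U (j + 1)) p q)
    (hp' : IsMinimizer (U k) (U (k + 1)) (U l) (U (l + 1)) p' q') :
    ∃ z, z ∈ hypSegment p q ∧ z ∈ hypSegment p' q' := by
  obtain ⟨F⟩ := hU.nonempty_frame hkl (by omega)
  -- Since the pairs interleave, `p` and `q` are on opposite sides of the line carrying the other
  -- perpendicular.
  have hpos : 0 < hypForm p F.ξ F.η := by
    have := hypForm_neg_of_between p (x := -F.η) (y := F.ξ) hp.1 (hU.bracket_pos (by omega) (by omega))
      (by
        rw [bracket_neg_left, ← bracket_swap]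
        exact (hU.pos_η F (by omega) (by omega) (by omega)).le)
      (by
        rw [bracket_neg_left, ← bracket_swap]
        exact (hU.pos_η F (by omega) (by omega) (by omega)))
      (hU.pos_ξ F (by omega) (by omega) (by omega))
      (hU.pos_ξ F (by omega) (by omega) (by omega)).le
      (Or.inr (hU.pos_ξ F (by omega) (by omega) (by omega)))
    rw [hypForm_neg_left, hypForm_comm] at this
    linarith
  have hneg : hypForm q F.ξ F.η < 0 :=
    hypForm_neg_of_between q hp.2.1 (hU.bracket_pos (by omega) (by omega))
      (hU.ξ_pos F (by omega) (by omega) (by omega)).le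
      (hU.ξ_pos F (by omega) (by omega) (by omega))
      (hU.pos_η F (by omega) (by omega) (by omega))
      (hU.pos_η F (by omega) (by omega) (by omega)).le
      (Or.inl (hU.ξ_pos F (by omega) (by omega) (by omega)))
  -- These weights cancel the values at `p` and `q`, so `z` is where the segment crosses that line.
  -- It is on the positive side of the sides `k` and `l` because `p` and `q` are.
  obtain ⟨z, κ, hκ, hz⟩ := exists_point_combination p q (neg_pos.2 hneg) hpos
  have hside : ∀ m, 0 ≤ hypForm p (U m) (U (m + 1)) → 0 ≤ hypForm q (U m) (U (m + 1)) →
      0 ≤ hypForm z (U m) (U (m + 1)) := fun m e1 e2 => by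
    rw [hz]
    exact mul_nonneg hκ.le (add_nonneg (mul_nonneg (neg_pos.2 hneg).le e1) (mul_nonneg hpos.le e2))
  refine ⟨z, mem_hypSegment_of_combination (α := κ * -hypForm q F.ξ F.η) (β := κ * hypForm p F.ξ F.η)
    (mul_pos hκ (neg_pos.2 hneg)).le (mul_pos hκ hpos).le fun u v => by rw [hz]; ring,
    F.mem_segment_of_form hp' (by rw [hz]; ring) (hside k ?_ ?_) (hside l ?_ ?_)⟩
  · exact (hU.side_pos (by omega) h1 (by omega) hp.1).le
  · exact (hU.side_pos' (by omega) h2 (by omega) hp.2.1).le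
  · exact (hU.side_pos (by omega) (by omega) (by omega) hp.1).le
  · exact (hU.side_pos (by omega) h3 (by omega) hp.2.1).le

/-- For a point common to two perpendiculars to one side, the two relations would prescribe
different values of the ratio that marks the foot. -/
theorem ne_of_ratio_lt {r₁ s₁ r₂ s₂ x y : ℝ} (hx : 0 < x) (hy : 0 < y)
    (h1 : r₁ * x = s₁ * y) (h2 : r₂ * x = s₂ * y) (h : r₂ * s₁ < r₁ * s₂) : False := by
  have : (r₁ * s₂ - r₂ * s₁) * (x * y) = 0 := by linear_combination s₂ * y * h1 - s₁ * y * h2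
  have h3 : 0 < (r₁ * s₂ - r₂ * s₁) * (x * y) := by
    have : 0 < r₁ * s₂ - r₂ * s₁ := by linarith
    positivity
  linarith

theorem self_pos (hU : IsVertexLift n U) (hn : 2 ≤ n) (z : ℍ) (m : ℕ) : 0 < hypForm z (U m) (U m) :=
  hypForm_self_pos z (v := U (m + 1)) (hU.bracket_pos (by omega) (by omega)).ne'

/-- Common perpendiculars of consecutive pairs of distinct sides are disjoint. -/
theorem perp_disjoint_of_consecutive (hU : IsVertexLift n U) (h2 : j < k)
    (h4 : l < n) (hij : i + 2 ≤ j) (hkl : k + 2 ≤ l)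
    (hp : IsMinimizer (U i) (U (i + 1)) (U j) (U (j + 1)) p q)
    (hp' : IsMinimizer (U k) (U (k + 1)) (U l) (U (l + 1)) p' q')
    (hz : z ∈ hypSegment p q) (hz' : z ∈ hypSegment p' q') : False := by
  obtain ⟨F⟩ := hU.nonempty_frame hij (by omega)
  obtain ⟨F'⟩ := hU.nonempty_frame hkl (by omega)
  have e1 := F.form_eq_zero_of_mem_segment hp hz
  have e2 := F'.form_eq_zero_of_mem_segment hp' hz'
  have hξξ : 0 < bracket F.ξ F'.ξ := F.bracket_ξ_pos
    (hU.pos_ξ F' (by omega) (by omega) (by omega)).le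
    (hU.pos_ξ F' (by omega) (by omega) (by omega)).le
    (Or.inl (hU.pos_ξ F' (by omega) (by omega) (by omega)))
  have hηξ : 0 < bracket F.η F'.ξ := F.bracket_η_neg
    (hU.pos_ξ F' (by omega) (by omega) (by omega)).le
    (hU.pos_ξ F' (by omega) (by omega) (by omega)).le
    (Or.inl (hU.pos_ξ F' (by omega) (by omega) (by omega)))
  have hξη : 0 < bracket F.ξ F'.η := F.bracket_ξ_pos
    (hU.pos_η F' (by omega) (by omega) (by omega)).le
    (hU.pos_η F' (by omega) (by omega) (by omega)).le
    (Or.inl (hU.pos_η F' (by omega) (by omega) (by omega)))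
  have hηη : 0 < bracket F.η F'.η := F.bracket_η_neg
    (hU.pos_η F' (by omega) (by omega) (by omega)).le
    (hU.pos_η F' (by omega) (by omega) (by omega)).le
    (Or.inl (hU.pos_η F' (by omega) (by omega) (by omega)))
  -- The ideal endpoints have the cyclic order `ξ, η, ξ', η'`, so the carrying lines themselves are
  -- disjoint.
  have := hypForm_neg_of_between z (x := -F'.η) (y := F'.ξ) e1 F.bracket_pos
    (by rw [bracket_neg_left, ← bracket_swap]; exact hξη.le)
    (by rw [bracket_neg_left, ← bracket_swap]; exact hηη) hξξ hηξ.le (Or.inr hηξ)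
  rw [hypForm_neg_left, hypForm_comm, e2] at this
  linarith

/-- Common perpendiculars of nested pairs of distinct sides are disjoint. -/
theorem perp_disjoint_of_nested (hU : IsVertexLift n U) (h1 : i < k) (h3 : l < j)
    (h4 : j + 2 ≤ i + n) (hkl : k + 2 ≤ l)
    (hp : IsMinimizer (U i) (U (i + 1)) (U j) (U (j + 1)) p q)
    (hp' : IsMinimizer (U k) (U (k + 1)) (U l) (U (l + 1)) p' q')
    (hz : z ∈ hypSegment p q) (hz' : z ∈ hypSegment p' q') : False := by
  obtain ⟨F⟩ := hU.nonempty_frame (i := i) (j := j) (by omega) (by omega)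
  obtain ⟨F'⟩ := hU.nonempty_frame hkl (by omega)
  have e1 := F.form_eq_zero_of_mem_segment hp hz
  have e2 := F'.form_eq_zero_of_mem_segment hp' hz'
  have hξξ : 0 < bracket F.ξ F'.ξ := F.bracket_ξ_pos
    (hU.pos_ξ F' (by omega) (by omega) (by omega)).le
    (hU.pos_ξ F' (by omega) (by omega) (by omega)).le
    (Or.inl (hU.pos_ξ F' (by omega) (by omega) (by omega)))
  have hξη : 0 < bracket F.ξ F'.η := F.bracket_ξ_pos
    (hU.pos_η F' (by omega) (by omega) (by omega)).le
    (hU.pos_η F' (by omega) (by omega) (by omega)).le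
    (Or.inl (hU.pos_η F' (by omega) (by omega) (by omega)))
  have hξη' : 0 < bracket F'.ξ F.η := F'.bracket_ξ_pos
    (hU.pos_η F (by omega) (by omega) (by omega)).le
    (hU.pos_η F (by omega) (by omega) (by omega)).le
    (Or.inl (hU.pos_η F (by omega) (by omega) (by omega)))
  have hηη : 0 < bracket F'.η F.η := F'.bracket_η_neg
    (hU.pos_η F (by omega) (by omega) (by omega)).le
    (hU.pos_η F (by omega) (by omega) (by omega)).le
    (Or.inl (hU.pos_η F (by omega) (by omega) (by omega)))
  have := hypForm_neg_of_between z e2 F'.bracket_pos hξξ.le hξη hξη' hηη.le (Or.inl hξξ)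
  linarith

/-- The foot on side `i` moves strictly monotonically with the other side; the strictness comes from
two Plücker relations. -/
theorem perp_disjoint_of_common_left (hU : IsVertexLift n U) (hij : i + 2 ≤ j) (hjl : j < l)
    (hl : l + 2 ≤ i + n) (hp : IsMinimizer (U i) (U (i + 1)) (U j) (U (j + 1)) p q)
    (hp' : IsMinimizer (U i) (U (i + 1)) (U l) (U (l + 1)) p' q')
    (hz : z ∈ hypSegment p q) (hz' : z ∈ hypSegment p' q') : False := by
  obtain ⟨F⟩ := hU.nonempty_frame hij (by omega)
  obtain ⟨F'⟩ := hU.nonempty_frame (i := i) (j := l) (by omega) (by omega)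
  have e1 := F.form_eq_zero_of_mem_segment hp hz
  have e2 := F'.form_eq_zero_of_mem_segment hp' hz'
  rw [F.line_left, sub_eq_zero] at e1
  rw [F'.line_left, sub_eq_zero] at e2
  refine ne_of_ratio_lt (hU.self_pos (by omega) z (i + 1)) (hU.self_pos (by omega) z i) e1 e2 ?_
  have a0 : 0 < bracket (U i) (U (i + 1)) := hU.bracket_pos (by omega) (by omega)
  have a1 := bracket_mul_bracket (U i) (U (i + 1)) (U j) (U l)
  have a2 := bracket_mul_bracket (U i) (U (i + 1)) (U (j + 1)) (U (l + 1))
  have b1 := mul_pos a0 (hU.bracket_pos hjl (by omega))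
  have b2 := mul_pos a0 (hU.bracket_pos (a := j + 1) (b := l + 1) (by omega) (by omega))
  have c1 : 0 < bracket (U i) (U l) * bracket (U (i + 1)) (U j) :=
    mul_pos (hU.bracket_pos (by omega) (by omega)) (hU.bracket_pos (by omega) (by omega))
  have c2 : 0 < bracket (U i) (U (l + 1)) * bracket (U (i + 1)) (U (j + 1)) :=
    mul_pos (hU.bracket_pos (by omega) (by omega)) (hU.bracket_pos (by omega) (by omega))
  have := mul_lt_mul'' (by linarith : bracket (U i) (U l) * bracket (U (i + 1)) (U j) <
    bracket (U i) (U j) * bracket (U (i + 1)) (U l)) (by linarith :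
    bracket (U i) (U (l + 1)) * bracket (U (i + 1)) (U (j + 1)) <
      bracket (U i) (U (j + 1)) * bracket (U (i + 1)) (U (l + 1))) c1.le c2.le
  linarith

theorem line_right_eq (hU : IsVertexLift n U) (hij : i + 2 ≤ j) (hj : j + 2 ≤ i + n)
    (hp : IsMinimizer (U i) (U (i + 1)) (U j) (U (j + 1)) p q) (hz : z ∈ hypSegment p q) :
    bracket (U (i + 1)) (U (j + 1)) * bracket (U i) (U (j + 1)) * hypForm z (U j) (U j) =
      bracket (U (i + 1)) (U j) * bracket (U i) (U j) * hypForm z (U (j + 1)) (U (j + 1)) := by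
  obtain ⟨F⟩ := hU.nonempty_frame hij hj
  have e1 := F.line_right z
  rw [F.form_eq_zero_of_mem_segment hp hz, mul_zero, eq_comm, mul_eq_zero,
    or_iff_right (hU.bracket_pos (by omega) (by omega)).ne', sub_eq_zero] at e1
  exact e1

theorem perp_disjoint_of_common_right (hU : IsVertexLift n U) (hik : i < k) (hkj : k + 2 ≤ j)
    (hj : j + 2 ≤ i + n) (hp : IsMinimizer (U i) (U (i + 1)) (U j) (U (j + 1)) p q)
    (hp' : IsMinimizer (U k) (U (k + 1)) (U j) (U (j + 1)) p' q')
    (hz : z ∈ hypSegment p q) (hz' : z ∈ hypSegment p' q') : False := by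
  have e1 := hU.line_right_eq (by omega) hj hp hz
  have e2 := hU.line_right_eq hkj (by omega) hp' hz'
  refine ne_of_ratio_lt (hU.self_pos (by omega) z j) (hU.self_pos (by omega) z (j + 1)) e2 e1 ?_
  have a0 : 0 < bracket (U j) (U (j + 1)) := hU.bracket_pos (by omega) (by omega)
  have a1 := bracket_mul_bracket (U i) (U k) (U j) (U (j + 1))
  have a2 := bracket_mul_bracket (U (i + 1)) (U (k + 1)) (U j) (U (j + 1))
  have b1 := mul_pos (hU.bracket_pos hik (by omega)) a0
  have b2 := mul_pos (hU.bracket_pos (a := i + 1) (b := k + 1) (by omega) (by omega)) a0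
  have c1 : 0 < bracket (U i) (U (j + 1)) * bracket (U k) (U j) :=
    mul_pos (hU.bracket_pos (by omega) (by omega)) (hU.bracket_pos (by omega) (by omega))
  have c2 : 0 < bracket (U (i + 1)) (U (j + 1)) * bracket (U (k + 1)) (U j) :=
    mul_pos (hU.bracket_pos (by omega) (by omega)) (hU.bracket_pos (by omega) (by omega))
  have := mul_lt_mul'' (by linarith : bracket (U i) (U (j + 1)) * bracket (U k) (U j) <
    bracket (U i) (U j) * bracket (U k) (U (j + 1))) (by linarith :
    bracket (U (i + 1)) (U (j + 1)) * bracket (U (k + 1)) (U j) <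
      bracket (U (i + 1)) (U j) * bracket (U (k + 1)) (U (j + 1))) c1.le c2.le
  linarith

/-- Side `j` is the right side of one pair and the left side of the other, so `line_right` is
compared with `line_left`. -/
theorem perp_disjoint_of_common_middle (hU : IsVertexLift n U) (hij : i + 2 ≤ j) (hjl : j + 2 ≤ l)
    (hl : l < n) (hp : IsMinimizer (U i) (U (i + 1)) (U j) (U (j + 1)) p q)
    (hp' : IsMinimizer (U j) (U (j + 1)) (U l) (U (l + 1)) p' q')
    (hz : z ∈ hypSegment p q) (hz' : z ∈ hypSegment p' q') : False := by
  have e1 := hU.line_right_eq hij (by omega) hp hz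
  obtain ⟨F'⟩ := hU.nonempty_frame hjl (by omega)
  have e2 := F'.form_eq_zero_of_mem_segment hp' hz'
  rw [F'.line_left, sub_eq_zero] at e2
  refine ne_of_ratio_lt (hU.self_pos (by omega) z j) (hU.self_pos (by omega) z (j + 1)) e1 e2.symm ?_
  have a0 : 0 < bracket (U j) (U (j + 1)) := hU.bracket_pos (by omega) (by omega)
  have a1 := bracket_mul_bracket (U i) (U j) (U (j + 1)) (U l)
  have a2 := bracket_mul_bracket (U (i + 1)) (U j) (U (j + 1)) (U (l + 1))
  have b1 := mul_pos (hU.bracket_pos (a := i) (b := l) (by omega) (by omega)) a0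
  have b2 := mul_pos (hU.bracket_pos (a := i + 1) (b := l + 1) (by omega) (by omega)) a0
  have c1 : 0 < bracket (U i) (U j) * bracket (U (j + 1)) (U l) :=
    mul_pos (hU.bracket_pos (by omega) (by omega)) (hU.bracket_pos (by omega) (by omega))
  have c2 : 0 < bracket (U (i + 1)) (U j) * bracket (U (j + 1)) (U (l + 1)) :=
    mul_pos (hU.bracket_pos (by omega) (by omega)) (hU.bracket_pos (by omega) (by omega))
  have f1 : bracket (U i) (U l) * bracket (U j) (U (j + 1)) =
      bracket (U i) (U (j + 1)) * bracket (U j) (U l) -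
        bracket (U i) (U j) * bracket (U (j + 1)) (U l) := by
    unfold bracket; ring
  have f2 : bracket (U (i + 1)) (U (l + 1)) * bracket (U j) (U (j + 1)) =
      bracket (U (i + 1)) (U (j + 1)) * bracket (U j) (U (l + 1)) -
        bracket (U (i + 1)) (U j) * bracket (U (j + 1)) (U (l + 1)) := by
    unfold bracket; ring
  have := mul_lt_mul'' (by linarith : bracket (U i) (U j) * bracket (U (j + 1)) (U l) <
    bracket (U i) (U (j + 1)) * bracket (U j) (U l)) (by linarith :
    bracket (U (i + 1)) (U j) * bracket (U (j + 1)) (U (l + 1)) <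
      bracket (U (i + 1)) (U (j + 1)) * bracket (U j) (U (l + 1))) c1.le c2.le
  linarith

/-- Common perpendiculars of different pairs of sides that do not interleave are disjoint. -/
theorem perp_disjoint (hU : IsVertexLift n U) (hd : IsDiagonal n (i, j)) (hd' : IsDiagonal n (k, l))
    (hne : (i, j) ≠ (k, l)) (hc : ¬ Crosses (i, j) (k, l))
    (hp : IsMinimizer (U i) (U (i + 1)) (U j) (U (j + 1)) p q)
    (hp' : IsMinimizer (U k) (U (k + 1)) (U l) (U (l + 1)) p' q') :
    Disjoint (hypSegment p q) (hypSegment p' q') := by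
  rw [Set.disjoint_left]
  intro z hz hz'
  simp only [IsDiagonal, Crosses, ne_eq, Prod.mk.injEq] at hd hd' hne hc
  rcases lt_trichotomy i k with h | rfl | h
  · rcases lt_trichotomy j k with h' | rfl | h'
    · exact hU.perp_disjoint_of_consecutive h' (by omega) (by omega) (by omega)
        hp hp' hz hz'
    · exact hU.perp_disjoint_of_common_middle (by omega) (by omega) (by omega) hp hp' hz hz'
    · rcases lt_trichotomy l j with h'' | rfl | h''
      · exact hU.perp_disjoint_of_nested h h'' (by omega) (by omega) hp hp' hz hz'
      · exact hU.perp_disjoint_of_common_right h (by omega) (by omega) hp hp' hz hz'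
      · omega
  · rcases lt_trichotomy j l with h' | rfl | h'
    · exact hU.perp_disjoint_of_common_left (by omega) h' (by omega) hp hp' hz hz'
    · omega
    · exact hU.perp_disjoint_of_common_left (by omega) h' (by omega) hp' hp hz' hz
  · rcases lt_trichotomy l i with h' | rfl | h'
    · exact hU.perp_disjoint_of_consecutive h' (by omega) (by omega) (by omega)
        hp' hp hz' hz
    · exact hU.perp_disjoint_of_common_middle (by omega) (by omega) (by omega) hp' hp hz' hz
    · rcases lt_trichotomy j l with h'' | rfl | h''
      · exact hU.perp_disjoint_of_nested h h'' (by omega) (by omega) hp' hp hz' hz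
      · exact hU.perp_disjoint_of_common_right h (by omega) (by omega) hp' hp hz' hz
      · omega

theorem not_disjoint_of_crosses (hU : IsVertexLift n U) (hd : IsDiagonal n (i, j))
    (hd' : IsDiagonal n (k, l)) (hc : Crosses (i, j) (k, l))
    (hp : IsMinimizer (U i) (U (i + 1)) (U j) (U (j + 1)) p q)
    (hp' : IsMinimizer (U k) (U (k + 1)) (U l) (U (l + 1)) p' q') :
    ¬ Disjoint (hypSegment p q) (hypSegment p' q') := by
  rw [Set.not_disjoint_iff]
  simp only [IsDiagonal, Crosses] at hd hd' hc
  rcases hc with hc | hc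
  · exact hU.perp_inter_of_crossing hc.1 hc.2.1 hc.2.2 (by omega) (by omega) (by omega) hp hp'
  · obtain ⟨z, h1, h2⟩ :=
      hU.perp_inter_of_crossing hc.1 hc.2.1 hc.2.2 (by omega) (by omega) (by omega) hp' hp
    exact ⟨z, h2, h1⟩

end IsVertexLift

/-! ### Ideal polygons, and their decompositions as triangulations. -/

/-- A vector of `ℝ²` representing a point of `ℝ ∪ {∞}`. -/
def liftIdeal : WithTop ℝ → ℝ × ℝ
  | some a => (a, 1)
  | none => (1, 0)

theorem bracket_liftIdeal_pos : ∀ {a b : WithTop ℝ}, a < b → 0 < bracket (liftIdeal a) (liftIdeal b)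
  | some a, some b, h => by
    have : a < b := WithTop.coe_lt_coe.1 h
    simp only [bracket, liftIdeal]; linarith
  | some a, none, _ => by simp [bracket, liftIdeal]
  | none, b, h => absurd h (not_lt_of_ge le_top)

theorem mem_hypGeodesic_iff (z : ℍ) : ∀ {a b : WithTop ℝ}, a ≠ b →
    (z ∈ hypGeodesic a b ↔ hypForm z (liftIdeal a) (liftIdeal b) = 0)
  | some a, some b, _ => by
    have := z.im_ne_zero
    simp only [hypGeodesic, hypForm, liftIdeal, Set.mem_ofPred_eq, div_eq_zero_iff, this, or_false]
    constructor <;> intro h <;> linear_combination h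
  | some a, none, _ => by
    have := z.im_ne_zero
    simp only [hypGeodesic, hypForm, liftIdeal, Set.mem_ofPred_eq, div_eq_zero_iff, this, or_false]
    constructor <;> intro h <;> linear_combination -h
  | none, some b, _ => by
    have := z.im_ne_zero
    simp only [hypGeodesic, hypForm, liftIdeal, Set.mem_ofPred_eq, div_eq_zero_iff, this, or_false]
    constructor <;> intro h <;> linear_combination -h
  | none, none, h => absurd rfl h

theorem val_finRotate {n : ℕ} (i : Fin n) : ((finRotate n i : Fin n) : ℕ) =
    if (i : ℕ) + 1 = n then 0 else (i : ℕ) + 1 := by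
  obtain _ | m := n
  · exact i.elim0
  rw [coe_finRotate]
  have := i.isLt
  by_cases h : i = Fin.last m
  · subst h; simp
  · have h' : (i : ℕ) ≠ m := fun hh => h (Fin.ext hh)
    rw [if_neg h, if_neg (by omega)]

theorem nonadjacent_iff_isDiagonal {n : ℕ} {i j : Fin n} (h : i < j) :
    (j ≠ finRotate n i ∧ i ≠ finRotate n j) ↔ IsDiagonal n (i, j) := by
  have h1 := val_finRotate i
  have h2 := val_finRotate j
  have := i.isLt
  have := j.isLt
  simp only [IsDiagonal, ne_eq, Fin.ext_iff, h1, h2, Fin.lt_def] at *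
  split_ifs <;> omega

theorem not_crosses_self (e : ℕ × ℕ) : ¬ Crosses e e := by
  simp only [Crosses]; omega

namespace IdealPolygon

variable {n : ℕ}

namespace Orthogeodesic

variable {P : IdealPolygon n}

/-- The pair of sides joined by an orthogeodesic. -/
def pair (μ : P.Orthogeodesic) : ℕ × ℕ := (μ.i, μ.j)

theorem isDiagonal_pair (μ : P.Orthogeodesic) : IsDiagonal n μ.pair :=
  (nonadjacent_iff_isDiagonal μ.lt).1 μ.nonadjacent

theorem two_le (μ : P.Orthogeodesic) : 2 ≤ n := by
  have h := μ.isDiagonal_pair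
  simp only [IsDiagonal] at h
  omega

end Orthogeodesic

variable [NeZero n]

/-- The lift of the vertices of a polygon to an antiperiodic sequence of vectors. -/
noncomputable def lift (P : IdealPolygon n) (k : ℕ) : ℝ × ℝ :=
  (-1 : ℝ) ^ (k / n) • liftIdeal (P.vertex (Fin.ofNat n k))

theorem lift_val (P : IdealPolygon n) (i : Fin n) : P.lift i = liftIdeal (P.vertex i) := by
  simp [lift, Nat.div_eq_of_lt i.isLt]

theorem isVertexLift (P : IdealPolygon n) : IsVertexLift n P.lift := by
  have hn : 0 < n := Nat.pos_of_ne_zero (NeZero.ne n)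
  have hanti : ∀ k, P.lift (k + n) = -P.lift k := fun k => by
    have : Fin.ofNat n (k + n) = Fin.ofNat n k := by ext; simp
    rw [lift, lift, this, Nat.add_div_right k hn, pow_succ]
    simp
  have hbase : ∀ {a b : ℕ}, a < b → b < n → 0 < bracket (P.lift a) (P.lift b) := fun {a b} h1 h2 => by
    have := P.strictMono_vertex (a := ⟨a, by omega⟩) (b := ⟨b, h2⟩) h1
    have h := bracket_liftIdeal_pos this
    rwa [← P.lift_val, ← P.lift_val] at h
  refine ⟨hanti, fun {a b} => ?_⟩
  induction a using Nat.strong_induction_on generalizing b with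
  | _ a ih =>
  intro h1 h2
  by_cases ha : a < n
  · by_cases hb : b < n
    · exact hbase h1 hb
    · obtain ⟨c, rfl⟩ : ∃ c, b = c + n := ⟨b - n, by omega⟩
      rw [hanti, bracket_neg_right, ← bracket_swap]
      exact hbase (by omega) ha
  · obtain ⟨c, rfl⟩ : ∃ c, a = c + n := ⟨a - n, by omega⟩
    obtain ⟨d, rfl⟩ : ∃ c, b = c + n := ⟨b - n, by omega⟩
    rw [hanti, hanti, bracket_neg_right, bracket_neg_left, neg_neg]
    exact ih c (by omega) (by omega) (by omega)

theorem mem_side_iff (hn : 2 ≤ n) (P : IdealPolygon n) (i : Fin n) (z : ℍ) :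
    z ∈ P.side i ↔ hypForm z (P.lift i) (P.lift (i + 1)) = 0 := by
  have hrot := val_finRotate i
  have hlt := i.isLt
  rw [side, mem_hypGeodesic_iff, ← P.lift_val, ← P.lift_val, hrot]
  · split_ifs with h
    · rw [h, show P.lift n = -P.lift 0 by simpa using P.isVertexLift.antiperiodic 0,
        hypForm_neg_right, neg_eq_zero]
    · rfl
  · intro h
    have h2 := congrArg Fin.val (P.strictMono_vertex.injective h)
    rw [hrot] at h2
    split_ifs at h2 <;> omega

namespace Orthogeodesic

variable {P : IdealPolygon n}

theorem isMinimizer (μ : P.Orthogeodesic) :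
    PerpFrame.IsMinimizer (P.lift μ.pair.1) (P.lift (μ.pair.1 + 1)) (P.lift μ.pair.2)
      (P.lift (μ.pair.2 + 1)) μ.p μ.q :=
  ⟨(P.mem_side_iff μ.two_le _ _).1 μ.p_mem, (P.mem_side_iff μ.two_le _ _).1 μ.q_mem,
    fun x y hx hy => μ.dist_le x ((P.mem_side_iff μ.two_le _ _).2 hx) y
      ((P.mem_side_iff μ.two_le _ _).2 hy)⟩

theorem nonempty_frame (μ : P.Orthogeodesic) :
    Nonempty (PerpFrame (P.lift μ.pair.1) (P.lift (μ.pair.1 + 1)) (P.lift μ.pair.2)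
      (P.lift (μ.pair.2 + 1))) := by
  have h := μ.isDiagonal_pair
  simp only [IsDiagonal] at h
  exact P.isVertexLift.nonempty_frame (by omega) (by omega)

theorem pair_injective : Function.Injective (pair : P.Orthogeodesic → ℕ × ℕ) := by
  intro μ ν h
  obtain ⟨F⟩ := μ.nonempty_frame
  have h1 := ν.isMinimizer
  rw [← h] at h1
  obtain ⟨hp, hq⟩ := F.minimizer_unique μ.isMinimizer h1
  obtain ⟨i, j, _, _, p, q, _, _, _⟩ := μ
  obtain ⟨i', j', _, _, p', q', _, _, _⟩ := ν
  simp only [pair, Prod.mk.injEq, Fin.val_inj] at h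
  obtain ⟨rfl, rfl⟩ := h
  simp only at hp hq
  subst hp hq
  rfl

theorem exists_pair_eq (P : IdealPolygon n) {e : ℕ × ℕ} (he : IsDiagonal n e) :
    ∃ μ : P.Orthogeodesic, μ.pair = e := by
  obtain ⟨a, b⟩ := e
  have he' := he
  simp only [IsDiagonal] at he'
  obtain ⟨F⟩ := P.isVertexLift.nonempty_frame (i := a) (j := b) (by omega) (by omega)
  obtain ⟨p, q, hp, hq, hm⟩ := F.exists_isMinimizer
  have hlt : (⟨a, by omega⟩ : Fin n) < ⟨b, by omega⟩ := Fin.mk_lt_mk.2 (by omega)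
  have hn : 2 ≤ n := by omega
  exact ⟨⟨⟨a, by omega⟩, ⟨b, by omega⟩, hlt, (nonadjacent_iff_isDiagonal hlt).2 he, p, q,
    (P.mem_side_iff hn _ _).2 hp, (P.mem_side_iff hn _ _).2 hq,
    fun x hx y hy => hm x y ((P.mem_side_iff hn _ _).1 hx) ((P.mem_side_iff hn _ _).1 hy)⟩, rfl⟩

theorem disjoint_carrier_iff {μ ν : P.Orthogeodesic} (h : μ ≠ ν) :
    Disjoint μ.carrier ν.carrier ↔ ¬ Crosses μ.pair ν.pair :=
  ⟨fun hd hc => P.isVertexLift.not_disjoint_of_crosses μ.isDiagonal_pair ν.isDiagonal_pair hc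
    μ.isMinimizer ν.isMinimizer hd,
  fun hc => P.isVertexLift.perp_disjoint μ.isDiagonal_pair ν.isDiagonal_pair
    (fun he => h (pair_injective he)) hc μ.isMinimizer ν.isMinimizer⟩

/-- The length of an orthogeodesic as a cross-ratio. -/
theorem sq_cosh_half_length (μ : P.Orthogeodesic) : Real.cosh (μ.length / 2) ^ 2 =
    bracket (P.lift μ.pair.1) (P.lift μ.pair.2) *
      bracket (P.lift (μ.pair.1 + 1)) (P.lift (μ.pair.2 + 1)) /
    (bracket (P.lift μ.pair.1) (P.lift (μ.pair.1 + 1)) *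
      bracket (P.lift μ.pair.2) (P.lift (μ.pair.2 + 1))) := by
  obtain ⟨F⟩ := μ.nonempty_frame
  exact F.sq_cosh_half_dist μ.isMinimizer

instance : Finite P.Orthogeodesic :=
  Finite.of_injective (fun μ : P.Orthogeodesic => (μ.i, μ.j)) fun μ ν h =>
    pair_injective (by
      simp only [Prod.mk.injEq] at h
      rw [pair, pair, h.1, h.2])

end Orthogeodesic

/-- `pair` is a bijection from orthogeodesics onto diagonals by existence and uniqueness of the
perpendicular, and it turns disjointness of distinct carriers into noncrossing. Both maximality
conditions then agree. -/
theorem isOrthogeodesicDecomposition_iff (P : IdealPolygon n) (D : Set P.Orthogeodesic) :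
    P.IsOrthogeodesicDecomposition D ↔ IsTriangulation n (Orthogeodesic.pair '' D) := by
  constructor
  · intro h
    refine ⟨?_, ?_, ?_⟩
    · rintro _ ⟨μ, -, rfl⟩
      exact μ.isDiagonal_pair
    · rintro _ ⟨μ, hμ, rfl⟩ _ ⟨ν, hν, rfl⟩
      by_cases hne : μ = ν
      · subst hne; exact not_crosses_self _
      · exact (Orthogeodesic.disjoint_carrier_iff hne).1 (h.prop hμ hν hne)
    · intro e he hc
      obtain ⟨μ, rfl⟩ := Orthogeodesic.exists_pair_eq P he
      refine ⟨μ, ?_, rfl⟩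
      refine h.le_of_ge (y := insert μ D) ?_ (Set.subset_insert μ D) (Set.mem_insert μ D)
      refine h.prop.insert fun ν hν hne => ?_
      have := (Orthogeodesic.disjoint_carrier_iff hne).2 (hc _ ⟨ν, hν, rfl⟩)
      exact ⟨this, this.symm⟩
  · intro h
    refine ⟨fun μ hμ ν hν hne => (Orthogeodesic.disjoint_carrier_iff hne).2
      (h.noncrossing _ ⟨μ, hμ, rfl⟩ _ ⟨ν, hν, rfl⟩), fun E hE hDE μ hμ => ?_⟩
    obtain ⟨ν, hν, he⟩ := h.maximal μ.pair μ.isDiagonal_pair (by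
      rintro _ ⟨ν, hν, rfl⟩
      by_cases hne : μ = ν
      · subst hne; exact not_crosses_self _
      · exact (Orthogeodesic.disjoint_carrier_iff hne).1 (hE hμ (hDE hν) hne))
    rwa [← Orthogeodesic.pair_injective he]

theorem IsOrthogeodesicDecomposition.ncard_eq (hn : 3 ≤ n) {P : IdealPolygon n}
    {D : Set P.Orthogeodesic} (h : P.IsOrthogeodesicDecomposition D) : D.ncard = n - 3 := by
  rw [← ((P.isOrthogeodesicDecomposition_iff D).1 h).ncard_eq hn,
    Set.ncard_image_of_injective _ Orthogeodesic.pair_injective]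

end IdealPolygon

/-! ### The optimal constant is attained. -/

/-- A lower bound of the admissible bounds that is approached by them is admissible: the lengths
of the orthogeodesics of a polygon form a finite set. -/
theorem isOrthoBound_of_forall_gt {n : ℕ} [NeZero n] {c : ℝ} (h : ∀ L, c < L → IsOrthoBound n L) :
    IsOrthoBound n c := by
  intro P
  classical
  by_cases hne : {μ : P.Orthogeodesic | c < μ.length}.Nonempty
  · obtain ⟨μ, hμ, hmin⟩ := Set.exists_min_image _ (fun μ : P.Orthogeodesic => μ.length)
      (Set.toFinite _) hne
    have hμ' : c < μ.length := hμ
    -- `μ` has the least length above `c`, so no length lies above `c` and at most at this midpoint.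
    obtain ⟨D, hD, hL⟩ := h ((c + μ.length) / 2) (by linarith) P
    refine ⟨D, hD, fun ν hν => ?_⟩
    by_contra hcon
    have h1 := hmin ν (not_le.1 hcon)
    have h2 := hL ν hν
    linarith
  · obtain ⟨D, hD, -⟩ := h (c + 1) (by linarith) P
    refine ⟨D, hD, fun ν _ => ?_⟩
    by_contra hcon
    exact hne ⟨ν, not_le.1 hcon⟩

theorem isLeast_orthoConst {n : ℕ} [NeZero n] {lo hi : ℝ} (hlo : ∀ L, IsOrthoBound n L → lo ≤ L)
    (hhi : IsOrthoBound n hi) : IsLeast {L : ℝ | IsOrthoBound n L} (orthoConst n) := by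
  have hbdd : BddBelow {L : ℝ | IsOrthoBound n L} := ⟨lo, fun L hL => hlo L hL⟩
  refine ⟨isOrthoBound_of_forall_gt fun L hL => ?_, fun L hL => csInf_le hbdd hL⟩
  obtain ⟨L', hL', hlt⟩ := exists_lt_of_csInf_lt ⟨hi, hhi⟩ hL
  intro P
  obtain ⟨D, hD, hb⟩ := hL' P
  exact ⟨D, hD, fun μ hμ => (hb μ hμ).trans hlt.le⟩

/-! ### The upper bound: discs inside the polygon touching two sides. -/

/-- The functional `x` applied to the vector `u`. -/
def pairing (x u : ℝ × ℝ) : ℝ := x.1 * u.1 + x.2 * u.2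

/-- As `T` varies, the point runs along the geodesic whose ideal endpoints are the kernels of `x`
and `y`, tending to the kernel of `y` as `T` grows. Centres of discs are moved in this way. -/
theorem exists_hypForm_eq_sq_add_sq {x y : ℝ × ℝ} (h : x.1 * y.2 - x.2 * y.1 ≠ 0) {T : ℝ} (hT : 0 < T) :
    ∃ z : ℍ, ∃ κ : ℝ, 0 < κ ∧ ∀ u v, hypForm z u v =
      κ * (pairing x u * pairing x v + T * (pairing y u * pairing y v)) := by
  have hdet : (x.1 ^ 2 + T * y.1 ^ 2) * (x.2 ^ 2 + T * y.2 ^ 2) -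
      (-(x.1 * x.2 + T * (y.1 * y.2))) ^ 2 = T * (x.1 * y.2 - x.2 * y.1) ^ 2 := by ring
  have hpos : 0 < T * (x.1 * y.2 - x.2 * y.1) ^ 2 := by positivity
  have ha : 0 < x.1 ^ 2 + T * y.1 ^ 2 := by
    have h0 : 0 ≤ x.1 ^ 2 + T * y.1 ^ 2 := by positivity
    refine h0.lt_of_ne' fun hz => ?_
    rw [hz] at hdet
    nlinarith [sq_nonneg (-(x.1 * x.2 + T * (y.1 * y.2)))]
  obtain ⟨z, hz⟩ := exists_hypForm_eq ha (by rw [hdet]; exact hpos)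
  rw [hdet] at hz
  refine ⟨z, _, inv_pos.2 (Real.sqrt_pos.2 hpos), fun u v => ?_⟩
  rw [hz, pairing, pairing, pairing, pairing]
  ring

/-- The linear map `ℝ² → ℂ` that turns `hypForm z` and `bracket` into inner and cross product. -/
noncomputable def complexLift (z : ℍ) (u : ℝ × ℝ) : ℂ := u.1 - u.2 * z

theorem complexLift_re (z : ℍ) (u : ℝ × ℝ) : (complexLift z u).re = u.1 - u.2 * z.re := by
  simp [complexLift]

theorem complexLift_im (z : ℍ) (u : ℝ × ℝ) : (complexLift z u).im = -(u.2 * z.im) := by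
  simp [complexLift]

theorem complexLift_neg (z : ℍ) (u : ℝ × ℝ) : complexLift z (-u) = -complexLift z u := by
  simp only [complexLift, Prod.fst_neg, Prod.snd_neg, Complex.ofReal_neg]; ring

theorem complexLift_inner (z : ℍ) (u v : ℝ × ℝ) :
    (complexLift z u).re * (complexLift z v).re + (complexLift z u).im * (complexLift z v).im =
      z.im * hypForm z u v := by
  have := z.im_ne_zero
  rw [complexLift_re, complexLift_re, complexLift_im, complexLift_im, hypForm]
  field_simp
  ring

theorem complexLift_cross (z : ℍ) (u v : ℝ × ℝ) :
    (complexLift z u).re * (complexLift z v).im - (complexLift z u).im * (complexLift z v).re =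
      z.im * bracket u v := by
  rw [complexLift_re, complexLift_re, complexLift_im, complexLift_im, bracket]
  ring

/-- Two complex numbers become symmetric with respect to the real axis after a rotation. -/
theorem exists_rotation {a b : ℂ} (h : 0 < a.re * b.im - a.im * b.re) :
    ∃ ρ : ℂ, ρ ≠ 0 ∧ 0 < (ρ * b).re ∧ 0 < ((ρ * a) * (ρ * b)).re ∧ ((ρ * a) * (ρ * b)).im = 0 := by
  obtain ⟨c, hc⟩ := IsAlgClosed.exists_pow_nat_eq (a * b) two_pos
  have ha : a ≠ 0 := by rintro rfl; simp at h
  have hb : b ≠ 0 := by rintro rfl; simp at h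
  have hc0 : c ≠ 0 := by rintro rfl; simp [ha, hb] at hc
  have hN : 0 < Complex.normSq c := Complex.normSq_pos.2 hc0
  -- Multiplying by the conjugate of a square root of `a * b` makes the product of the rotated
  -- numbers positive.
  set ρ := (starRingEnd ℂ) c with hρ
  have hρ0 : ρ ≠ 0 := by simpa [hρ] using hc0
  have hprod : (ρ * a) * (ρ * b) = ((Complex.normSq c ^ 2 : ℝ) : ℂ) := by
    calc (ρ * a) * (ρ * b) = (c * ρ) ^ 2 := by rw [mul_pow, hc]; ring
      _ = _ := by rw [hρ, Complex.mul_conj]; push_cast; rfl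
  have hre : 0 < ((ρ * a) * (ρ * b)).re := by rw [hprod, Complex.ofReal_re]; positivity
  have him : ((ρ * a) * (ρ * b)).im = 0 := by rw [hprod, Complex.ofReal_im]
  have hne : (ρ * b).re ≠ 0 := by
    intro h0
    have h1 : (ρ * a).re * (ρ * b).im - (ρ * a).im * (ρ * b).re =
        Complex.normSq ρ * (a.re * b.im - a.im * b.re) := by
      simp only [Complex.mul_re, Complex.mul_im, Complex.normSq_apply]; ring
    have h2 : 0 < Complex.normSq ρ * (a.re * b.im - a.im * b.re) :=
      mul_pos (Complex.normSq_pos.2 hρ0) h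
    rw [Complex.mul_im, h0, mul_zero, add_zero] at him
    rw [h0] at h1
    linarith
  rcases hne.lt_or_gt with h0 | h0
  · refine ⟨-ρ, neg_ne_zero.2 hρ0, ?_, ?_, ?_⟩
    · rw [neg_mul, Complex.neg_re]; linarith
    · rwa [neg_mul ρ a, neg_mul ρ b, neg_mul_neg]
    · rwa [neg_mul ρ a, neg_mul ρ b, neg_mul_neg]
  · exact ⟨ρ, hρ0, h0, hre, him⟩

/-- Orthogonal coordinates at `z` in which the vectors `a` and `b` are symmetric with respect to the
first axis. -/
theorem exists_symmetric_coordinates (z : ℍ) {a b : ℝ × ℝ} (hab : 0 < bracket a b) :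
    ∃ x y : ℝ × ℝ, ∃ κ μ : ℝ, 0 < κ ∧ 0 < μ ∧ x.1 * y.2 - x.2 * y.1 ≠ 0 ∧
      (∀ u v, pairing x u * pairing x v + pairing y u * pairing y v = κ * hypForm z u v) ∧
      (∀ u v, pairing x u * pairing y v - pairing y u * pairing x v = κ * bracket u v) ∧
      0 < pairing x b ∧ 0 < pairing y b ∧
      pairing x a = μ * pairing x b ∧ pairing y a = -μ * pairing y b := by
  have hy := z.im_pos
  obtain ⟨ρ, hρ, h1, h2, h3⟩ := exists_rotation (a := complexLift z a) (b := complexLift z b)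
    (by rw [complexLift_cross]; positivity)
  have hN := Complex.normSq_pos.2 hρ
  let x : ℝ × ℝ := (ρ.re, -(ρ.re * z.re - ρ.im * z.im))
  let y : ℝ × ℝ := (ρ.im, -(ρ.re * z.im + ρ.im * z.re))
  have hx : ∀ u, pairing x u = (ρ * complexLift z u).re := fun u => by
    rw [Complex.mul_re, complexLift_re, complexLift_im]; simp only [pairing, x]; ring
  have hy' : ∀ u, pairing y u = (ρ * complexLift z u).im := fun u => by
    rw [Complex.mul_im, complexLift_re, complexLift_im]; simp only [pairing, y]; ring
  have hcr : ∀ u v, pairing x u * pairing y v - pairing y u * pairing x v =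
      Complex.normSq ρ * z.im * bracket u v := fun u v => by
    rw [mul_assoc, ← complexLift_cross, hx, hx, hy', hy']
    simp only [Complex.mul_re, Complex.mul_im, Complex.normSq_apply]; ring
  have hxa := hcr a b
  have hpos : 0 < Complex.normSq ρ * z.im * bracket a b := by positivity
  rw [Complex.mul_re, ← hx, ← hx, ← hy', ← hy'] at h2
  rw [Complex.mul_im, ← hx, ← hx, ← hy', ← hy'] at h3
  rw [← hx] at h1
  set Xa := pairing x a
  set Xb := pairing x b
  set Ya := pairing y a
  set Yb := pairing y b
  have hS : 0 < Xb ^ 2 + Yb ^ 2 := by positivity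
  have ea : Xa = (Xa * Xb - Ya * Yb) / (Xb ^ 2 + Yb ^ 2) * Xb := by
    field_simp; linear_combination Yb * h3
  have eb : Ya = -((Xa * Xb - Ya * Yb) / (Xb ^ 2 + Yb ^ 2)) * Yb := by
    field_simp; linear_combination Xb * h3
  have hμ : 0 < (Xa * Xb - Ya * Yb) / (Xb ^ 2 + Yb ^ 2) := by positivity
  refine ⟨x, y, Complex.normSq ρ * z.im, _, by positivity, hμ, ?_, fun u v => ?_, hcr, h1, ?_, ea, eb⟩
  · have : x.1 * y.2 - x.2 * y.1 = -(Complex.normSq ρ * z.im) := by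
      simp only [x, y, Complex.normSq_apply]; ring
    rw [this]
    exact neg_ne_zero.2 (by positivity)
  · rw [mul_assoc, ← complexLift_inner, hx, hx, hy', hy']
    simp only [Complex.mul_re, Complex.mul_im, Complex.normSq_apply]; ring
  · have : 0 < Xa * Yb := by linarith
    have h5 : 0 < Xa := by
      rw [ea]; positivity
    exact pos_of_mul_pos_right this h5.le

/-- The cotangent of half the angle under which the side between consecutive vertices is seen. -/
noncomputable def sideCot (U : ℕ → ℝ × ℝ) (z : ℍ) (k : ℕ) : ℝ :=
  hypForm z (U k) (U (k + 1)) / bracket (U k) (U (k + 1))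

/-- Some disc inside the polygon touches the sides `s` and `t`. -/
def Touches (U : ℕ → ℝ × ℝ) (s t : ℕ) : Prop :=
  ∃ z : ℍ, sideCot U z s = sideCot U z t ∧ ∀ l, sideCot U z s ≤ sideCot U z l

/-- Comparison of lengths in the normalized position. -/
theorem inv_sub_le_inv_sub {m m' M N : ℝ} (h1 : m ≤ M) (h2 : m' < m) (h3 : -M ≤ m') (h4 : 0 ≤ M)
    (h5 : M < N) (h : (1 + M * N) / (N - M) ≤ (1 + m * m') / (m - m')) :
    1 / (N - M) ≤ 1 / (m - m') := by
  have a1 : 0 < N - M := by linarith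
  have a2 : 0 < m - m' := by linarith
  by_contra hcon
  rw [not_le, one_div_lt_one_div a2 a1] at hcon
  -- Both `m` and `m'` lie in `[-M, M]`. A gap `m - m'` larger than `N - M` would then give a
  -- smaller quotient, contrary to `h`.
  have b1 : m * m' ≤ M * N := by
    have : |m * m'| ≤ M * M := by
      rw [abs_mul]
      exact mul_le_mul (abs_le.2 ⟨by linarith, h1⟩) (abs_le.2 ⟨h3, by linarith⟩) (abs_nonneg _) h4
    have := le_abs_self (m * m')
    nlinarith
  have b2 : 0 < 1 + M * N := by nlinarith
  have : (1 + m * m') / (m - m') < (1 + M * N) / (N - M) :=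
    (div_le_div_of_nonneg_right (by linarith) a2.le).trans_lt
      (div_lt_div_of_pos_left b2 a1 hcon)
  linarith

namespace IsVertexLift

variable {n : ℕ} {U : ℕ → ℝ × ℝ}

theorem sideCot_periodic (hU : IsVertexLift n U) (z : ℍ) : Function.Periodic (sideCot U z) n := by
  intro k
  rw [sideCot, sideCot, show k + n + 1 = k + 1 + n by omega, hU.antiperiodic, hU.antiperiodic,
    hypForm_neg_left, hypForm_neg_right, bracket_neg_left, bracket_neg_right, neg_neg, neg_neg]

theorem le_sideCot (hU : IsVertexLift n U) {z : ℍ} {s : ℕ} (hs : s < n) {c : ℝ}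
    (h : ∀ l, s ≤ l → l < s + n → c ≤ sideCot U z l) (l : ℕ) : c ≤ sideCot U z l := by
  rw [← (hU.sideCot_periodic z).map_mod_nat l]
  have hl := Nat.mod_lt l (by omega : n > 0)
  by_cases h1 : s ≤ l % n
  · exact h _ h1 (by omega)
  · rw [← hU.sideCot_periodic z]
    exact h _ (by omega) (by omega)

/-- The sides `0` and `n - 1` share the vertex `U 0`. On the geodesic that issues from it and stays
equidistant from both sides, a centre close enough to the vertex has every other side farther away.
-/
theorem touches_zero_last (hU : IsVertexLift n U) (hn : 3 ≤ n) : Touches U 0 (n - 1) := by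
  have d1 : 0 < bracket (U 0) (U 1) := hU.bracket_pos (by omega) (by omega)
  have d2 : 0 < bracket (U 0) (U (n - 1)) := hU.bracket_pos (by omega) (by omega)
  have d3 : 0 < bracket (U 1) (U (n - 1)) := hU.bracket_pos (by omega) (by omega)
  have hUn : U (n - 1 + 1) = -U 0 := by
    rw [show n - 1 + 1 = 0 + n by omega, hU.antiperiodic]
  -- This value of `h` gives `A (n - 1) = A 0`, which makes the two sides equidistant for every `T`.
  set h := bracket (U 1) (U (n - 1)) / (bracket (U 0) (U 1) * bracket (U 0) (U (n - 1))) / 2 with hh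
  let y : ℝ × ℝ := ((U 0).2, -(U 0).1)
  let x : ℝ × ℝ := (h * (U 0).2 - (U 1).2 / bracket (U 0) (U 1),
    -h * (U 0).1 + (U 1).1 / bracket (U 0) (U 1))
  have hy : ∀ u, pairing y u = bracket (U 0) u := fun u => by
    simp only [pairing, y, bracket]; ring
  have hx : ∀ u, pairing x u = h * bracket (U 0) u + bracket u (U 1) / bracket (U 0) (U 1) :=
    fun u => by simp only [pairing, x]; field_simp; unfold bracket; ring
  have hxy : x.1 * y.2 - x.2 * y.1 = -1 := by
    simp only [x, y]; field_simp; unfold bracket; ring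
  let A : ℕ → ℝ := fun l => pairing x (U l) * pairing x (U (l + 1)) / bracket (U l) (U (l + 1))
  let C : ℕ → ℝ := fun l => pairing y (U l) * pairing y (U (l + 1)) / bracket (U l) (U (l + 1))
  obtain ⟨T, hT⟩ : ∃ T, ∀ l ∈ Finset.range n, (A 0 - A l) / C l ≤ T := by
    obtain ⟨T, hT⟩ := ((Finset.range n).image fun l => (A 0 - A l) / C l).exists_le
    exact ⟨T, fun l hl => hT _ (Finset.mem_image_of_mem _ hl)⟩
  obtain ⟨z, κ, hκ, hz⟩ := exists_hypForm_eq_sq_add_sq (x := x) (y := y)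
    (by rw [hxy]; norm_num) (T := max T 1) (by positivity)
  have hcot : ∀ l, sideCot U z l = κ * (A l + max T 1 * C l) := fun l => by
    rw [sideCot, hz]; simp only [A, C]; ring
  have hC0 : C 0 = 0 := by simp only [C, hy, bracket_self]; simp
  have hCn : C (n - 1) = 0 := by
    simp only [C, hy, hUn, bracket_neg_right, bracket_self]; simp
  have hA : A (n - 1) = A 0 := by
    simp only [A, hx, hUn, bracket_neg_right, bracket_neg_left, bracket_self, zero_add]
    rw [bracket_swap (U (n - 1)) (U 1), bracket_swap (U (n - 1)) (U 0), hh]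
    field_simp
    ring
  have heq : sideCot U z 0 = sideCot U z (n - 1) := by rw [hcot, hcot, hC0, hCn, hA]
  refine ⟨z, heq, hU.le_sideCot (s := 0) (by omega) fun l _ hl => ?_⟩
  by_cases h0 : l = 0
  · rw [h0]
  by_cases h1 : l = n - 1
  · rw [h1, heq]
  have hC : 0 < C l := by
    simp only [C, hy]
    have e1 : 0 < bracket (U 0) (U l) := hU.bracket_pos (by omega) (by omega)
    have e2 : 0 < bracket (U 0) (U (l + 1)) := hU.bracket_pos (by omega) (by omega)
    have e3 : 0 < bracket (U l) (U (l + 1)) := hU.bracket_pos (by omega) (by omega)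
    positivity
  rw [hcot, hcot, hC0]
  refine mul_le_mul_of_nonneg_left ?_ hκ.le
  have := (hT l (Finset.mem_range.2 (by omega))).trans (le_max_left T 1)
  rw [div_le_iff₀ hC] at this
  linarith

/-- A disc touching two sides can be moved until it touches a third one between them. -/
theorem exists_between (hU : IsVertexLift n U) {s t : ℕ} (hst : s + 2 ≤ t) (htn : t < n)
    (h : Touches U s t) : ∃ k, s < k ∧ k < t ∧ Touches U s k ∧ Touches U k t := by
  classical
  obtain ⟨z, heq, hle⟩ := h
  -- Coordinates centred at `z` in which the inner vertices `s + 1` and `t` are mirror images, so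
  -- that the first axis becomes the bisector of the sides `s` and `t`.
  obtain ⟨x, y, κ, μ, hκ, hμ, hxy, hdot, hcr, hxt, hyt, hxs, hys⟩ := exists_symmetric_coordinates z
    (hU.bracket_pos (a := s + 1) (b := t) (by omega) (by omega))
  set X : ℕ → ℝ := fun l => pairing x (U l) with hX
  set Y : ℕ → ℝ := fun l => pairing y (U l) with hY
  have hcr' : ∀ k l, X k * Y l - Y k * X l = κ * bracket (U k) (U l) := fun k l => hcr _ _
  have hdot' : ∀ k l, X k * X l + Y k * Y l = κ * hypForm z (U k) (U l) := fun k l => hdot _ _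
  have cpos : ∀ {k l}, k < l → l < k + n → 0 < X k * Y l - Y k * X l := fun h1 h2 => by
    rw [hcr']; exact mul_pos hκ (hU.bracket_pos h1 h2)
  have cnonneg : ∀ {k l}, k ≤ l → l ≤ k + n → 0 ≤ X k * Y l - Y k * X l := fun h1 h2 => by
    rw [hcr']; exact mul_nonneg hκ.le (hU.bracket_nonneg h1 h2)
  change 0 < X t at hxt
  change 0 < Y t at hyt
  change X (s + 1) = μ * X t at hxs
  change Y (s + 1) = -μ * Y t at hys
  let D : ℕ → ℝ := fun l => X l * Y (l + 1) - Y l * X (l + 1)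
  have hD : ∀ l, 0 < D l := fun l => cpos (by omega) (by omega)
  -- For the centre with form `x ^ 2 + T * y ^ 2`, the value of `sideCot` at `l` is proportional to
  -- `A l + T * C l`. At `T = 1` the centre is `z`; as `T` grows it moves along the bisector towards
  -- the boundary arc between `U (s + 1)` and `U t`.
  let A : ℕ → ℝ := fun l => X l * X (l + 1) / D l
  let C : ℕ → ℝ := fun l => Y l * Y (l + 1) / D l
  have hcot : ∀ l, sideCot U z l = A l + C l := fun l => by
    have h1 : sideCot U z l = (κ * hypForm z (U l) (U (l + 1))) / (κ * bracket (U l) (U (l + 1))) := by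
      rw [sideCot, mul_div_mul_left _ _ hκ.ne']
    rw [h1, ← hdot', ← hcr']
    simp only [A, C, D]; ring
  -- every vertex after `t` and up to the vertex `s + n` has positive second coordinate
  have hYpos : ∀ l, t < l → l ≤ s + n → 0 < Y l := fun l h1 h2 => by
    have e1 := cpos (k := t) (l := l) h1 (by omega)
    have e2 := cpos (k := s + 1) (l := l) (by omega) (by omega)
    rw [hxs, hys] at e2
    have e3 : 0 < X t * Y l + Y t * X l := by
      have : 0 < μ * (X t * Y l + Y t * X l) := by linarith
      exact pos_of_mul_pos_right this hμ.le
    have : 0 < X t * Y l := by linarith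
    exact pos_of_mul_pos_right this hxt.le
  have hYt1 := hYpos (t + 1) (by omega) (by omega)
  -- the vertices `s` and `t + 1` are symmetric
  obtain ⟨ν, hν, hνx, hνy⟩ : ∃ ν, 0 < ν ∧ X s = ν * X (t + 1) ∧ Y s = -ν * Y (t + 1) := by
    have f1 : A s + C s = A t + C t := by rw [← hcot, ← hcot, heq]
    have f2 : (X s * X (s + 1) + Y s * Y (s + 1)) * D t = (X t * X (t + 1) + Y t * Y (t + 1)) * D s := by
      simp only [A, C] at f1
      have := (hD s).ne'
      have := (hD t).ne'
      field_simp at f1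
      linarith
    have f3 : X s * Y (t + 1) + Y s * X (t + 1) = 0 := by
      simp only [D, hxs, hys] at f2
      have hpos : μ * (X t ^ 2 + Y t ^ 2) ≠ 0 := by positivity
      refine mul_left_cancel₀ hpos ?_
      linear_combination f2
    refine ⟨-(Y s / Y (t + 1)), ?_, ?_, ?_⟩
    · have e1 := hD s
      simp only [D, hxs, hys] at e1
      have e2 := hD t
      simp only [D] at e2
      have e3 : 0 < -(Y s) * (X t * Y (t + 1) - Y t * X (t + 1)) := by
        have : 0 < Y (t + 1) * (μ * (-(X s * Y t) - Y s * X t)) := mul_pos hYt1 (by linarith)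
        have h4 : Y (t + 1) * (μ * (-(X s * Y t) - Y s * X t)) =
            μ * (-(Y s) * (X t * Y (t + 1) - Y t * X (t + 1))) := by
          linear_combination (-μ * Y t) * f3
        rw [h4] at this
        exact pos_of_mul_pos_right this hμ.le
      have e4 : 0 < -(Y s) := pos_of_mul_pos_left e3 e2.le
      rw [← neg_div]
      positivity
    · field_simp; linarith
    · field_simp
  have hXt1 : 0 ≤ X (t + 1) := by
    have e1 := cnonneg (k := s) (l := t + 1) (by omega) (by omega)
    rw [hνx, hνy] at e1
    have e2 : 0 ≤ (2 * ν * Y (t + 1)) * X (t + 1) := by linarith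
    exact nonneg_of_mul_nonneg_right e2 (by positivity)
  have hDs : D s = μ * ν * D t := by
    simp only [D, hxs, hys, hνx, hνy]; ring
  have hAs : A s = A t := by
    have := (hD t).ne'
    simp only [A, hDs, hxs, hνx]; field_simp
  have hCs : C s = C t := by
    have := (hD t).ne'
    simp only [C, hDs, hys, hνy]; field_simp
  have hCt : 0 < C t := div_pos (mul_pos hyt hYt1) (hD t)
  -- sides on the other side
  have hout : ∀ l, t < l → l < s + n → C s ≤ C l := fun l h1 h2 => by
    have q1 := hYpos l h1 (by omega)
    have q2 := hYpos (l + 1) (by omega) (by omega)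
    have r1 := cnonneg (k := t + 1) (l := l) (by omega) (by omega)
    have r2 := cnonneg (k := l + 1) (l := s + n) (by omega) (by omega)
    have hsn : X (s + n) = -X s ∧ Y (s + n) = -Y s := by
      simp only [hX, hY, hU.antiperiodic, pairing, Prod.fst_neg, Prod.snd_neg]
      constructor <;> ring
    rw [hsn.1, hsn.2, hνx, hνy] at r2
    have r3 : 0 ≤ X (l + 1) * Y (t + 1) + Y (l + 1) * X (t + 1) := by
      have : 0 ≤ ν * (X (l + 1) * Y (t + 1) + Y (l + 1) * X (t + 1)) := by linarith
      exact nonneg_of_mul_nonneg_right this hν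
    have d1 := hD l
    have d2 := hD t
    have k1 := hle l
    rw [hcot, hcot, hAs, hCs] at k1
    rw [hCs]
    simp only [D] at d1 d2
    -- In terms of the slopes `X / Y`, which decrease along the vertices from `t` to `s + n`, `A +
    -- C` is a cotangent of a difference and `C` the inverse of a difference of slopes.
    have w1 : A t + C t = (1 + X (t + 1) / Y (t + 1) * (X t / Y t)) /
        (X t / Y t - X (t + 1) / Y (t + 1)) := by
      have : X t / Y t - X (t + 1) / Y (t + 1) = D t / (Y t * Y (t + 1)) := by
        simp only [D]; field_simp
      rw [this]
      have := (hD t).ne'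
      simp only [A, C]; field_simp; ring
    have w2 : A l + C l = (1 + X l / Y l * (X (l + 1) / Y (l + 1))) /
        (X l / Y l - X (l + 1) / Y (l + 1)) := by
      have : X l / Y l - X (l + 1) / Y (l + 1) = D l / (Y l * Y (l + 1)) := by
        simp only [D]; field_simp
      rw [this]
      have := (hD l).ne'
      simp only [A, C]; field_simp; ring
    have w3 : C t = 1 / (X t / Y t - X (t + 1) / Y (t + 1)) := by
      have : X t / Y t - X (t + 1) / Y (t + 1) = D t / (Y t * Y (t + 1)) := by
        simp only [D]; field_simp
      rw [this, one_div_div]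
    have w4 : C l = 1 / (X l / Y l - X (l + 1) / Y (l + 1)) := by
      have : X l / Y l - X (l + 1) / Y (l + 1) = D l / (Y l * Y (l + 1)) := by
        simp only [D]; field_simp
      rw [this, one_div_div]
    rw [w1, w2] at k1
    rw [w3, w4]
    refine inv_sub_le_inv_sub ?_ ?_ ?_ (by positivity) ?_ k1
    · rw [div_le_div_iff₀ q1 hYt1]; linarith
    · rw [div_lt_div_iff₀ q2 q1]; linarith
    · rw [neg_le_iff_add_nonneg, div_add_div _ _ q2.ne' hYt1.ne']
      exact div_nonneg (by linarith) (by positivity)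
    · rw [div_lt_div_iff₀ hYt1 hyt]; linarith
  -- a side between `s` and `t` that comes closer
  obtain ⟨k₁, hk₁s, hk₁t, hk₁⟩ : ∃ k, s < k ∧ k < t ∧ C k < C s := by
    have hneg : Y (s + 1) < 0 := by rw [hys]; nlinarith
    have hex : ∃ m, 0 ≤ Y (s + 1 + m) := ⟨t - (s + 1), by
      rw [show s + 1 + (t - (s + 1)) = t by omega]; exact hyt.le⟩
    set m := Nat.find hex with hm
    have h1 : 0 ≤ Y (s + 1 + m) := Nat.find_spec hex
    have hm0 : m ≠ 0 := by
      intro h0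
      rw [h0, add_zero] at h1
      linarith
    have h2 : Y (s + 1 + (m - 1)) < 0 := not_le.1 (Nat.find_min hex (by omega : m - 1 < m))
    have hmt : m ≤ t - (s + 1) := Nat.find_min' hex (by
      rw [show s + 1 + (t - (s + 1)) = t by omega]; exact hyt.le)
    refine ⟨s + 1 + (m - 1), by omega, by omega, ?_⟩
    rw [hCs]
    refine lt_of_le_of_lt ?_ hCt
    refine div_nonpos_of_nonpos_of_nonneg ?_ (hD _).le
    rw [show s + 1 + (m - 1) + 1 = s + 1 + m by omega]
    exact mul_nonpos_of_nonpos_of_nonneg h2.le h1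
  let S := (Finset.Ioo s t).filter fun k => C k < C s
  have hS : S.Nonempty := ⟨k₁, by simp only [S, Finset.mem_filter, Finset.mem_Ioo]; tauto⟩
  -- Only sides with `C k < C s` come relatively closer; the least such quotient is the parameter
  -- `T` of the first contact.
  obtain ⟨k, hkS, hkmin⟩ := S.exists_min_image (fun k => (A k - A s) / (C s - C k)) hS
  simp only [S, Finset.mem_filter, Finset.mem_Ioo] at hkS hkmin
  obtain ⟨⟨hsk, hkt⟩, hCk⟩ := hkS
  set T := (A k - A s) / (C s - C k) with hT
  have hle' : ∀ l, A s + C s ≤ A l + C l := fun l => by rw [← hcot, ← hcot]; exact hle l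
  have hT1 : 1 ≤ T := by
    rw [hT, one_le_div (by linarith)]
    linarith [hle' k]
  obtain ⟨z', κ', hκ', hz'⟩ := exists_hypForm_eq_sq_add_sq hxy (T := T) (by linarith)
  have hcot' : ∀ l, sideCot U z' l = κ' * κ * (A l + T * C l) := fun l => by
    have hDl : D l = κ * bracket (U l) (U (l + 1)) := hcr' l (l + 1)
    have : bracket (U l) (U (l + 1)) = D l / κ := by rw [hDl]; field_simp
    rw [sideCot, hz', this]
    have := (hD l).ne'
    simp only [A, C, hX, hY]; field_simp
  have hkk : 0 < κ' * κ := by positivity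
  have hst' : sideCot U z' s = sideCot U z' t := by rw [hcot', hcot', hAs, hCs]
  have hsk' : sideCot U z' s = sideCot U z' k := by
    rw [hcot', hcot', hT]
    have : C s - C k ≠ 0 := by linarith
    congr 1
    field_simp
    ring
  have hlt : ∀ l, C s ≤ C l → A s + T * C s ≤ A l + T * C l := fun l hl => by
    have h1 := hle' l
    have h2 : 0 ≤ (T - 1) * (C l - C s) := mul_nonneg (by linarith) (by linarith)
    linarith
  have hall : ∀ l, sideCot U z' s ≤ sideCot U z' l := hU.le_sideCot (s := s) (by omega) fun l h1 h2 => by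
    rcases h1.eq_or_lt with rfl | h1
    · exact le_rfl
    rcases lt_trichotomy l t with h3 | rfl | h3
    · rw [hcot', hcot']
      refine mul_le_mul_of_nonneg_left ?_ hkk.le
      by_cases h4 : C l < C s
      · have h5 := hkmin l ⟨⟨h1, h3⟩, h4⟩
        rw [le_div_iff₀ (by linarith)] at h5
        linarith
      · exact hlt l (not_lt.1 h4)
    · exact hst'.le
    · rw [hcot', hcot']
      exact mul_le_mul_of_nonneg_left (hlt l (hout l h3 h2)) hkk.le
  exact ⟨k, hsk, hkt, ⟨z', hsk', hall⟩, ⟨z', hsk'.symm.trans hst', fun l => hsk' ▸ hall l⟩⟩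

/-- The sides are seen from a point under angles whose sum is the full angle. -/
theorem exists_sideCot_le (hU : IsVertexLift n U) (hn : 2 ≤ n) (z : ℍ) :
    ∃ k, sideCot U z k ≤ Real.cot (Real.pi / n) := by
  by_contra! hcon
  have hy := z.im_pos
  have hn0 : (0 : ℝ) < n := by exact_mod_cast (by omega : 0 < n)
  have hpi0 : 0 < Real.pi / n := by positivity
  have hpi1 : Real.pi / n < Real.pi := by
    rw [div_lt_iff₀ hn0]
    have : (2 : ℝ) ≤ n := by exact_mod_cast hn
    nlinarith [Real.pi_pos]
  have hsin : 0 < Real.sin (Real.pi / n) := Real.sin_pos_of_pos_of_lt_pi hpi0 hpi1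
  -- From `W k` to `W (k + 1)` the argument grows by half the angle under which side `k` is seen. If
  -- every step stayed below `π / n`, the total turn would lie strictly between 0 and `π`, whereas
  -- `W n = -W 0`.
  let W : ℕ → ℂ := fun k => complexLift z (U k)
  have hW0 : ∀ k, W k ≠ 0 := fun k h0 => by
    have h1 := complexLift_cross z (U k) (U (k + 1))
    have h2 : 0 < z.im * bracket (U k) (U (k + 1)) :=
      mul_pos hy (hU.bracket_pos (by omega) (by omega))
    simp only [W] at h0
    rw [h0] at h1
    simp at h1
    rcases h1 with h1 | h1
    · exact absurd h1 z.im_ne_zero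
    · rw [h1] at h2; simp at h2
  have hang : ∀ k, 0 < (W (k + 1) / W k).arg ∧ (W (k + 1) / W k).arg < Real.pi / n := fun k => by
    have hN : 0 < Complex.normSq (W k) := Complex.normSq_pos.2 (hW0 k)
    have hbr : 0 < bracket (U k) (U (k + 1)) := hU.bracket_pos (by omega) (by omega)
    have him : (W (k + 1) / W k).im = z.im * bracket (U k) (U (k + 1)) / Complex.normSq (W k) := by
      rw [Complex.div_im, ← complexLift_cross]; simp only [W]; ring
    have hre : (W (k + 1) / W k).re = z.im * hypForm z (U k) (U (k + 1)) / Complex.normSq (W k) := by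
      rw [Complex.div_re, ← complexLift_inner]; simp only [W]; ring
    have hq0 : W (k + 1) / W k ≠ 0 := div_ne_zero (hW0 _) (hW0 _)
    have him0 : 0 < (W (k + 1) / W k).im := by rw [him]; positivity
    have hnorm : 0 < ‖W (k + 1) / W k‖ := norm_pos_iff.2 hq0
    have h0 : 0 < (W (k + 1) / W k).arg :=
      (Complex.arg_nonneg_iff.2 him0.le).lt_of_ne fun h0 => by
        have := Complex.sin_arg (W (k + 1) / W k)
        rw [← h0, Real.sin_zero] at this
        have h5 : 0 < (W (k + 1) / W k).im / ‖W (k + 1) / W k‖ := by positivity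
        linarith
    have hle := Complex.arg_le_pi (W (k + 1) / W k)
    refine ⟨h0, ?_⟩
    by_contra hge
    rw [not_lt] at hge
    have h1 : Real.sin (Real.pi / n - (W (k + 1) / W k).arg) ≤ 0 :=
      Real.sin_nonpos_of_nonpos_of_neg_pi_le (by linarith) (by linarith)
    rw [Real.sin_sub, Complex.sin_arg, Complex.cos_arg hq0, him, hre] at h1
    have h2 := hcon k
    rw [sideCot, Real.cot_eq_cos_div_sin, div_lt_div_iff₀ hsin hbr] at h2
    have h3 : Real.sin (Real.pi / n) * (z.im * hypForm z (U k) (U (k + 1)) / Complex.normSq (W k) /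
        ‖W (k + 1) / W k‖) - Real.cos (Real.pi / n) * (z.im * bracket (U k) (U (k + 1)) /
        Complex.normSq (W k) / ‖W (k + 1) / W k‖) = z.im / Complex.normSq (W k) / ‖W (k + 1) / W k‖ *
        (hypForm z (U k) (U (k + 1)) * Real.sin (Real.pi / n) -
          Real.cos (Real.pi / n) * bracket (U k) (U (k + 1))) := by ring
    rw [h3] at h1
    have h4 : 0 < z.im / Complex.normSq (W k) / ‖W (k + 1) / W k‖ *
        (hypForm z (U k) (U (k + 1)) * Real.sin (Real.pi / n) -
          Real.cos (Real.pi / n) * bracket (U k) (U (k + 1))) :=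
      mul_pos (by positivity) (by linarith)
    linarith
  have hprod : ∀ m, ∃ r : ℝ, 0 < r ∧ W m = W 0 * (r * Complex.exp
      ((∑ k ∈ Finset.range m, (W (k + 1) / W k).arg : ℝ) * Complex.I)) := fun m => by
    induction m with
    | zero => exact ⟨1, one_pos, by simp⟩
    | succ m ih =>
      obtain ⟨r, hr, hm⟩ := ih
      refine ⟨r * ‖W (m + 1) / W m‖, mul_pos hr (norm_pos_iff.2 (div_ne_zero (hW0 _) (hW0 _))), ?_⟩
      have h1 := Complex.norm_mul_exp_arg_mul_I (W (m + 1) / W m)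
      have h2 : W (m + 1) = W m * (W (m + 1) / W m) := by
        have := hW0 m
        field_simp
      rw [Finset.sum_range_succ, Complex.ofReal_add, add_mul, Complex.exp_add, Complex.ofReal_mul]
      calc W (m + 1) = W m * (W (m + 1) / W m) := h2
        _ = W m * (‖W (m + 1) / W m‖ * Complex.exp ((W (m + 1) / W m).arg * Complex.I)) := by rw [h1]
        _ = _ := by rw [hm]; ring
  obtain ⟨r, hr, hn'⟩ := hprod n
  have hWn : W n = -W 0 := by
    have := hU.antiperiodic 0
    rw [zero_add] at this
    simp only [W, this, complexLift_neg]
  set Θ := ∑ k ∈ Finset.range n, (W (k + 1) / W k).arg with hΘ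
  have hne : (Finset.range n).Nonempty := ⟨0, Finset.mem_range.2 (by omega)⟩
  have hΘ0 : 0 < Θ := Finset.sum_pos (fun k _ => (hang k).1) hne
  have hΘ1 : Θ < Real.pi := by
    have : Θ < ∑ _k ∈ Finset.range n, Real.pi / n :=
      Finset.sum_lt_sum_of_nonempty hne fun k _ => (hang k).2
    rw [Finset.sum_const, Finset.card_range, nsmul_eq_mul] at this
    rwa [mul_div_cancel₀ _ hn0.ne'] at this
  have h1 : (r : ℂ) * Complex.exp (Θ * Complex.I) = -1 := by
    refine mul_left_cancel₀ (hW0 0) ?_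
    rw [← hn', hWn]; ring
  have h2 := congrArg Complex.im h1
  rw [Complex.im_ofReal_mul, Complex.exp_ofReal_mul_I_im] at h2
  have h3 : 0 < r * Real.sin Θ := mul_pos hr (Real.sin_pos_of_pos_of_lt_pi hΘ0 hΘ1)
  simp at h2
  rcases h2 with h2 | h2
  · exact hr.ne' h2
  · rw [h2] at h3; simp at h3

/-- Let `f` be the common value of `sideCot` at the two touched sides. An identity writes the
cross-ratio as `(1 + f ^ 2) * bracket a c ^ 2 / (hypForm z a a * hypForm z c c)`, and the last
quotient is at most one by the Gram identity. Since `f` is the minimum over the sides, `f ≤ cot (π /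
n)`. -/
theorem cross_ratio_le (hU : IsVertexLift n U) {s t : ℕ} (hst : s + 2 ≤ t) (htn : t + 2 ≤ s + n)
    (h : Touches U s t) : bracket (U s) (U t) * bracket (U (s + 1)) (U (t + 1)) /
      (bracket (U s) (U (s + 1)) * bracket (U t) (U (t + 1))) ≤ 1 / Real.sin (Real.pi / n) ^ 2 := by
  obtain ⟨z, heq, hle⟩ := h
  obtain ⟨k, hk⟩ := hU.exists_sideCot_le (by omega) z
  have hf := (hle k).trans hk
  have g1 : 0 < bracket (U s) (U (s + 1)) := hU.bracket_pos (by omega) (by omega)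
  have g2 : 0 < bracket (U t) (U (t + 1)) := hU.bracket_pos (by omega) (by omega)
  have g3 : 0 < bracket (U s) (U t) := hU.bracket_pos (by omega) (by omega)
  have g4 : 0 < bracket (U (s + 1)) (U t) := hU.bracket_pos (by omega) (by omega)
  have g5 : 0 < bracket (U s) (U (t + 1)) := hU.bracket_pos (by omega) (by omega)
  set f := sideCot U z s with hfd
  have e1 : hypForm z (U s) (U (s + 1)) = f * bracket (U s) (U (s + 1)) := by
    rw [hfd, sideCot]; field_simp
  have e2 : hypForm z (U t) (U (t + 1)) = f * bracket (U t) (U (t + 1)) := by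
    rw [heq, sideCot]; field_simp
  have p1 := hU.self_pos (by omega) z s
  have p2 := hU.self_pos (by omega) z t
  generalize U s = a at *
  generalize U (s + 1) = b at *
  generalize U t = c at *
  generalize U (t + 1) = d at *
  have hy := z.im_ne_zero
  have i1 : hypForm z a a * hypForm z c c * bracket b d =
      bracket a b * bracket c d * bracket a c + hypForm z a b * hypForm z c d * bracket a c +
      (hypForm z a b * bracket c d - bracket a b * hypForm z c d) * hypForm z a c := by
    unfold hypForm bracket; field_simp; ring
  have i2 : hypForm z a a * bracket b c = hypForm z a b * bracket a c - bracket a b * hypForm z a c := by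
    unfold hypForm bracket; field_simp; ring
  have i3 : hypForm z c c * bracket a d = hypForm z c d * bracket a c + bracket c d * hypForm z a c := by
    unfold hypForm bracket; field_simp; ring
  have gram := hypForm_gram z a c
  rw [e1, e2] at i1
  rw [e1] at i2
  rw [e2] at i3
  -- `Touches` does not require the centre to lie inside the polygon. Positivity of `f`, needed to
  -- square `f ≤ cot (π / n)`, follows from `i2` and `i3`.
  have f0 : 0 < f := by
    have q1 : 0 < f * bracket a c - hypForm z a c := by
      have : 0 < bracket a b * (f * bracket a c - hypForm z a c) := by
        have := mul_pos p1 g4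
        linarith
      exact pos_of_mul_pos_right this g1.le
    have q2 : 0 < f * bracket a c + hypForm z a c := by
      have : 0 < bracket c d * (f * bracket a c + hypForm z a c) := by
        have := mul_pos p2 g5
        linarith
      exact pos_of_mul_pos_right this g2.le
    have : 0 < f * bracket a c := by linarith
    exact pos_of_mul_pos_left this g3.le
  have hpi : 0 < Real.sin (Real.pi / n) := by
    have hn : (2 : ℝ) ≤ n := by exact_mod_cast (by omega : 2 ≤ n)
    refine Real.sin_pos_of_pos_of_lt_pi (by positivity) ?_
    rw [div_lt_iff₀ (by linarith)]
    nlinarith [Real.pi_pos]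
  have hsq : 1 + f ^ 2 ≤ 1 / Real.sin (Real.pi / n) ^ 2 := by
    have h1 : f ^ 2 ≤ Real.cot (Real.pi / n) ^ 2 := by gcongr
    have h2 : 1 + Real.cot (Real.pi / n) ^ 2 = 1 / Real.sin (Real.pi / n) ^ 2 := by
      rw [Real.cot_eq_cos_div_sin]
      field_simp
      rw [Real.sin_sq_add_cos_sq]
    linarith
  refine le_trans ?_ hsq
  rw [div_le_iff₀ (by positivity)]
  have hpp : 0 < hypForm z a a * hypForm z c c := mul_pos p1 p2
  refine le_of_mul_le_mul_left ?_ hpp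
  have : hypForm z a a * hypForm z c c * (bracket a c * bracket b d) =
      (1 + f ^ 2) * (bracket a b * bracket c d) * bracket a c ^ 2 := by
    linear_combination bracket a c * i1
  rw [this]
  have h3 : bracket a c ^ 2 ≤ hypForm z a a * hypForm z c c := by
    nlinarith [sq_nonneg (hypForm z a c)]
  have h4 : 0 ≤ (1 + f ^ 2) * (bracket a b * bracket c d) := by positivity
  nlinarith [mul_le_mul_of_nonneg_left h3 h4]

end IsVertexLift

theorem isOrthoBound_arcosh {n : ℕ} (hn : 4 ≤ n) :
    IsOrthoBound n (2 * Real.arcosh (1 / Real.sin (Real.pi / n))) := by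
  have : NeZero n := ⟨by omega⟩
  intro P
  obtain ⟨D, hD, hR⟩ := exists_triangulation (n := n) (by omega)
    (P.isVertexLift.touches_zero_last (by omega))
    fun i j h1 h2 h3 => P.isVertexLift.exists_between h1 h2 h3
  refine ⟨IdealPolygon.Orthogeodesic.pair ⁻¹' D, ?_, fun μ hμ => ?_⟩
  · rw [P.isOrthogeodesicDecomposition_iff, Set.image_preimage_eq_of_subset]
    · exact hD
    · intro e he
      obtain ⟨μ, hμ⟩ := IdealPolygon.Orthogeodesic.exists_pair_eq P (hD.diag e he)
      exact ⟨μ, hμ⟩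
  · have hdg := μ.isDiagonal_pair
    simp only [IsDiagonal] at hdg
    have h1 := P.isVertexLift.cross_ratio_le (by omega) (by omega) (hR _ hμ)
    rw [← μ.sq_cosh_half_length, ← one_div_pow] at h1
    have hpi : 0 < Real.sin (Real.pi / n) := by
      have hn : (4 : ℝ) ≤ n := by exact_mod_cast hn
      refine Real.sin_pos_of_pos_of_lt_pi (by positivity) ?_
      rw [div_lt_iff₀ (by linarith)]
      nlinarith [Real.pi_pos]
    have h2 : Real.cosh (μ.length / 2) ≤ 1 / Real.sin (Real.pi / n) :=
      abs_le_of_sq_le_sq' h1 (by positivity) |>.2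
    have h3 := (Real.arcosh_le_arcosh (Real.cosh_pos _) (by positivity)).2 h2
    have h4 : 0 ≤ μ.length := dist_nonneg
    rw [Real.arcosh_cosh (by positivity)] at h3
    linarith

/-! ### The lower bound: polygons in which every central triangle has a long edge. -/

section LowerBound

open Real (sin cos pi cot arsinh cosh sinh)

/-- The cross-ratio attached to two sides of the polygon with vertices at given angles. -/
noncomputable def angleRatio (φ : ℕ → ℝ) (i j : ℕ) : ℝ :=
  sin (φ j - φ i) * sin (φ (j + 1) - φ (i + 1)) / (sin (φ (i + 1) - φ i) * sin (φ (j + 1) - φ j))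

/-- With vertices `-cot (φ k)`, the lifts are positive multiples of `(-cos (φ k), sin (φ k))`.
Brackets become sines of angle differences, and the scaling factors cancel in the cross-ratio. One
turn of the boundary circle corresponds to the angle `π`. -/
theorem exists_polygon_of_angles_pos {n : ℕ} [NeZero n] {φ : ℕ → ℝ}
    (hφ : ∀ k < n, φ k < φ (k + 1)) (hn : φ n = φ 0 + pi) (h0 : 0 < φ 0) (h1 : φ (n - 1) < pi) :
    ∃ P : IdealPolygon n, ∀ μ : P.Orthogeodesic,
      cosh (μ.length / 2) ^ 2 = angleRatio φ μ.pair.1 μ.pair.2 := by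
  have hpos : 0 < n := Nat.pos_of_ne_zero (NeZero.ne n)
  have hmono : ∀ {a b : ℕ}, a < b → b ≤ n → φ a < φ b := fun {a b} hab hb => by
    induction b, hab using Nat.le_induction with
    | base => exact hφ a (by omega)
    | succ b hab ih => exact (ih (by omega)).trans (hφ b (by omega))
  have hsin : ∀ k < n, 0 < sin (φ k) := fun k hk => by
    refine Real.sin_pos_of_pos_of_lt_pi ?_ ?_
    · rcases Nat.eq_zero_or_pos k with rfl | h
      · exact h0
      · exact h0.trans (hmono h hk.le)
    · rcases (show k ≤ n - 1 by omega).eq_or_lt with rfl | h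
      · exact h1
      · exact (hmono h (by omega)).trans h1
  let P : IdealPolygon n := ⟨fun k => ((-(cos (φ k) / sin (φ k)) : ℝ) : WithTop ℝ), fun a b hab => by
    have ha := hsin a a.isLt
    have hb := hsin b b.isLt
    rw [WithTop.coe_lt_coe, neg_lt_neg_iff, div_lt_div_iff₀ hb ha]
    have h2 : 0 < sin (φ b - φ a) :=
      Real.sin_pos_of_pos_of_lt_pi (sub_pos.2 (hmono hab b.isLt.le)) (by
        have h3 : φ b < pi := by
          rcases (show (b : ℕ) ≤ n - 1 by omega).eq_or_lt with h | h
          · rw [h]; exact h1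
          · exact (hmono h (by omega)).trans h1
        have h4 : 0 < φ a := by
          rcases Nat.eq_zero_or_pos (a : ℕ) with h | h
          · rw [h]; exact h0
          · exact h0.trans (hmono h a.isLt.le)
        linarith)
    rw [Real.sin_sub] at h2
    linarith⟩
  have hlift : ∀ k ≤ n, ∃ c : ℝ, 0 < c ∧ P.lift k = (-(cos (φ k)) / c, sin (φ k) / c) := fun k hk => by
    rcases hk.lt_or_eq with h | rfl
    · refine ⟨sin (φ k), hsin k h, ?_⟩
      have := P.lift_val ⟨k, h⟩
      rw [this]
      change (-(cos (φ k) / sin (φ k)), (1 : ℝ)) = _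
      rw [div_self (hsin k h).ne', neg_div]
    · refine ⟨sin (φ 0), hsin 0 hpos, ?_⟩
      have e1 := P.isVertexLift.antiperiodic 0
      rw [zero_add] at e1
      have e2 := P.lift_val ⟨0, hpos⟩
      rw [e1, e2, hn, Real.cos_add_pi, Real.sin_add_pi]
      change -(-(cos (φ 0) / sin (φ 0)), (1 : ℝ)) = _
      have hne := (hsin 0 hpos).ne'
      exact Prod.ext (by simp) (by simp [hne])
  have hbr : ∀ {a b : ℕ} {c d : ℝ}, bracket (-(cos (φ a)) / c, sin (φ a) / c)
      (-(cos (φ b)) / d, sin (φ b) / d) = sin (φ b - φ a) / (c * d) := fun {a b c d} => by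
    rw [Real.sin_sub, bracket]; simp only; ring
  refine ⟨P, fun μ => ?_⟩
  have hd := μ.isDiagonal_pair
  simp only [IsDiagonal] at hd
  obtain ⟨c1, hc1, e1⟩ := hlift μ.pair.1 (by omega)
  obtain ⟨c2, hc2, e2⟩ := hlift (μ.pair.1 + 1) (by omega)
  obtain ⟨c3, hc3, e3⟩ := hlift μ.pair.2 (by omega)
  obtain ⟨c4, hc4, e4⟩ := hlift (μ.pair.2 + 1) (by omega)
  rw [μ.sq_cosh_half_length, e1, e2, e3, e4, hbr, hbr, hbr, hbr, angleRatio]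
  have s1 : sin (φ (μ.pair.1 + 1) - φ μ.pair.1) / (c1 * c2) *
      (sin (φ (μ.pair.2 + 1) - φ μ.pair.2) / (c3 * c4)) =
      sin (φ (μ.pair.1 + 1) - φ μ.pair.1) * sin (φ (μ.pair.2 + 1) - φ μ.pair.2) /
        (c1 * c2 * c3 * c4) := by ring
  have s2 : sin (φ μ.pair.2 - φ μ.pair.1) / (c1 * c3) *
      (sin (φ (μ.pair.2 + 1) - φ (μ.pair.1 + 1)) / (c2 * c4)) =
      sin (φ μ.pair.2 - φ μ.pair.1) * sin (φ (μ.pair.2 + 1) - φ (μ.pair.1 + 1)) /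
        (c1 * c2 * c3 * c4) := by ring
  rw [s1, s2, div_div_div_cancel_right₀ (by positivity)]

theorem exists_polygon_of_angles {n : ℕ} [NeZero n] {φ : ℕ → ℝ}
    (hφ : ∀ k < n, φ k < φ (k + 1)) (hn : φ n = φ 0 + pi) :
    ∃ P : IdealPolygon n, ∀ μ : P.Orthogeodesic,
      cosh (μ.length / 2) ^ 2 = angleRatio φ μ.pair.1 μ.pair.2 := by
  have hpos : 0 < n := Nat.pos_of_ne_zero (NeZero.ne n)
  have h1 := hφ (n - 1) (by omega)
  rw [Nat.sub_add_cancel hpos] at h1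
  -- Only differences of angles matter, so the sequence is shifted to start at `ε`. Half of the last
  -- gap keeps the first `n` angles inside `(0, π)`.
  set ε := (φ n - φ (n - 1)) / 2 with hε
  have hε0 : 0 < ε := by rw [hε]; linarith
  obtain ⟨P, hP⟩ := exists_polygon_of_angles_pos (φ := fun k => φ k - φ 0 + ε)
    (fun k hk => by linarith [hφ k hk]) (by linarith) (by linarith) (by linarith)
  refine ⟨P, fun μ => ?_⟩
  have hdiff : ∀ a b, φ a - φ 0 + ε - (φ b - φ 0 + ε) = φ a - φ b := fun a b => by ring
  rw [hP, angleRatio, angleRatio]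
  simp only [hdiff]

/-- Angles for which each central triangle has a long edge give a lower bound. -/
theorem arsinh_le_of_isOrthoBound {n : ℕ} (hn : 4 ≤ n) {φ : ℕ → ℝ}
    (hφ : ∀ k < n, φ k < φ (k + 1)) (hφn : φ n = φ 0 + pi) {c : ℝ}
    (h : ∀ i j k, i < j → j < k → k < n → 2 * (j - i) ≤ n → 2 * (k - j) ≤ n → n ≤ 2 * (k - i) →
      ∃ e ∈ [(i, j), (j, k), (i, k)], IsDiagonal n e ∧ 1 + c ^ 2 ≤ angleRatio φ e.1 e.2)
    {L : ℝ} (hL : IsOrthoBound n L) : 2 * arsinh c ≤ L := by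
  have : NeZero n := ⟨by omega⟩
  obtain ⟨P, hP⟩ := exists_polygon_of_angles hφ hφn
  obtain ⟨D, hD, hb⟩ := hL P
  rw [P.isOrthogeodesicDecomposition_iff] at hD
  obtain ⟨i, j, k, e1, e2, e3, h1, h2, h3⟩ := hD.exists_central_triangle (by omega)
  obtain ⟨e, he, hdiag, hc⟩ := h i j k e1.1 e2.1 e2.2.1 h1 h2 h3
  have hedge : IsEdge n (IdealPolygon.Orthogeodesic.pair '' D) e.1 e.2 := by
    simp only [List.mem_cons, List.not_mem_nil, or_false] at he
    rcases he with rfl | rfl | rfl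
    exacts [e1, e2, e3]
  have hmem : e ∈ IdealPolygon.Orthogeodesic.pair '' D := by
    simp only [IsDiagonal] at hdiag
    rcases hedge.2.2 with h4 | h4 | h4
    · omega
    · omega
    · exact h4
  obtain ⟨μ, hμ, rfl⟩ := hmem
  rw [← hP, Real.cosh_sq] at hc
  have h4 : 0 ≤ μ.length := dist_nonneg
  have h5 : c ≤ sinh (μ.length / 2) :=
    abs_le_of_sq_le_sq' (by linarith) (Real.sinh_nonneg_iff.2 (by positivity)) |>.2
  have h6 := Real.arsinh_le_arsinh.2 h5
  rw [Real.arsinh_sinh] at h6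
  linarith [hb μ hμ]

/-- Sine is bounded below on an interval symmetric about `π / 2`. -/
theorem sin_le_sin_of_mem {s t : ℝ} (h0 : 0 ≤ s) (h1 : s ≤ t) (h2 : t ≤ pi - s) : sin s ≤ sin t := by
  rcases le_total t (pi / 2) with h | h
  · exact Real.sin_le_sin_of_le_of_le_pi_div_two (by linarith [Real.pi_pos]) h h1
  · rw [← Real.sin_pi_sub t]
    exact Real.sin_le_sin_of_le_of_le_pi_div_two (by linarith [Real.pi_pos]) (by linarith)
      (by linarith)

theorem one_add_sq_mul_cot {x : ℝ} (hx : sin x ≠ 0) :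
    1 + (√3 / 2 * cot x) ^ 2 = (3 / 4 + sin x ^ 2 / 4) / sin x ^ 2 := by
  rw [Real.cot_eq_cos_div_sin, mul_pow, div_pow, div_pow, Real.sq_sqrt (by norm_num),
    Real.cos_sq']
  field_simp
  ring

/-- With `y = x / 3`, `sin (π/3 + y) ^ 2 = 3/4 + sin (π/3 - y) * sin y`. The two factors are at
least `sin x` (this uses `x ≤ π/4`) and `sin x / 3`. -/
theorem sq_sin_ge {x t : ℝ} (hx0 : 0 < x) (hx : x ≤ pi / 4) (h1 : pi / 3 + x / 3 ≤ t)
    (h2 : t ≤ pi - (pi / 3 + x / 3)) : 3 / 4 + sin x ^ 2 / 4 ≤ sin t ^ 2 := by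
  have hpi := Real.pi_pos
  have h3 : sin (pi / 3 + x / 3) ≤ sin t := sin_le_sin_of_mem (by linarith) h1 h2
  have h4 : 0 ≤ sin (pi / 3 + x / 3) := Real.sin_nonneg_of_nonneg_of_le_pi (by linarith) (by linarith)
  have h5 : sin (pi / 3 + x / 3) ^ 2 ≤ sin t ^ 2 := by gcongr
  refine le_trans ?_ h5
  have hy0 : 0 ≤ sin (x / 3) := Real.sin_nonneg_of_nonneg_of_le_pi (by linarith) (by linarith)
  have hx0' : 0 ≤ sin x := Real.sin_nonneg_of_nonneg_of_le_pi (by linarith) (by linarith)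
  have h6 : sin (pi / 3 + x / 3) ^ 2 = 3 / 4 + sin (pi / 3 - x / 3) * sin (x / 3) := by
    rw [Real.sin_add, Real.sin_sub, Real.sin_pi_div_three, Real.cos_pi_div_three]
    have e1 : √3 ^ 2 = 3 := Real.sq_sqrt (by norm_num)
    have e2 := Real.sin_sq_add_cos_sq (x / 3)
    linear_combination (cos (x / 3) ^ 2 / 4) * e1 + (3 / 4) * e2
  have h7 : sin x ≤ 3 * sin (x / 3) := by
    have := Real.sin_three_mul (x / 3)
    rw [mul_div_cancel₀ _ (by norm_num : (3 : ℝ) ≠ 0)] at this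
    have : 0 ≤ sin (x / 3) ^ 3 := by positivity
    linarith
  have h8 : sin x ≤ sin (pi / 3 - x / 3) :=
    Real.sin_le_sin_of_le_of_le_pi_div_two (by linarith) (by linarith) (by linarith)
  rw [h6]
  nlinarith

theorem arsinh_le_of_not_three_dvd {n : ℕ} (hn : 4 ≤ n) (h3 : ¬ 3 ∣ n) {L : ℝ}
    (hL : IsOrthoBound n L) : 2 * arsinh (√3 / 2 * cot (pi / n)) ≤ L := by
  have hn' : (4 : ℝ) ≤ n := by exact_mod_cast hn
  have hn0 : (0 : ℝ) < n := by linarith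
  have hpi := Real.pi_pos
  set x := pi / n with hx
  have hx0 : 0 < x := by positivity
  have hnx : n * x = pi := by rw [hx]; field_simp
  have hx4 : x ≤ pi / 4 := by rw [hx]; gcongr
  have hs : 0 < sin x := Real.sin_pos_of_pos_of_lt_pi hx0 (by linarith)
  refine arsinh_le_of_isOrthoBound hn (φ := fun k => k * x) (fun k _ => by push_cast; nlinarith)
    (by simp [hnx]) (fun i j k hij hjk hkn g1 g2 g3 => ?_) hL
  -- The three gaps add up to `n`, which is not divisible by 3. Either one of the first two exceeds
  -- `n / 3`, or both are below it and then `k - i < 2 n / 3`.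
  obtain ⟨e, he, hdiag, q1, q2⟩ : ∃ e ∈ [(i, j), (j, k), (i, k)], IsDiagonal n e ∧
      n + 1 ≤ 3 * (e.2 - e.1) ∧ 3 * (e.2 - e.1) + 1 ≤ 2 * n := by
    by_cases c1 : n + 1 ≤ 3 * (j - i)
    · exact ⟨(i, j), by simp, by simp only [IsDiagonal]; omega, by simp only; omega,
        by simp only; omega⟩
    by_cases c2 : n + 1 ≤ 3 * (k - j)
    · exact ⟨(j, k), by simp, by simp only [IsDiagonal]; omega, by simp only; omega,
        by simp only; omega⟩
    · exact ⟨(i, k), by simp, by simp only [IsDiagonal]; omega, by simp only; omega,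
        by simp only; omega⟩
  refine ⟨e, he, hdiag, ?_⟩
  simp only [IsDiagonal] at hdiag
  obtain ⟨a, b⟩ := e
  simp only at *
  obtain ⟨d, rfl⟩ : ∃ d, b = a + d := ⟨b - a, by omega⟩
  rw [Nat.add_sub_cancel_left] at q1 q2
  have r1 : (n : ℝ) + 1 ≤ 3 * d := by exact_mod_cast q1
  have r2 : 3 * (d : ℝ) + 1 ≤ 2 * n := by exact_mod_cast q2
  have e1 : ((a + d : ℕ) : ℝ) * x - a * x = d * x := by push_cast; ring
  have e2 : ((a + d + 1 : ℕ) : ℝ) * x - (a + 1 : ℕ) * x = d * x := by push_cast; ring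
  have e3 : ((a + 1 : ℕ) : ℝ) * x - a * x = x := by push_cast; ring
  have e4 : ((a + d + 1 : ℕ) : ℝ) * x - (a + d : ℕ) * x = x := by push_cast; ring
  rw [one_add_sq_mul_cot hs.ne', angleRatio, e1, e2, e3, e4, ← sq, ← sq]
  gcongr
  exact sq_sin_ge hx0 hx4 (by nlinarith) (by nlinarith)

/-- Angles of the vertices of a polygon whose first `2 * m` sides are seen under the angle `a` and
whose remaining sides are seen under the angle `b`. -/
noncomputable def blockAngle (m : ℕ) (a b : ℝ) (k : ℕ) : ℝ :=
  if k ≤ 2 * m then k * a else 2 * m * a + (k - 2 * m) * b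

theorem blockAngle_of_le {m k : ℕ} (a b : ℝ) (h : k ≤ 2 * m) : blockAngle m a b k = k * a := if_pos h

theorem blockAngle_of_ge {m k : ℕ} (a b : ℝ) (h : 2 * m ≤ k) :
    blockAngle m a b k = 2 * m * a + (k - 2 * m) * b := by
  rcases h.eq_or_lt with rfl | h
  · rw [blockAngle_of_le a b le_rfl]; push_cast; ring
  · exact if_neg (by omega)

theorem blockAngle_succ_sub (m k : ℕ) (a b : ℝ) :
    blockAngle m a b (k + 1) - blockAngle m a b k = if k < 2 * m then a else b := by
  split_ifs with h
  · rw [blockAngle_of_le a b h, blockAngle_of_le a b (by omega)]; push_cast; ring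
  · rw [blockAngle_of_ge a b (by omega), blockAngle_of_ge a b (by omega)]; push_cast; ring

theorem mul_le_blockAngle_sub {m : ℕ} {a b : ℝ} (hab : a ≤ b) (k d : ℕ) :
    d * a ≤ blockAngle m a b (k + d) - blockAngle m a b k := by
  induction d with
  | zero => simp
  | succ d ih =>
    have h := blockAngle_succ_sub m (k + d) a b
    have h2 : a ≤ blockAngle m a b (k + d + 1) - blockAngle m a b (k + d) := by
      rw [h]; split_ifs <;> linarith
    push_cast
    rw [← add_assoc]
    linarith

/-- In the regular `3 m`-gon the triangle with gaps `m, m, m` only reaches `sin (π/3) ^ 2 = 3/4`. In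
the block polygon `h1` makes the edge of such a triangle inside the first block long enough, and
`h2` handles every other central triangle, which has an edge with at least `m + 1` steps on both
sides. -/
theorem arsinh_le_of_block {m : ℕ} (hm : 2 ≤ m) {a b c : ℝ} (ha : 0 < a) (hab : a ≤ b)
    (hsum : 2 * m * a + m * b = pi) (h1 : (1 + c ^ 2) * sin a ^ 2 ≤ sin (m * a) ^ 2)
    (h2 : sin (m * a) ^ 2 * sin b ≤ sin ((m + 1) * a) ^ 2 * sin a) {L : ℝ}
    (hL : IsOrthoBound (3 * m) L) : 2 * arsinh c ≤ L := by
  have hpi := Real.pi_pos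
  have hm' : (2 : ℝ) ≤ m := by exact_mod_cast hm
  have hb2 : b ≤ pi / 2 := by nlinarith
  have hsa : 0 < sin a := Real.sin_pos_of_pos_of_lt_pi ha (by linarith)
  have hsb : 0 < sin b := Real.sin_pos_of_pos_of_lt_pi (by linarith) (by linarith)
  have hsab : sin a ≤ sin b := Real.sin_le_sin_of_le_of_le_pi_div_two (by linarith) hb2 hab
  have h0 : blockAngle m a b 0 = 0 := by rw [blockAngle_of_le a b (by omega)]; simp
  have hlast : blockAngle m a b (3 * m) = pi := by
    rw [blockAngle_of_ge a b (by omega), ← hsum]; push_cast; ring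
  refine arsinh_le_of_isOrthoBound (n := 3 * m) (by omega) (φ := blockAngle m a b) (fun k _ => ?_)
    (by rw [h0, hlast, zero_add]) (fun i j k hij hjk hkn g1 g2 g3 => ?_) hL
  · have := blockAngle_succ_sub m k a b
    split_ifs at this <;> linarith
  by_cases hall : j = i + m ∧ k = j + m
  · obtain ⟨rfl, rfl⟩ := hall
    -- Since `i + 2 * m < 3 * m`, the sides `i` and `i + m` both belong to the block of angle `a`.
    refine ⟨(i, i + m), by simp, by simp only [IsDiagonal]; omega, ?_⟩
    have e1 : blockAngle m a b (i + m) - blockAngle m a b i = m * a := by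
      rw [blockAngle_of_le a b (by omega), blockAngle_of_le a b (by omega)]; push_cast; ring
    have e2 : blockAngle m a b (i + m + 1) - blockAngle m a b (i + 1) = m * a := by
      rw [blockAngle_of_le a b (by omega), blockAngle_of_le a b (by omega)]; push_cast; ring
    simp only [angleRatio]
    rw [e1, e2, blockAngle_succ_sub, blockAngle_succ_sub, if_pos (by omega), if_pos (by omega),
      ← sq, ← sq, le_div_iff₀ (by positivity)]
    exact h1
  obtain ⟨e, he, hdiag, q1, q2⟩ : ∃ e ∈ [(i, j), (j, k), (i, k)], IsDiagonal (3 * m) e ∧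
      m + 1 ≤ e.2 - e.1 ∧ e.2 - e.1 + m + 1 ≤ 3 * m := by
    by_cases c1 : m + 1 ≤ j - i
    · exact ⟨(i, j), by simp, by simp only [IsDiagonal]; omega, by simp only; omega,
        by simp only; omega⟩
    by_cases c2 : m + 1 ≤ k - j
    · exact ⟨(j, k), by simp, by simp only [IsDiagonal]; omega, by simp only; omega,
        by simp only; omega⟩
    · exact ⟨(i, k), by simp, by simp only [IsDiagonal]; omega, by simp only; omega,
        by simp only; omega⟩
  refine ⟨e, he, hdiag, ?_⟩
  simp only [IsDiagonal] at hdiag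
  clear he hall hkn g1 g2 g3 hij hjk
  obtain ⟨p, q⟩ := e
  simp only at *
  obtain ⟨d, rfl⟩ : ∃ d, q = p + d := ⟨q - p, by omega⟩
  rw [Nat.add_sub_cancel_left] at q1 q2
  have hsin : ∀ r, r + d ≤ 3 * m → sin ((m + 1) * a) ≤
      sin (blockAngle m a b (r + d) - blockAngle m a b r) := fun r hr => by
    have r1 := mul_le_blockAngle_sub (m := m) hab r d
    have r2 := mul_le_blockAngle_sub (m := m) hab 0 r
    -- The steps outside the edge number at least `m + 1`, so the angle also stays at least `(m + 1)
    -- * a` away from `π`.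
    have r3 := mul_le_blockAngle_sub (m := m) hab (r + d) (3 * m - (r + d))
    rw [Nat.add_sub_cancel' hr, hlast, Nat.cast_sub hr] at r3
    rw [zero_add, h0] at r2
    have s1 : ((m : ℝ) + 1) ≤ d := by exact_mod_cast q1
    have s2 : (d : ℝ) + m + 1 ≤ 3 * m := by exact_mod_cast q2
    push_cast at r3
    refine sin_le_sin_of_mem (by positivity) (by nlinarith) (by nlinarith)
  have hpos : 0 ≤ sin ((m + 1) * a) :=
    Real.sin_nonneg_of_nonneg_of_le_pi (by positivity) (by nlinarith)
  have k1 := hsin p (by omega)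
  have k2 := hsin (p + 1) (by omega)
  have hnum : sin ((m + 1) * a) ^ 2 ≤ sin (blockAngle m a b (p + d) - blockAngle m a b p) *
      sin (blockAngle m a b (p + d + 1) - blockAngle m a b (p + 1)) := by
    rw [sq, show p + d + 1 = p + 1 + d by omega]
    exact mul_le_mul k1 k2 hpos (hpos.trans k1)
  -- From `d ≥ m + 1` follows `p < 2 * m`: at most one of the two sides belongs to the block of
  -- angle `b`.
  have hden : sin (blockAngle m a b (p + 1) - blockAngle m a b p) *
      sin (blockAngle m a b (p + d + 1) - blockAngle m a b (p + d)) ≤ sin a * sin b := by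
    rw [blockAngle_succ_sub, blockAngle_succ_sub, if_pos (by omega)]
    refine mul_le_mul_of_nonneg_left ?_ hsa.le
    split_ifs
    exacts [hsab, le_rfl]
  have hden0 : 0 < sin (blockAngle m a b (p + 1) - blockAngle m a b p) *
      sin (blockAngle m a b (p + d + 1) - blockAngle m a b (p + d)) := by
    rw [blockAngle_succ_sub, blockAngle_succ_sub, if_pos (by omega)]
    refine mul_pos hsa ?_
    split_ifs
    exacts [hsa, hsb]
  simp only [angleRatio]
  rw [le_div_iff₀ hden0]
  calc (1 + c ^ 2) * _ ≤ (1 + c ^ 2) * (sin a * sin b) := by gcongr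
    _ ≤ sin ((m + 1) * a) ^ 2 := by
      refine le_of_mul_le_mul_right ?_ hsa
      calc (1 + c ^ 2) * (sin a * sin b) * sin a = (1 + c ^ 2) * sin a ^ 2 * sin b := by ring
        _ ≤ sin (m * a) ^ 2 * sin b := by gcongr
        _ ≤ _ := h2
    _ ≤ _ := hnum

theorem sin_nat_mul_le {x : ℝ} (hx : 0 ≤ x) (k : ℕ) (hk : k * x ≤ pi) : sin (k * x) ≤ k * sin x := by
  have h0 : 0 ≤ sin x ∨ k = 0 := by
    rcases Nat.eq_zero_or_pos k with h | h
    · exact Or.inr h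
    · refine Or.inl (Real.sin_nonneg_of_nonneg_of_le_pi hx ?_)
      have : (1 : ℝ) ≤ k := by exact_mod_cast h
      nlinarith
  rcases h0 with h0 | rfl
  · induction k with
    | zero => simp
    | succ k ih =>
      push_cast at hk ⊢
      have hk' : k * x ≤ pi := by linarith
      have h1 := ih hk'
      have h2 : 0 ≤ sin (k * x) := Real.sin_nonneg_of_nonneg_of_le_pi (by positivity) hk'
      rw [add_mul, one_mul, Real.sin_add]
      have h3 := Real.cos_le_one x
      have h4 := Real.cos_le_one (k * x)
      nlinarith
  · simp

/-- The angle `π / 7` that the general choice would give just fails, since `4 * cos (π / 7) ^ 2 < 13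
/ 4`. Here `a` is chosen with `cos a ^ 2 = 13 / 16`, which makes the first block condition an
equality. -/
theorem arsinh_le_of_isOrthoBound_six {L : ℝ} (hL : IsOrthoBound 6 L) :
    2 * arsinh (√3 / 2 * cot (pi / 6)) ≤ L := by
  have hpi := Real.pi_pos
  have h3 : √3 ^ 2 = 3 := Real.sq_sqrt (by norm_num)
  have h30 : 0 < √3 := by positivity
  have h32 : √3 < 2 := by nlinarith
  set a := Real.arcsin (√3 / 4) with ha
  have hsa : sin a = √3 / 4 := Real.sin_arcsin (by linarith) (by linarith)
  have ha0 : 0 < a := Real.arcsin_pos.2 (by positivity)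
  have ha6 : a ≤ pi / 6 := by
    rw [ha, Real.arcsin_le_iff_le_sin ⟨by linarith, by linarith⟩ ⟨by linarith, by linarith⟩,
      Real.sin_pi_div_six]
    linarith
  have hcos : cos a ^ 2 = 13 / 16 := by rw [Real.cos_sq', hsa, div_pow, h3]; norm_num
  have hs2 : sin (2 * a) ^ 2 = 39 / 64 := by
    rw [Real.sin_two_mul, mul_pow, mul_pow, hcos, hsa, div_pow, h3]; norm_num
  have hs3 : sin (3 * a) = 9 / 4 * sin a := by
    rw [Real.sin_three_mul, hsa]; linear_combination (-(√3) / 16) * h3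
  have hsb : sin (pi / 2 - 2 * a) = 5 / 8 := by
    rw [Real.sin_pi_div_two_sub, Real.cos_two_mul, hcos]; norm_num
  refine arsinh_le_of_block (m := 2) le_rfl (a := a) (b := pi / 2 - 2 * a) ha0 (by linarith)
    (by push_cast; ring) ?_ ?_ hL
  · rw [one_add_sq_mul_cot (by rw [Real.sin_pi_div_six]; norm_num), Real.sin_pi_div_six]
    push_cast
    rw [hs2, hsa, div_pow √3, h3]
    norm_num
  · push_cast
    rw [hs2, hsb, show (2 + 1 : ℝ) * a = 3 * a by norm_num, hs3, hsa]
    have h17 : (1.7 : ℝ) < √3 := by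
      rw [Real.lt_sqrt (by norm_num)]; norm_num
    have : (9 / 4 * (√3 / 4)) ^ 2 * (√3 / 4) = 243 / 1024 * √3 := by
      linear_combination (81 / 1024 * √3) * h3
    rw [this]
    linarith

/-- Bounds from below the gain `sin x / sin a` when `a = π / (3 m + 1)` and `x = π / (3 m)`; the
constant `0.318` is just below `1 / π`. -/
theorem mul_sin_le_sin_add {a : ℝ} (ha : 0 < a) (ha1 : a ≤ 0.315) :
    (1 + 0.318 * a - 0.06 * a ^ 2) * sin a ≤ sin (a + 0.318 * a ^ 2) := by
  have hpi := Real.pi_gt_three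
  have hsa : 0 < sin a := Real.sin_pos_of_pos_of_lt_pi ha (by linarith)
  have hsq : a ^ 2 ≤ 0.1 := (pow_le_pow_left₀ ha.le ha1 2).trans (by norm_num)
  obtain ⟨ε, hε⟩ : ∃ ε, ε = 0.318 * a ^ 2 := ⟨_, rfl⟩
  have hε0 : 0 < ε := by rw [hε]; positivity
  have hε2 : ε ^ 2 = 0.101124 * a ^ 4 := by rw [hε]; ring
  have p3 : a ^ 4 ≤ 0.1 * a ^ 2 := by
    linarith [mul_le_mul_of_nonneg_right hsq (sq_nonneg a)]
  have hca : 1 - a ^ 2 / 2 ≤ cos a := Real.one_sub_sq_div_two_le_cos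
  have hcε : 1 - ε ^ 2 / 2 ≤ cos ε := Real.one_sub_sq_div_two_le_cos
  have hsε : ε - ε ^ 3 / 6 < sin ε := Real.sin_gt_sub_cube hε0
  rw [← hε, Real.sin_add]
  have k0 : 0 ≤ 1 - a ^ 2 / 2 := by linarith
  have k1 : 0 ≤ 1 - ε ^ 2 / 6 := by linarith
  have k2 : (1 - a ^ 2 / 2) * (ε - ε ^ 3 / 6) ≤ cos a * sin ε := by
    refine mul_le_mul hca hsε.le ?_ (k0.trans hca)
    rw [show ε - ε ^ 3 / 6 = ε * (1 - ε ^ 2 / 6) by ring]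
    positivity
  have k3 : 0 ≤ 0.318 * a * (1 - a ^ 2 / 2) * (1 - ε ^ 2 / 6) := by positivity
  have k4 : sin a * (0.318 * a * (1 - a ^ 2 / 2) * (1 - ε ^ 2 / 6)) ≤
      (1 - a ^ 2 / 2) * (ε - ε ^ 3 / 6) :=
    calc _ ≤ a * (0.318 * a * (1 - a ^ 2 / 2) * (1 - ε ^ 2 / 6)) :=
          mul_le_mul_of_nonneg_right (Real.sin_le ha.le) k3
      _ = _ := by rw [hε]; ring
  have k5 : 1 + 0.318 * a - 0.06 * a ^ 2 ≤
      1 - ε ^ 2 / 2 + 0.318 * a * (1 - a ^ 2 / 2) * (1 - ε ^ 2 / 6) := by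
    rw [hε2]
    have p2 : 0 ≤ a ^ 2 * (0.315 - a) := mul_nonneg (sq_nonneg a) (by linarith)
    have p4 : a * a ^ 4 ≤ a * (0.1 * a ^ 2) := mul_le_mul_of_nonneg_left p3 ha.le
    have p5 : 0 ≤ a ^ 7 := by positivity
    have p6 : 0 ≤ a ^ 3 := by positivity
    linarith
  have k6 := mul_le_mul_of_nonneg_right k5 hsa.le
  have k7 := mul_le_mul_of_nonneg_left hcε hsa.le
  linarith

/-- Bounds the loss from shrinking `π / 3` to `m * a = π / 3 - a / 3`; the constant `0.289` is just
above `√3 / 6`. -/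
theorem le_sq_sin_pi_div_three_sub {a : ℝ} (ha : 0 < a) (ha1 : a ≤ 1) :
    3 / 4 - 0.289 * a - a ^ 2 / 18 ≤ sin (pi / 3 - a / 3) ^ 2 := by
  have hpi := Real.pi_gt_three
  have h3 : √3 ^ 2 = 3 := Real.sq_sqrt (by norm_num)
  have h32 : √3 ≤ 1.733 := by
    rw [Real.sqrt_le_left (by norm_num)]; norm_num
  have y0 : 0 ≤ sin (a / 3) := Real.sin_nonneg_of_nonneg_of_le_pi (by linarith) (by linarith)
  have y1 : sin (a / 3) ≤ a / 3 := Real.sin_le (by linarith)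
  have y3 := Real.sin_sq_add_cos_sq (a / 3)
  have e : sin (pi / 3 - a / 3) ^ 2 =
      3 / 4 - sin (a / 3) ^ 2 / 2 - √3 / 2 * (sin (a / 3) * cos (a / 3)) := by
    rw [Real.sin_sub, Real.sin_pi_div_three, Real.cos_pi_div_three]
    linear_combination (cos (a / 3) ^ 2 / 4) * h3 + 3 / 4 * y3
  have y4 : sin (a / 3) ^ 2 ≤ (a / 3) ^ 2 := pow_le_pow_left₀ y0 y1 2
  have y5 : sin (a / 3) * cos (a / 3) ≤ a / 3 :=
    (mul_le_of_le_one_right y0 (Real.cos_le_one _)).trans y1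
  have y6 : √3 / 2 * (sin (a / 3) * cos (a / 3)) ≤ 1.733 / 2 * (a / 3) :=
    (mul_le_mul_of_nonneg_left y5 (by positivity)).trans
      (mul_le_mul_of_nonneg_right (by linarith) (by positivity))
  rw [e]
  linarith

theorem three_quarters_le_mul_sq {a : ℝ} (ha : 0 < a) (ha1 : a ≤ 0.315) :
    3 / 4 ≤ (3 / 4 - 0.289 * a - a ^ 2 / 18 - a ^ 2 / 4) *
      (1 + 0.318 * a - 0.06 * a ^ 2) ^ 2 := by
  have p2 : 0 ≤ a ^ 2 * (0.315 - a) := mul_nonneg (sq_nonneg a) (by linarith)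
  have p3 : 0 ≤ a * (0.315 - a) := mul_nonneg ha.le (by linarith)
  have p4 : 0 ≤ a ^ 4 := by positivity
  have q1 : 1 + 0.636 * a - 0.031 * a ^ 2 ≤ (1 + 0.318 * a - 0.06 * a ^ 2) ^ 2 := by
    linarith [sq_nonneg a]
  have q2 : 0 ≤ 3 / 4 - 0.289 * a - a ^ 2 / 18 - a ^ 2 / 4 := by linarith
  refine le_trans ?_ (mul_le_mul_of_nonneg_left q1 q2)
  linarith

/-- Estimate behind the choice of angles for polygons whose number of sides is divisible by three. -/
theorem block_estimate {a x : ℝ} (ha : 0 < a) (ha1 : a ≤ 0.315) (hx : a + 0.318 * a ^ 2 ≤ x)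
    (hx1 : x ≤ pi / 2) :
    (3 / 4 + sin x ^ 2 / 4) * sin a ^ 2 ≤ sin (pi / 3 - a / 3) ^ 2 * sin x ^ 2 := by
  have hpi := Real.pi_gt_three
  have hsa : 0 < sin a := Real.sin_pos_of_pos_of_lt_pi ha (by linarith)
  have hs2 : sin a ^ 2 ≤ a ^ 2 := pow_le_pow_left₀ hsa.le (Real.sin_le ha.le) 2
  have ha2 : a ^ 2 ≤ 0.1 := (pow_le_pow_left₀ ha.le ha1 2).trans (by norm_num)
  have hratio := (mul_sin_le_sin_add ha ha1).trans
    (Real.sin_le_sin_of_le_of_le_pi_div_two (by linarith [sq_nonneg a]) hx1 hx)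
  have hS := le_sq_sin_pi_div_three_sub ha (by linarith)
  have hpoly := three_quarters_le_mul_sq ha ha1
  -- Moving `sin x ^ 2 * sin a ^ 2 / 4` to the right, `t` bounds the factor of `sin x ^ 2` from
  -- below and `r` bounds `sin x / sin a`. The claim then reduces to `3 / 4 ≤ t * r ^ 2`.
  obtain ⟨r, hr⟩ : ∃ r, r = 1 + 0.318 * a - 0.06 * a ^ 2 := ⟨_, rfl⟩
  obtain ⟨t, ht⟩ : ∃ t, t = 3 / 4 - 0.289 * a - a ^ 2 / 18 - a ^ 2 / 4 := ⟨_, rfl⟩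
  have hr0 : 0 ≤ r := by linarith
  have ht0 : 0 ≤ t := by linarith
  rw [← hr] at hratio hpoly
  rw [← ht] at hpoly
  have hsq : (r * sin a) ^ 2 ≤ sin x ^ 2 := pow_le_pow_left₀ (mul_nonneg hr0 hsa.le) hratio 2
  have k1 := mul_le_mul_of_nonneg_right hpoly (sq_nonneg (sin a))
  have k2 := mul_le_mul_of_nonneg_left hsq ht0
  have k3 : t * sin x ^ 2 ≤ (sin (pi / 3 - a / 3) ^ 2 - sin a ^ 2 / 4) * sin x ^ 2 :=
    mul_le_mul_of_nonneg_right (by linarith) (sq_nonneg _)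
  linarith

theorem arsinh_le_of_three_mul {m : ℕ} (hm : 3 ≤ m) {L : ℝ} (hL : IsOrthoBound (3 * m) L) :
    2 * arsinh (√3 / 2 * cot (pi / (3 * m : ℕ))) ≤ L := by
  have hpi := Real.pi_pos
  have hm' : (3 : ℝ) ≤ m := by exact_mod_cast hm
  -- With `m * b = (m + 1) * a` the total angle is `(3 * m + 1) * a = π`. For `m ≥ 3` this gives `a
  -- ≤ π / 10 < 0.315`.
  set a := pi / (3 * m + 1) with ha
  have ha0 : 0 < a := by positivity
  have hma : (3 * m + 1) * a = pi := by rw [ha]; field_simp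
  set b := (1 + 1 / m) * a with hb
  have hab : a ≤ b := by
    rw [hb]
    have : 0 < 1 / (m : ℝ) * a := by positivity
    linarith
  have hmb : m * b = (m + 1) * a := by rw [hb]; field_simp
  set x := pi / (3 * m : ℕ) with hx
  have hmx : 3 * m * x = pi := by rw [hx]; push_cast; field_simp
  have hx0 : 0 < x := by
    rw [hx]; push_cast; positivity
  have hxpi : x ≤ pi / 2 := by nlinarith
  have hsx : 0 < sin x := Real.sin_pos_of_pos_of_lt_pi hx0 (by linarith)
  have hsa : 0 < sin a := Real.sin_pos_of_pos_of_lt_pi ha0 (by nlinarith)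
  refine arsinh_le_of_block (by omega) ha0 hab (by rw [hmb]; linarith) ?_ ?_ hL
  · rw [one_add_sq_mul_cot hsx.ne', div_mul_eq_mul_div, div_le_iff₀ (by positivity),
      show (m : ℝ) * a = pi / 3 - a / 3 by linarith]
    refine block_estimate ha0 ?_ ?_ hxpi
    · have := Real.pi_lt_d2
      nlinarith
    · have h1 : (x - a) * (3 * m) = a := by linarith
      have h2 : (x - a) * pi = a ^ 2 + a * (x - a) := by
        rw [← hma]; linear_combination a * h1
      have h3 : 0 < x - a := by
        by_contra hcon
        have : (x - a) * (3 * m) ≤ 0 := mul_nonpos_of_nonpos_of_nonneg (by linarith) (by positivity)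
        linarith
      have h4 := Real.pi_lt_d4
      have h5 : 0.318 * a ^ 2 * pi ≤ (x - a) * pi := by nlinarith [mul_pos ha0 h3, sq_nonneg a]
      linarith [le_of_mul_le_mul_right h5 hpi]
  · have hsum : sin ((m + 1) * a) ^ 2 = sin (m * a) ^ 2 + sin (m * a) * sin a := by
      have e1 : sin ((m + 1) * a + m * a) = sin (m * a) := by
        rw [← Real.sin_pi_sub (m * a)]; congr 1; linarith
      have e2 : sin ((m + 1) * a - m * a) = sin a := by congr 1; ring
      have e3 : sin ((m + 1) * a + m * a) * sin ((m + 1) * a - m * a) =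
          sin ((m + 1) * a) ^ 2 - sin (m * a) ^ 2 := by
        rw [Real.sin_add, Real.sin_sub]
        linear_combination sin ((m + 1) * a) ^ 2 * Real.sin_sq_add_cos_sq (m * a) -
          sin (m * a) ^ 2 * Real.sin_sq_add_cos_sq ((m + 1) * a)
      rw [e1, e2] at e3
      linarith
    have hm0 : (0 : ℝ) < m := by linarith
    have ha2 : a < pi / 2 := by nlinarith
    have hcos : 0 < cos a := Real.cos_pos_of_mem_Ioo ⟨by linarith, ha2⟩
    have hsb : sin b ≤ (1 + 1 / m) * sin a := by
      have t1 : a * cos a ≤ sin a := by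
        have := Real.lt_tan ha0 ha2
        rw [Real.tan_eq_sin_div_cos, lt_div_iff₀ hcos] at this
        exact this.le
      have t2 : sin (a / m) ≤ a / m := Real.sin_le (by positivity)
      have t3 : cos a * sin (a / m) ≤ 1 / m * sin a :=
        calc cos a * sin (a / m) ≤ cos a * (a / m) := by gcongr
          _ = 1 / m * (a * cos a) := by ring
          _ ≤ _ := by gcongr
      have t4 := mul_le_mul_of_nonneg_left (Real.cos_le_one (a / m)) hsa.le
      rw [show b = a + a / m by rw [hb]; ring, Real.sin_add]
      linarith
    have hsm0 : 0 ≤ sin (m * a) := Real.sin_nonneg_of_nonneg_of_le_pi (by positivity) (by nlinarith)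
    have hsm : sin (m * a) ≤ m * sin a := sin_nat_mul_le ha0.le m (by nlinarith)
    have hsm' : 1 / m * sin (m * a) ≤ sin a := by
      rw [one_div, inv_mul_le_iff₀ hm0]; exact hsm
    calc sin (m * a) ^ 2 * sin b ≤ sin (m * a) ^ 2 * ((1 + 1 / m) * sin a) := by gcongr
      _ = (sin (m * a) ^ 2 + sin (m * a) * (1 / m * sin (m * a))) * sin a := by ring
      _ ≤ (sin (m * a) ^ 2 + sin (m * a) * sin a) * sin a := by gcongr
      _ = _ := by rw [hsum]

/-- The lower bound for the optimal constant. -/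
theorem arsinh_le_of_isOrthoBound_of_four_le {n : ℕ} (hn : 4 ≤ n) {L : ℝ} (hL : IsOrthoBound n L) :
    2 * arsinh (√3 / 2 * cot (pi / n)) ≤ L := by
  by_cases h : 3 ∣ n
  · obtain ⟨m, rfl⟩ := h
    rcases (show 2 ≤ m by omega).eq_or_lt with rfl | hm
    · have := arsinh_le_of_isOrthoBound_six hL
      exact_mod_cast this
    · exact arsinh_le_of_three_mul hm hL
  · exact arsinh_le_of_not_three_dvd hn h hL

end LowerBound

/-! ### Asymptotics of the optimal constant, and the theorem. -/

theorem Real.log_le_arsinh {y : ℝ} (hy : 0 < y) : Real.log y ≤ Real.arsinh y :=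
  Real.log_le_log hy (le_add_of_nonneg_right (Real.sqrt_nonneg _))

theorem Real.arcosh_le_log {y : ℝ} (hy : 1 ≤ y) : Real.arcosh y ≤ Real.log (2 * y) := by
  refine Real.log_le_log (by positivity) ?_
  have : √(y ^ 2 - 1) ≤ y := Real.sqrt_le_iff.2 ⟨by linarith, by linarith⟩
  linarith

theorem isLeast_orthoConst_of_four_le {n : ℕ} (hn : 4 ≤ n) :
    IsLeast {L : ℝ | IsOrthoBound n L} (orthoConst n) :=
  have : NeZero n := ⟨by omega⟩
  isLeast_orthoConst (fun _ hL => arsinh_le_of_isOrthoBound_of_four_le hn hL)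
    (isOrthoBound_arcosh hn)

theorem orthoConst_le_two_mul_log {n : ℕ} (hn : 4 ≤ n) : orthoConst n ≤ 2 * Real.log n := by
  have hn' : (4 : ℝ) ≤ n := by exact_mod_cast hn
  have hpi := Real.pi_pos
  refine ((isLeast_orthoConst_of_four_le hn).2 (isOrthoBound_arcosh hn)).trans ?_
  have hle : Real.pi / n ≤ Real.pi / 2 := by gcongr; linarith
  -- Jordan's inequality makes `2 / sin (π / n)` at most `n`, so no additive constant remains.
  have hsin : 2 / (n : ℝ) ≤ Real.sin (Real.pi / n) := by
    have := Real.mul_le_sin (x := Real.pi / n) (by positivity) hle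
    rwa [div_mul_div_cancel₀ hpi.ne'] at this
  have hs0 : 0 < Real.sin (Real.pi / n) := lt_of_lt_of_le (by positivity) hsin
  have h1 : 1 ≤ 1 / Real.sin (Real.pi / n) := (one_le_div hs0).2 (Real.sin_le_one _)
  refine mul_le_mul_of_nonneg_left ((Real.arcosh_le_log h1).trans ?_) (by norm_num)
  refine Real.log_le_log (by positivity) ?_
  rw [mul_one_div, div_le_iff₀ hs0, ← div_le_iff₀' (by positivity)]
  exact hsin

theorem two_mul_log_sub_le_orthoConst {n : ℕ} (hn : 4 ≤ n) :
    2 * Real.log n - 2 * Real.log 16 ≤ orthoConst n := by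
  have hn' : (4 : ℝ) ≤ n := by exact_mod_cast hn
  have hn0 : (0 : ℝ) < n := by linarith
  have hpi := Real.pi_pos
  refine le_trans ?_ (arsinh_le_of_isOrthoBound_of_four_le hn (isLeast_orthoConst_of_four_le hn).1)
  have hle : Real.pi / n ≤ Real.pi / 3 := by gcongr; linarith
  have hx0 : 0 < Real.pi / n := by positivity
  have hcos : 1 / 2 ≤ Real.cos (Real.pi / n) := by
    rw [← Real.cos_pi_div_three]
    exact Real.cos_le_cos_of_nonneg_of_le_pi hx0.le (by linarith) hle
  have hs0 : 0 < Real.sin (Real.pi / n) := Real.sin_pos_of_pos_of_lt_pi hx0 (by linarith)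
  -- Any linear lower bound suffices for the limit; this one uses `cos ≥ 1 / 2` and `π ≤ 4`.
  have hcot : (n : ℝ) / 8 ≤ Real.cot (Real.pi / n) := by
    rw [Real.cot_eq_cos_div_sin, le_div_iff₀ hs0]
    have h1 : Real.sin (Real.pi / n) ≤ 4 / n :=
      (Real.sin_le hx0.le).trans (by gcongr; exact Real.pi_le_four)
    calc (n : ℝ) / 8 * Real.sin (Real.pi / n) ≤ n / 8 * (4 / n) := by gcongr
      _ = 1 / 2 := by field_simp; norm_num
      _ ≤ _ := hcos
  have h3 : 1 ≤ √3 := Real.one_le_sqrt.2 (by norm_num)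
  have hy : (n : ℝ) / 16 ≤ √3 / 2 * Real.cot (Real.pi / n) :=
    calc (n : ℝ) / 16 = 1 / 2 * (n / 8) := by ring
      _ ≤ _ := by gcongr
  have := (Real.log_le_log (by positivity) hy).trans
    (Real.log_le_arsinh (lt_of_lt_of_le (by positivity) hy))
  rw [Real.log_div hn0.ne' (by norm_num)] at this
  linarith

theorem tendsto_orthoConst_div :
    Filter.Tendsto (fun n : ℕ => orthoConst n / (2 * Real.log n)) Filter.atTop (nhds 1) := by
  have hlog : Filter.Tendsto (fun n : ℕ => Real.log n) Filter.atTop Filter.atTop :=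
    Real.tendsto_log_atTop.comp tendsto_natCast_atTop_atTop
  have hlow : Filter.Tendsto (fun n : ℕ => 1 - Real.log 16 / Real.log n) Filter.atTop (nhds 1) := by
    simpa using tendsto_const_nhds.sub (hlog.const_div_atTop (Real.log 16))
  have hpos : ∀ᶠ n : ℕ in Filter.atTop, 4 ≤ n ∧ 0 < Real.log n :=
    (Filter.eventually_ge_atTop 4).and (hlog.eventually_gt_atTop 0)
  refine tendsto_of_tendsto_of_tendsto_of_le_of_le' hlow tendsto_const_nhds ?_ ?_
  · filter_upwards [hpos] with n ⟨hn, h0⟩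
    rw [le_div_iff₀ (by positivity)]
    refine le_trans (le_of_eq ?_) (two_mul_log_sub_le_orthoConst hn)
    field_simp
  · filter_upwards [hpos] with n ⟨hn, h0⟩
    exact div_le_one_of_le₀ (orthoConst_le_two_mul_log hn) (by positivity)

theorem theorem1 :
    (∀ n : ℕ, 4 ≤ n →
      (∀ P : IdealPolygon n, ∃ μ : Fin (n - 3) → P.Orthogeodesic,
        Function.Injective μ ∧ P.IsOrthogeodesicDecomposition (Set.range μ) ∧
          ∀ k, (μ k).length ≤ orthoConst n) ∧
      IsLeast {L : ℝ | IsOrthoBound n L} (orthoConst n) ∧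
      2 * Real.arsinh (√3 / 2 * Real.cot (Real.pi / n)) ≤ orthoConst n ∧
      orthoConst n ≤ 2 * Real.arcosh (1 / Real.sin (Real.pi / n))) ∧
    Filter.Tendsto (fun n : ℕ => orthoConst n / (2 * Real.log n)) Filter.atTop (nhds 1) := by
  refine ⟨fun n hn => ?_, tendsto_orthoConst_div⟩
  have hleast := isLeast_orthoConst_of_four_le hn
  refine ⟨fun P => ?_, hleast, arsinh_le_of_isOrthoBound_of_four_le hn hleast.1,
    hleast.2 (isOrthoBound_arcosh hn)⟩
  have : NeZero n := ⟨by omega⟩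
  obtain ⟨D, hD, hlen⟩ := hleast.1 P
  have hcard : Nat.card D = n - 3 := hD.ncard_eq (by omega)
  let e : Fin (n - 3) ≃ D := (Finite.equivFinOfCardEq hcard).symm
  have hrange : Set.range (fun k => (e k : P.Orthogeodesic)) = D := by
    rw [← Function.comp_def, e.surjective.range_comp, Subtype.range_coe]
  refine ⟨fun k => e k, Subtype.val_injective.comp e.injective, ?_, fun k => hlen _ (e k).2⟩
  rw [hrange]
  exact hD
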